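/- Let $\mathbb{Z}_0=\mathbb{Z}\setminus\{0\}$ and, for $s\in\mathbb{R}$, let $\dot H^s$ be the space of real-valued $2\pi$-periodic functions (distributions) with mean value zero, identified with sequences of Fourier coefficients $v=(v_k)_{k\in\mathbb{Z}_0}$ with $v_{-k}=\overline{v_k}$ and $\|v\|_{\dot H^s}^2=\sum_{k\in\mathbb{Z}_0}|k|^{2s}|v_k|^2<\infty$; $\|\cdot\|_{\dot H^0}$ is the normalized $L_2$ norm. Consider the KdV equation $\partial_tu=u\,\partial_xu+\partial_x^3u$ in the variables $u_k(t)=e^{-ik^3t}v_k(t)$, that is, $$\partial_tv_k=B_1(v,v)_k:=\tfrac12\,ik\sum_{k_1+k_2=k}e^{3ikk_1k_2t}v_{k_1}v_{k_2},\qquad v_k(0)=v_k^0,\qquad k\in\mathbb{Z}_0. \tag{1}$$ A function $v\in L_\infty([0,T];\dot H^0)$ is called a solution of (1) over $[0,T]$ if for every $k\in\mathbb{Z}_0$ and every $t\in[0,T]$ $$v_k(t)-v_k(0)=\tfrac12\,ik\int_0^t\sum_{k_1+k_2=k}e^{3ikk_1k_2t'}v_{k_1}(t')v_{k_2}(t')\,dt',\qquad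 v(0)=v^0.$$ For $m\in\mathbb{N}$ let $\Pi_m$ be the projection onto the Fourier modes $|k|\le m$, and let $v^{(m)}$ be the solution of the Galerkin system $\partial_tv^{(m)}=\Pi_mB_1(\Pi_mv^{(m)},\Pi_mv^{(m)})$, $v^{(m)}(0)=v^0$. **Theorem.** Let $s>1/2$ and $T>0$. (a) For every $v^0\in\dot H^s$ there is a solution $v^\infty$ of (1) over $[0,T]$ which, for every $0<\sigma<s$, is the limit of a subsequence of $v^{(m)}$ strongly in $L_p([0,T];\dot H^\sigma)$ for all $1<p<\infty$ and $*$-weakly in $L_\infty([0,T];\dot H^s)$. It is the unique solution of (1) over $[0,T]$ with initial data $v^0$, it belongs to $C([0,T];\dot H^s)$, and $\|v^\infty(t)\|_{\dot H^0}=\|v^0\|_{\dot H^0}$ for all $t\in[0,T]$. (b) The solutions depend Lipschitz continuously on the initial data: there are $C'=C'(s,T,R)\ge0$ and $T^*=T^*(s,T,R)>0$ such that for any two solutions $v,w$ of (1) over $[0,T]$ with initial data $v^0,w^0\in\dot H^s$ and $R=\|v^0\|_{\dot H^s}+\|w^0\|_{\dot H^s}$, $$\|w(t)-v(t)\|_{\dot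 H^s}\le\bigl(C'(s,T,R)+1\bigr)^N\|w^0-v^0\|_{\dot H^s},\qquad N=[T/T^*]+1,\qquad t\in[0,T].$$ -/

import Mathlib

open MeasureTheory Filter Topology

namespace PeriodicKdV

noncomputable section

/-- The homogeneous Sobolev space `Ḣ^s` of real-valued mean-zero `2π`-periodic functions,
described by Fourier coefficients: a sequence `a : ℤ → ℂ` with `a 0 = 0` (zero mean),
`a (-k) = conj (a k)` (real-valued function) and `∑ |k|^(2s) |a k|² < ∞`. -/
structure MemHdot (s : ℝ) (a : ℤ → ℂ) : Prop where
  zero_mode : a 0 = 0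
  real_valued : ∀ k : ℤ, a (-k) = (starRingEnd ℂ) (a k)
  summable : Summable fun k : ℤ => |(k : ℝ)| ^ (2 * s) * ‖a k‖ ^ 2

/-- The norm of `Ḣ^s`: `‖a‖² = ∑_{k ≠ 0} |k|^(2s) |a k|²` (used for sequences with `a 0 = 0`).
For `s = 0` this is the normalized `L₂` norm. -/
def normHdot (s : ℝ) (a : ℤ → ℂ) : ℝ :=
  Real.sqrt (∑' k : ℤ, |(k : ℝ)| ^ (2 * s) * ‖a k‖ ^ 2)

/-- `v ∈ L_∞([0,T]; Ḣ^s)`. Measurability is stated for every Fourier coefficient, which for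
the separable Hilbert space `Ḣ^s` is the same as strong measurability. -/
structure MemLinfty (s T : ℝ) (v : ℝ → ℤ → ℂ) : Prop where
  aemeasurable : ∀ k : ℤ, AEMeasurable (fun t => v t k) (volume.restrict (Set.Icc 0 T))
  bounded : ∃ M : ℝ, ∀ᵐ t ∂(volume.restrict (Set.Icc 0 T)),
    MemHdot s (v t) ∧ normHdot s (v t) ≤ M

/-- `v ∈ C([0,T]; Ḣ^s)`. -/
structure MemC (s T : ℝ) (v : ℝ → ℤ → ℂ) : Prop where
  mem : ∀ t ∈ Set.Icc 0 T, MemHdot s (v t)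
  continuous : ∀ t₀ ∈ Set.Icc 0 T,
    Tendsto (fun t => normHdot s (v t - v t₀)) (𝓝[Set.Icc 0 T] t₀) (𝓝 0)

/-- The right-hand side of the KdV equation in the interaction variables:
`B₁(a, b)_k = ½ i k ∑_{k₁ + k₂ = k} exp(3 i k k₁ k₂ t) a_{k₁} b_{k₂}`, at time `t`.
For sequences vanishing at `0` only `k₁, k₂ ≠ 0` contribute. -/
def B₁ (t : ℝ) (a b : ℤ → ℂ) (k : ℤ) : ℂ :=
  (1 / 2 : ℂ) * Complex.I * (k : ℂ) *
    ∑' k₁ : ℤ, Complex.exp (Complex.I * 3 * (k : ℂ) * (k₁ : ℂ) * ((k - k₁ : ℤ) : ℂ) * (t : ℂ)) *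
      a k₁ * b (k - k₁)

/-- `v` is a solution over `[0,T]` of `∂ₜ v_k = B₁(v, v)_k`, `v(0) = v⁰`:
`v ∈ L_∞([0,T]; Ḣ⁰)`, and the equation integrated in time holds for all `t ∈ [0,T]` and all
`k ≠ 0`. The zeroth Fourier coefficient, which is not an unknown, is identically zero. -/
structure IsSolution (T : ℝ) (v₀ : ℤ → ℂ) (v : ℝ → ℤ → ℂ) : Prop where
  memLinfty : MemLinfty 0 T v
  zero_mode : ∀ t ∈ Set.Icc 0 T, v t 0 = 0
  initial : v 0 = v₀
  integrated : ∀ t ∈ Set.Icc 0 T, ∀ k : ℤ, k ≠ 0 →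
    v t k - v 0 k = ∫ τ in (0 : ℝ)..t, B₁ τ (v τ) (v τ) k

/-- The Fourier truncation `Π_m`. -/
def trunc (m : ℕ) (a : ℤ → ℂ) (k : ℤ) : ℂ :=
  if |k| ≤ (m : ℤ) then a k else 0

/-- `v` is the solution on `[0,T]` of the Galerkin system
`∂ₜ v_k = (Π_m B₁(Π_m v, Π_m v))_k`, `v(0) = v⁰`, with the full initial data `v⁰`. -/
structure IsGalerkinSolution (m : ℕ) (T : ℝ) (v₀ : ℤ → ℂ) (v : ℝ → ℤ → ℂ) : Prop where
  zero_mode : ∀ t ∈ Set.Icc 0 T, v t 0 = 0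
  initial : v 0 = v₀
  deriv : ∀ t ∈ Set.Icc 0 T, ∀ k : ℤ, k ≠ 0 →
    HasDerivWithinAt (fun τ => v τ k)
      (trunc m (B₁ t (trunc m (v t)) (trunc m (v t))) k) (Set.Icc 0 T) t

/-- `V j → v` strongly in `L_p([0,T]; Ḣ^σ)`. -/
def TendstoLp (σ T p : ℝ) (V : ℕ → ℝ → ℤ → ℂ) (v : ℝ → ℤ → ℂ) : Prop :=
  Tendsto (fun j => ∫⁻ t in Set.Icc 0 T, ENNReal.ofReal (normHdot σ (V j t - v t)) ^ p)
    atTop (𝓝 0)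

/-- `g ∈ L_1([0,T]; Ḣ^s)`. -/
structure MemL1 (s T : ℝ) (g : ℝ → ℤ → ℂ) : Prop where
  aemeasurable : ∀ k : ℤ, AEMeasurable (fun t => g t k) (volume.restrict (Set.Icc 0 T))
  mem : ∀ᵐ t ∂(volume.restrict (Set.Icc 0 T)), MemHdot s (g t)
  finite : ∫⁻ t in Set.Icc 0 T, ENNReal.ofReal (normHdot s (g t)) < ⊤

/-- `V j → v` *-weakly in `L_∞([0,T]; Ḣ^s)`, the dual of `L_1([0,T]; Ḣ^(-s))`. -/
def TendstoWeakStar (s T : ℝ) (V : ℕ → ℝ → ℤ → ℂ) (v : ℝ → ℤ → ℂ) : Prop :=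
  ∀ g : ℝ → ℤ → ℂ, MemL1 (-s) T g →
    Tendsto (fun j => ∫ t in (0 : ℝ)..T, ∑' k : ℤ, V j t k * (starRingEnd ℂ) (g t k))
      atTop (𝓝 (∫ t in (0 : ℝ)..T, ∑' k : ℤ, v t k * (starRingEnd ℂ) (g t k)))

/-- `v` is obtained from the Galerkin solutions with initial data `v⁰` as the limit of a
subsequence, strongly in `L_p([0,T]; Ḣ^σ)` for all `1 < p < ∞` and *-weakly in
`L_∞([0,T]; Ḣ^s)`. -/
def IsGalerkinLimit (s σ T : ℝ) (v₀ : ℤ → ℂ) (v : ℝ → ℤ → ℂ) : Prop :=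
  MemLinfty s T v ∧
  ∃ (φ : ℕ → ℕ) (V : ℕ → ℝ → ℤ → ℂ), StrictMono φ ∧
    (∀ j, IsGalerkinSolution (φ j) T v₀ (V j) ∧ MemLinfty s T (V j)) ∧
    (∀ p : ℝ, 1 < p → TendstoLp σ T p V v) ∧
    TendstoWeakStar s T V v

end

end PeriodicKdV

/-!
The proof rests on a normal form of the equation. Since `k³ = k₁³ + k₂³ + 3 k k₁ k₂` for
`k = k₁ + k₂`, the quadratic terms oscillate with the phase `3 k k₁ k₂ t`, and integrating by parts
in time gains the factor `1 / (k k₁ k₂)`, which cancels the derivative. The cubic terms produced in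
this way oscillate with the phase `3 (k₁ + k₂) (k₂ + k₃) (k₁ + k₃) t`; they are integrated by parts
again except at the resonances, where one of these sums vanishes. The integrations are made only
when some frequency exceeds a cutoff of order `N` (`IsCurve.isPrim_normalForm`). All multilinear
forms that remain are bounded on `ℓ²`, and the boundary terms carry a factor `1 / N`
(`formBound_kerBdry`, `formBound_kerBdry3`, `formBound_kerRes`, `formBound_kerQuart`). As the sum of
the frequencies is the output frequency, the weight `|k|^s` can be passed to one of the factors
(`FormBound.weighted_diff`). For large `N` the boundary terms are absorbed, and Gronwall's
inequality yields `exists_lipschitz`, for the equation and for its Galerkin truncations at once.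

This single estimate has three uses. With one of the two curves equal to zero it bounds the `Ḣ^s`
norm by a constant that depends only on the `L²` norm (`exists_apriori`). With `s = 0` it gives
uniqueness of solutions that are merely bounded in `L²` (`IsSolution.unique`). For curves bounded in
`Ḣ^s` it is the Lipschitz dependence on the initial data (`exists_lipschitz_hnorm`).

The Galerkin solutions conserve the `L²` norm, hence they exist globally (`exists_galerkin`) and are
bounded in `Ḣ^s` uniformly in the number of modes. Their Fourier coefficients are equi-Lipschitz in
time, so a subsequence converges for all times and frequencies (`exists_subseq_tendsto`). The bound
in `Ḣ^s` turns this into convergence in `Ḣ^σ` for `σ < s`, which includes `σ = 0`; thus the limit is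
a solution with the same `L²` norm (`exists_solution`), and the modes of convergence follow by
dominated convergence. Continuity in time with values in `Ḣ^s` is clear for data in `Ḣ^(s+1)`, and
passes to the limit by Lipschitz dependence on the data (`IsSolution.memC`).

The Lipschitz estimate is obtained on `[0, T]` at once, without dividing the interval, so that any
value of `T*` is admissible.
-/

namespace PeriodicKdV

open scoped ENNReal NNReal

/-! ### Square summable sequences with values in `[0, ∞]` -/

section

/-- The `ℓ²` norm of a family with values in `[0, ∞]`. -/
noncomputable def l2 {α : Type*} (f : α → ℝ≥0∞) : ℝ≥0∞ := (∑' k, f k ^ 2) ^ (1 / 2 : ℝ)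

section l2
variable {α : Type*}

lemma l2_sq (f : α → ℝ≥0∞) : l2 f ^ 2 = ∑' k, f k ^ 2 := by
  rw [l2, ← ENNReal.rpow_natCast, ← ENNReal.rpow_mul]; norm_num

lemma l2_le_iff {f : α → ℝ≥0∞} {c : ℝ≥0∞} : l2 f ≤ c ↔ ∑' k, f k ^ 2 ≤ c ^ 2 := by
  rw [← l2_sq]
  exact (ENNReal.pow_le_pow_left_iff two_ne_zero).symm

lemma l2_mono {f g : α → ℝ≥0∞} (h : ∀ k, f k ≤ g k) : l2 f ≤ l2 g := by
  rw [l2_le_iff, l2_sq]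
  exact ENNReal.tsum_le_tsum fun k => by gcongr; exact h k

lemma le_l2 (f : α → ℝ≥0∞) (k : α) : f k ≤ l2 f := by
  rw [← ENNReal.pow_le_pow_left_iff two_ne_zero, l2_sq]
  exact ENNReal.le_tsum (f := fun k => f k ^ 2) k

lemma l2_const_mul (c : ℝ≥0∞) (f : α → ℝ≥0∞) : l2 (fun k => c * f k) = c * l2 f := by
  rw [l2, l2]
  simp_rw [mul_pow]
  rw [ENNReal.tsum_mul_left, ENNReal.mul_rpow_of_nonneg _ _ (by norm_num),
    ← ENNReal.rpow_natCast, ← ENNReal.rpow_mul]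
  norm_num

/-- Minkowski's inequality, from the measure-theoretic one for the counting measure. -/
lemma l2_add_le (f g : α → ℝ≥0∞) : l2 (fun k => f k + g k) ≤ l2 f + l2 g := by
  let _ : MeasurableSpace α := ⊤
  have := ENNReal.lintegral_Lp_add_le (μ := Measure.count) (p := 2) (f := f) (g := g)
    measurable_from_top.aemeasurable measurable_from_top.aemeasurable (by norm_num)
  simpa [lintegral_count, l2] using this

/-- The Cauchy–Schwarz inequality. -/
lemma tsum_mul_le_l2 (f g : α → ℝ≥0∞) : ∑' k, f k * g k ≤ l2 f * l2 g := by
  let _ : MeasurableSpace α := ⊤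
  have := ENNReal.lintegral_mul_le_Lp_mul_Lq (Measure.count) (p := 2) (q := 2) (f := f) (g := g)
    (by constructor <;> norm_num) measurable_from_top.aemeasurable measurable_from_top.aemeasurable
  simpa [lintegral_count, l2] using this

lemma sq_tsum_mul_le (f g : α → ℝ≥0∞) :
    (∑' k, f k * g k) ^ 2 ≤ (∑' k, f k ^ 2) * ∑' k, g k ^ 2 := by
  rw [← l2_sq, ← l2_sq, ← mul_pow]
  gcongr
  exact tsum_mul_le_l2 f g

end l2

/-! ### Multilinear convolution forms -/

variable {J : Type*} {n : ℕ}

/-- The positive `n`-linear form with kernel `K`: its `k`-th coefficient is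
`∑ i, K k i * ∏ j, f j (e k i j)`, where the index `i` runs over the frequency tuples
`e k i` of total frequency `k`. -/
noncomputable def posForm (K : ℤ → J → ℝ≥0∞) (e : ℤ → J → Fin n → ℤ) (f : Fin n → ℤ → ℝ≥0∞)
    (k : ℤ) : ℝ≥0∞ := ∑' i, K k i * ∏ j, f j (e k i j)

/-- The positive form with kernel `K` is bounded by `κ` as a map `ℓ² × ⋯ × ℓ² → ℓ²`. -/
def FormBound (K : ℤ → J → ℝ≥0∞) (e : ℤ → J → Fin n → ℤ) (κ : ℝ≥0∞) : Prop :=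
  ∀ f : Fin n → ℤ → ℝ≥0∞, l2 (posForm K e f) ≤ κ * ∏ j, l2 (f j)

/-- A kernel that is square summable uniformly in the output frequency is bounded: this is the
Cauchy–Schwarz inequality together with Young's inequality `ℓ¹ * ⋯ * ℓ¹ → ℓ¹` for the squares. -/
lemma FormBound.of_sq {K : ℤ → J → ℝ≥0∞} {e : ℤ → J → Fin n → ℤ} {c : ℝ≥0∞}
    (hK : ∀ k, ∑' i, K k i ^ 2 ≤ c ^ 2)
    (he : ∀ F : Fin n → ℤ → ℝ≥0∞, ∑' k, ∑' i, ∏ j, F j (e k i j) ≤ ∏ j, ∑' k, F j k) :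
    FormBound K e c := fun f => by
  rw [l2_le_iff, mul_pow, ← Finset.prod_pow]
  simp_rw [l2_sq]
  calc ∑' k, posForm K e f k ^ 2
      ≤ ∑' k, c ^ 2 * ∑' i, ∏ j, f j (e k i j) ^ 2 := by
        refine ENNReal.tsum_le_tsum fun k => ?_
        refine (sq_tsum_mul_le _ _).trans ?_
        simp_rw [← Finset.prod_pow]
        gcongr
        exact hK k
    _ ≤ _ := by
        rw [ENNReal.tsum_mul_left]
        gcongr
        exact he fun j k => f j k ^ 2

/-- Frequency pairs of total frequency `k`. -/
def e2 (k i : ℤ) : Fin 2 → ℤ := ![i, k - i]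

/-- Frequency triples of total frequency `k`. -/
def e3 (k : ℤ) (i : ℤ × ℤ) : Fin 3 → ℤ := ![i.1, i.2, k - i.1 - i.2]

/-- Frequency quadruples of total frequency `k`, obtained from a triple by splitting its entry
number `r` into two; the two parts come first. -/
def e4 (r : Fin 3) (k : ℤ) (i : (ℤ × ℤ) × ℤ) : Fin 4 → ℤ :=
  ![i.2, e3 k i.1 r - i.2, e3 k i.1 (r.succAbove 0), e3 k i.1 (r.succAbove 1)]

lemma sum_e2 (k i : ℤ) : ∑ j, e2 k i j = k := by simp [e2, Fin.sum_univ_two]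

lemma sum_e3 (k : ℤ) (i : ℤ × ℤ) : ∑ j, e3 k i j = k := by
  simp [e3, Fin.sum_univ_three]

lemma sum_e4 (r : Fin 3) (k : ℤ) (i : (ℤ × ℤ) × ℤ) : ∑ j, e4 r k i j = k := by
  have h := sum_e3 k i.1
  rw [Fin.sum_univ_succAbove _ r, Fin.sum_univ_two] at h
  simp only [e4, Fin.sum_univ_four, Matrix.cons_val]
  linarith

lemma tsum_sub_left (F : ℤ → ℝ≥0∞) (k : ℤ) : ∑' i, F (k - i) = ∑' i, F i :=
  (Equiv.subLeft k).tsum_eq F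

lemma tsum_sub_right (F : ℤ → ℝ≥0∞) (k : ℤ) : ∑' i, F (i - k) = ∑' i, F i :=
  (Equiv.subRight k).tsum_eq F

lemma tsum_add_left (F : ℤ → ℝ≥0∞) (k : ℤ) : ∑' i, F (k + i) = ∑' i, F i :=
  (Equiv.addLeft k).tsum_eq F

lemma tsum_pair {α β : Type*} (F : α × β → ℝ≥0∞) : ∑' i, F i = ∑' a, ∑' b, F (a, b) :=
  ENNReal.tsum_prod (f := fun a b => F (a, b))

lemma young_e2 (F : Fin 2 → ℤ → ℝ≥0∞) :
    ∑' k, ∑' i, ∏ j, F j (e2 k i j) ≤ ∏ j, ∑' k, F j k := by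
  simp only [e2, Fin.prod_univ_two, Matrix.cons_val]
  rw [ENNReal.tsum_comm]
  simp_rw [ENNReal.tsum_mul_left, tsum_sub_right, ENNReal.tsum_mul_right]
  rfl

lemma young_e3 (F : Fin 3 → ℤ → ℝ≥0∞) :
    ∑' k, ∑' i, ∏ j, F j (e3 k i j) ≤ ∏ j, ∑' k, F j k := by
  simp only [e3, Fin.prod_univ_three, Matrix.cons_val]
  rw [ENNReal.tsum_comm]
  simp_rw [ENNReal.tsum_mul_left, sub_sub, tsum_sub_right, ENNReal.tsum_mul_right]
  rw [tsum_pair]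
  simp_rw [ENNReal.tsum_mul_left, ENNReal.tsum_mul_right]
  rfl

/-- In the quadrilinear forms, the convolution of the two factors that share the split frequency
is bounded uniformly in that frequency. -/
lemma FormBound.of_split {K : ℤ → ℤ × ℤ → ℝ≥0∞} {r : Fin 3} {κ : ℝ≥0∞}
    (h : ∀ x y : ℤ → ℝ≥0∞, l2 (fun k => ∑' i, K k i * (x (e3 k i (r.succAbove 0)) *
      y (e3 k i (r.succAbove 1)))) ≤ κ * (l2 x * l2 y)) :
    FormBound (fun k (i : (ℤ × ℤ) × ℤ) => K k i.1) (e4 r) κ := fun f => by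
  have hA (m : ℤ) : ∑' p, f 0 p * f 1 (m - p) ≤ l2 (f 0) * l2 (f 1) := by
    refine (tsum_mul_le_l2 _ _).trans_eq ?_
    congr 1
    rw [l2, l2, tsum_sub_left (fun p => f 1 p ^ 2)]
  calc l2 (posForm _ (e4 r) f)
      ≤ l2 (fun k => (l2 (f 0) * l2 (f 1)) * ∑' i, K k i * (f 2 (e3 k i (r.succAbove 0)) *
          f 3 (e3 k i (r.succAbove 1)))) := by
        refine l2_mono fun k => ?_
        rw [posForm, tsum_pair, ← ENNReal.tsum_mul_left]
        refine ENNReal.tsum_le_tsum fun i => ?_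
        simp only [e4, Fin.prod_univ_four, Matrix.cons_val]
        simp_rw [mul_assoc, ENNReal.tsum_mul_left, ← mul_assoc (f 0 _), ENNReal.tsum_mul_right]
        calc _ ≤ K k i * ((l2 (f 0) * l2 (f 1)) * _) := by gcongr; exact hA _
          _ = _ := by ring
    _ ≤ _ := by
        rw [l2_const_mul, Fin.prod_univ_four]
        calc _ ≤ (l2 (f 0) * l2 (f 1)) * (κ * (l2 (f 2) * l2 (f 3))) := by gcongr; exact h _ _
          _ = _ := by ring

/-- A weighted Cauchy–Schwarz inequality for bilinear expressions whose kernel is a product. -/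
lemma l2_bilinear_le {K₁ K₂ : ℤ → J → ℝ≥0∞} {p q : ℤ → J → ℤ} {x y : ℤ → ℝ≥0∞} {c₁ c₂ : ℝ≥0∞}
    (h₁ : ∀ k, ∑' i, K₁ k i ^ 2 * x (p k i) ^ 2 ≤ c₁ ^ 2 * ∑' k, x k ^ 2)
    (h₂ : ∑' k, ∑' i, K₂ k i ^ 2 * y (q k i) ^ 2 ≤ c₂ ^ 2 * ∑' k, y k ^ 2) :
    l2 (fun k => ∑' i, K₁ k i * K₂ k i * (x (p k i) * y (q k i))) ≤
      c₁ * c₂ * (l2 x * l2 y) := by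
  rw [l2_le_iff]
  simp_rw [mul_pow, l2_sq]
  calc _ ≤ ∑' k, (c₁ ^ 2 * ∑' k, x k ^ 2) * ∑' i, K₂ k i ^ 2 * y (q k i) ^ 2 := by
        refine ENNReal.tsum_le_tsum fun k => ?_
        simp_rw [fun i => mul_mul_mul_comm (K₁ k i) (K₂ k i)]
        refine (sq_tsum_mul_le _ _).trans ?_
        simp_rw [mul_pow]
        gcongr
        exact h₁ k
    _ ≤ (c₁ ^ 2 * ∑' k, x k ^ 2) * (c₂ ^ 2 * ∑' k, y k ^ 2) := by
        rw [ENNReal.tsum_mul_left]; gcongr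
    _ = _ := by ring

/-! ### The kernels of the normal form -/

/-- `1 / |k|`, with value `0` at `k = 0`. -/
noncomputable def invAbs (k : ℤ) : ℝ≥0∞ := ‖((k : ℂ))⁻¹‖ₑ

@[simp] lemma invAbs_zero : invAbs 0 = 0 := by simp [invAbs]

lemma invAbs_le_one (k : ℤ) : invAbs k ≤ 1 := by
  rcases eq_or_ne k 0 with rfl | hk
  · simp
  have : (1 : ℝ) ≤ |(k : ℝ)| := by exact_mod_cast Int.one_le_abs hk
  rw [invAbs, ← ofReal_norm, norm_inv, Complex.norm_intCast]
  exact ENNReal.ofReal_le_one.2 (inv_le_one_of_one_le₀ this)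

lemma enorm_mul_invAbs_le (k : ℤ) : ‖(k : ℂ)‖ₑ * invAbs k ≤ 1 := by
  rcases eq_or_ne k 0 with rfl | hk
  · simp
  rw [invAbs, ← enorm_mul, mul_inv_cancel₀ (by exact_mod_cast hk)]
  simp

lemma invAbs_le_of_lt {k : ℤ} {N : ℕ} (h : (N : ℤ) < |k|) : invAbs k ≤ (N : ℝ≥0∞)⁻¹ := by
  rw [ENNReal.le_inv_iff_mul_le, mul_comm]
  refine le_trans ?_ (enorm_mul_invAbs_le k)
  gcongr
  rw [← ofReal_norm, Complex.norm_intCast, ← ENNReal.ofReal_natCast]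
  exact ENNReal.ofReal_le_ofReal (by exact_mod_cast h.le)

/-- `∑ 1 / k²` over the nonzero integers. -/
noncomputable def zetaTwo : ℝ≥0∞ := ∑' k, invAbs k ^ 2

lemma zetaTwo_ne_top : zetaTwo ≠ ⊤ := by
  have : Summable fun k : ℤ => ‖((k : ℂ))⁻¹‖ ^ 2 := by
    have := Real.summable_one_div_int_pow (p := 2) |>.2 (by norm_num)
    refine this.congr fun k => ?_
    simp [Complex.norm_intCast]
  have h2 : zetaTwo = ∑' k : ℤ, ENNReal.ofReal (‖((k : ℂ))⁻¹‖ ^ 2) := by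
    refine tsum_congr fun k => ?_
    rw [invAbs, ENNReal.ofReal_pow (norm_nonneg _), ofReal_norm]
  rw [h2, ← ENNReal.ofReal_tsum_of_nonneg (fun _ => by positivity) this]
  exact ENNReal.ofReal_ne_top

lemma tsum_invAbs_sub_left (k : ℤ) : ∑' i, invAbs (k - i) ^ 2 = zetaTwo :=
  tsum_sub_left (fun i => invAbs i ^ 2) k

lemma tsum_invAbs_sub_right (k : ℤ) : ∑' i, invAbs (i - k) ^ 2 = zetaTwo :=
  tsum_sub_right (fun i => invAbs i ^ 2) k

lemma tsum_invAbs_add (k : ℤ) : ∑' i, invAbs (k + i) ^ 2 = zetaTwo :=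
  tsum_add_left (fun i => invAbs i ^ 2) k

end

lemma tsum_indicator_abs_le (N : ℕ) :
    ∑' i : ℤ, (if |i| ≤ (N : ℤ) then 1 else 0 : ℝ≥0∞) = 2 * N + 1 := by
  rw [tsum_eq_sum (s := Finset.Icc (-(N : ℤ)) N)
    (fun i hi => if_neg fun h => hi (Finset.mem_Icc.2 (abs_le.1 h)))]
  rw [Finset.sum_congr rfl fun i hi => if_pos (abs_le.2 (Finset.mem_Icc.1 hi))]
  have : (N + 1 + N : ℤ).toNat = 2 * N + 1 := by omega
  simp [this]

/-- Kernel of the quadratic terms at low frequencies. -/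
noncomputable def kerLow (N : ℕ) (k i : ℤ) : ℝ≥0∞ :=
  if |i| ≤ (N : ℤ) ∧ |k - i| ≤ (N : ℤ) then ‖(k : ℂ)‖ₑ else 0

lemma formBound_kerLow (N : ℕ) : FormBound (kerLow N) e2 (2 * N * (2 * N + 1)) := by
  refine .of_sq (fun k => ?_) young_e2
  have h (i : ℤ) : kerLow N k i ^ 2 ≤
      (2 * N) ^ 2 * (if |i| ≤ (N : ℤ) then 1 else 0 : ℝ≥0∞) := by
    unfold kerLow
    split_ifs with h1 h2
    · rw [mul_one]
      gcongr
      rw [← ofReal_norm, Complex.norm_intCast]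
      have : (2 * N : ℝ≥0∞) = ENNReal.ofReal (2 * N) := by
        rw [ENNReal.ofReal_mul zero_le_two]; simp
      rw [this]
      refine ENNReal.ofReal_le_ofReal ?_
      have : |k| ≤ 2 * N := by
        have := abs_add_le i (k - i)
        rw [add_sub_cancel] at this
        linarith
      exact_mod_cast this
    · exact absurd h1.1 h2
    all_goals simp
  refine (ENNReal.tsum_le_tsum h).trans ?_
  rw [ENNReal.tsum_mul_left, tsum_indicator_abs_le, mul_pow (2 * (N : ℝ≥0∞)) (2 * N + 1)]
  gcongr
  exact le_self_pow₀ (by simp) two_ne_zero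

/-- Kernel of the quadratic boundary terms, which only involve high frequencies. -/
noncomputable def kerBdry (N : ℕ) (k i : ℤ) : ℝ≥0∞ :=
  if |i| ≤ (N : ℤ) ∧ |k - i| ≤ (N : ℤ) then 0 else invAbs i * invAbs (k - i)

lemma formBound_kerBdry (N : ℕ) : FormBound (kerBdry N) e2 (2 * (1 + zetaTwo) * (N : ℝ≥0∞)⁻¹) := by
  refine .of_sq (fun k => ?_) young_e2
  have h (i : ℤ) : kerBdry N k i ^ 2 ≤
      (N : ℝ≥0∞)⁻¹ ^ 2 * (invAbs i ^ 2 + invAbs (k - i) ^ 2) := by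
    unfold kerBdry
    split_ifs with h1
    · simp
    · rw [mul_pow, mul_add]
      rw [not_and_or, not_le, not_le] at h1
      rcases h1 with h1 | h1
      · refine le_trans ?_ le_add_self
        gcongr
        exact invAbs_le_of_lt h1
      · refine le_trans ?_ le_self_add
        rw [mul_comm]
        gcongr
        exact invAbs_le_of_lt h1
  refine (ENNReal.tsum_le_tsum h).trans ?_
  rw [ENNReal.tsum_mul_left, ENNReal.tsum_add, tsum_invAbs_sub_left]
  change _ * (zetaTwo + zetaTwo) ≤ _
  rw [mul_pow _ (_⁻¹), mul_comm]
  gcongr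
  calc zetaTwo + zetaTwo ≤ (zetaTwo + zetaTwo) + (4 + 6 * zetaTwo + 4 * zetaTwo ^ 2) := le_self_add
    _ = _ := by ring

/-- Kernel of the resonant and low-frequency cubic terms. -/
noncomputable def kerRes (N : ℕ) (k : ℤ) (i : ℤ × ℤ) : ℝ≥0∞ :=
  if i.2 = -i.1 ∨ i.2 = k ∨ |i.2| ≤ ((2 * N : ℕ) : ℤ) then invAbs i.1 else 0

lemma formBound_kerRes (N : ℕ) : FormBound (kerRes N) e3 ((1 + zetaTwo) * (4 * N + 3)) := by
  refine .of_sq (fun k => ?_) young_e3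
  have h (i : ℤ × ℤ) : kerRes N k i ^ 2 ≤ invAbs i.1 ^ 2 * ((if i.2 = -i.1 then 1 else 0) +
      (if i.2 = k then 1 else 0) + (if |i.2| ≤ ((2 * N : ℕ) : ℤ) then 1 else 0)) := by
    unfold kerRes
    split_ifs with h1 <;> first | (exfalso; tauto) | skip
    all_goals
      first
        | simp only [ne_eq, OfNat.ofNat_ne_zero, not_false_eq_true, zero_pow, zero_le]
        | exact le_mul_of_one_le_right' (by norm_num [add_assoc])
  refine (ENNReal.tsum_le_tsum h).trans ?_
  rw [tsum_pair]
  simp_rw [ENNReal.tsum_mul_left, ENNReal.tsum_add, tsum_indicator_abs_le, tsum_ite_eq,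
    ENNReal.tsum_mul_right]
  change zetaTwo * _ ≤ _
  rw [mul_pow]
  gcongr
  · calc zetaTwo ≤ zetaTwo + (1 + zetaTwo + zetaTwo ^ 2) := le_self_add
      _ = _ := by ring
  · refine le_trans (le_of_eq ?_) (le_self_pow₀ ?_ two_ne_zero)
    · push_cast; ring
    · exact le_add_self.trans' (by norm_num)

/-- Kernel of the cubic boundary terms. With `i = (k₁, k₂)` and `k₃ = k - k₁ - k₂` the four
reciprocals are those of `k₁`, `k₁ + k₂`, `k₂ + k₃` and `k₁ + k₃`. -/
noncomputable def kerBdry3 (N : ℕ) (k : ℤ) (i : ℤ × ℤ) : ℝ≥0∞ :=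
  if |i.1| ≤ ((2 * N : ℕ) : ℤ) ∧ |i.2| ≤ ((2 * N : ℕ) : ℤ) ∧ |k - i.1 - i.2| ≤ ((2 * N : ℕ) : ℤ)
  then 0 else invAbs i.1 * invAbs (i.1 + i.2) * invAbs (k - i.1) * invAbs (k - i.2)

lemma tsum_pair_mul_left (f g : ℤ → ℤ → ℝ≥0∞) {a b : ℝ≥0∞} (hf : ∑' i, f i 0 = a)
    (hf' : ∀ i j, f i j = f i 0) (hg : ∀ i, ∑' j, g i j = b) :
    ∑' i : ℤ × ℤ, f i.1 i.2 * g i.1 i.2 = a * b := by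
  rw [tsum_pair]
  simp_rw [hf', ENNReal.tsum_mul_left, hg, ENNReal.tsum_mul_right, hf]

lemma formBound_kerBdry3 (N : ℕ) :
    FormBound (kerBdry3 N) e3 (2 * (1 + zetaTwo) * (N : ℝ≥0∞)⁻¹) := by
  refine .of_sq (fun k => ?_) young_e3
  have h (i : ℤ × ℤ) : kerBdry3 N k i ^ 2 ≤ (N : ℝ≥0∞)⁻¹ ^ 2 *
      (invAbs (k - i.1) ^ 2 * invAbs (i.1 + i.2) ^ 2 + invAbs i.1 ^ 2 * invAbs (k - i.2) ^ 2 +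
        invAbs i.1 ^ 2 * invAbs (i.1 + i.2) ^ 2) := by
    unfold kerBdry3
    have q1 := pow_le_one₀ (n := 2) (zero_le (a := invAbs i.1)) (invAbs_le_one _)
    have q2 := pow_le_one₀ (n := 2) (zero_le (a := invAbs (i.1 + i.2))) (invAbs_le_one _)
    have q3 := pow_le_one₀ (n := 2) (zero_le (a := invAbs (k - i.1))) (invAbs_le_one _)
    have q4 := pow_le_one₀ (n := 2) (zero_le (a := invAbs (k - i.2))) (invAbs_le_one _)
    split_ifs with h1
    · simp
    · -- `k₁`, `k₂`, `k₃` are combinations of `k₁`, `k₁ + k₂` and `k₁ + k₃`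
      have h2 : (N : ℤ) < |i.1| ∨ (N : ℤ) < |i.1 + i.2| ∨ (N : ℤ) < |k - i.2| := by
        by_contra! h3
        refine h1 ⟨?_, ?_, ?_⟩ <;> push_cast <;> grind
      simp only [mul_pow]
      rcases h2 with h2 | h2 | h2
      · have := pow_le_pow_left' (invAbs_le_of_lt h2) 2
        calc _ ≤ (N : ℝ≥0∞)⁻¹ ^ 2 * invAbs (i.1 + i.2) ^ 2 * invAbs (k - i.1) ^ 2 * 1 := by gcongr
          _ = (N : ℝ≥0∞)⁻¹ ^ 2 * (invAbs (k - i.1) ^ 2 * invAbs (i.1 + i.2) ^ 2) := by ring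
          _ ≤ _ := by gcongr; rw [add_assoc]; exact le_self_add
      · have := pow_le_pow_left' (invAbs_le_of_lt h2) 2
        calc _ ≤ invAbs i.1 ^ 2 * (N : ℝ≥0∞)⁻¹ ^ 2 * 1 * invAbs (k - i.2) ^ 2 := by gcongr
          _ = (N : ℝ≥0∞)⁻¹ ^ 2 * (invAbs i.1 ^ 2 * invAbs (k - i.2) ^ 2) := by ring
          _ ≤ _ := by gcongr; exact le_add_self.trans le_self_add
      · have := pow_le_pow_left' (invAbs_le_of_lt h2) 2
        calc _ ≤ invAbs i.1 ^ 2 * invAbs (i.1 + i.2) ^ 2 * 1 * (N : ℝ≥0∞)⁻¹ ^ 2 := by gcongr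
          _ = (N : ℝ≥0∞)⁻¹ ^ 2 * (invAbs i.1 ^ 2 * invAbs (i.1 + i.2) ^ 2) := by ring
          _ ≤ _ := by gcongr; exact le_add_self
  refine (ENNReal.tsum_le_tsum h).trans ?_
  rw [ENNReal.tsum_mul_left, ENNReal.tsum_add, ENNReal.tsum_add,
    tsum_pair_mul_left (fun i _ => invAbs (k - i) ^ 2) (fun i j => invAbs (i + j) ^ 2)
      (tsum_invAbs_sub_left k) (fun _ _ => rfl) tsum_invAbs_add,
    tsum_pair_mul_left (fun i _ => invAbs i ^ 2) (fun i j => invAbs (k - j) ^ 2)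
      (a := zetaTwo) rfl (fun _ _ => rfl) (fun _ => tsum_invAbs_sub_left k),
    tsum_pair_mul_left (fun i _ => invAbs i ^ 2) (fun i j => invAbs (i + j) ^ 2)
      (a := zetaTwo) rfl (fun _ _ => rfl) tsum_invAbs_add]
  rw [mul_pow _ (_⁻¹), mul_comm]
  gcongr
  calc zetaTwo * zetaTwo + zetaTwo * zetaTwo + zetaTwo * zetaTwo
      ≤ (zetaTwo * zetaTwo + zetaTwo * zetaTwo + zetaTwo * zetaTwo) +
        (4 + 8 * zetaTwo + zetaTwo ^ 2) := le_self_add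
    _ = _ := by ring

/-- Kernel of the quartic terms: the cubic boundary kernel, extended to all frequencies, multiplied
by the frequency at which the time derivative falls. -/
noncomputable def kerQuart (r : Fin 3) (k : ℤ) (i : ℤ × ℤ) : ℝ≥0∞ :=
  invAbs i.1 * invAbs (i.1 + i.2) * invAbs (k - i.1) * invAbs (k - i.2) * ‖(e3 k i r : ℂ)‖ₑ

lemma enorm_mul_invAbs_mul_le (m p q : ℤ) (h : m = p + q ∨ m = p - q) :
    invAbs p * invAbs q * ‖(m : ℂ)‖ₑ ≤ invAbs p + invAbs q := by
  have : ‖(m : ℂ)‖ₑ ≤ ‖(p : ℂ)‖ₑ + ‖(q : ℂ)‖ₑ := by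
    rcases h with rfl | rfl
    · push_cast; exact enorm_add_le _ _
    · push_cast; exact enorm_sub_le
  calc _ ≤ invAbs p * invAbs q * (‖(p : ℂ)‖ₑ + ‖(q : ℂ)‖ₑ) := by gcongr
    _ = (‖(p : ℂ)‖ₑ * invAbs p) * invAbs q + (‖(q : ℂ)‖ₑ * invAbs q) * invAbs p := by ring
    _ ≤ 1 * invAbs q + 1 * invAbs p := by gcongr <;> exact enorm_mul_invAbs_le _
    _ = _ := by ring

lemma add_sq_le_two_mul (a b : ℝ≥0∞) : (a + b) ^ 2 ≤ 2 * (a ^ 2 + b ^ 2) := by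
  have := ENNReal.rpow_add_le_mul_rpow_add_rpow a b (p := 2) (by norm_num)
  norm_num at this
  exact this

lemma formBound_kerQuart (r : Fin 3) :
    FormBound (fun k (i : (ℤ × ℤ) × ℤ) => kerQuart r k i.1) (e4 r) (4 * (1 + zetaTwo) ^ 2) := by
  refine .of_split fun x y => ?_
  have hc1 : zetaTwo ≤ (1 + zetaTwo) ^ 2 := by
    calc zetaTwo ≤ zetaTwo + (1 + zetaTwo + zetaTwo ^ 2) := le_self_add
      _ = _ := by ring
  have hc2 : zetaTwo * zetaTwo ≤ (1 + zetaTwo) ^ 2 := by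
    calc zetaTwo * zetaTwo ≤ zetaTwo * zetaTwo + (1 + zetaTwo + zetaTwo) := le_self_add
      _ = _ := by ring
  have hc4 : 2 * (zetaTwo * zetaTwo + zetaTwo * zetaTwo) ≤ (4 * (1 + zetaTwo)) ^ 2 := by
    calc 2 * (zetaTwo * zetaTwo + zetaTwo * zetaTwo)
        ≤ 2 * (zetaTwo * zetaTwo + zetaTwo * zetaTwo) +
        (16 + 32 * zetaTwo + 12 * zetaTwo ^ 2) := le_self_add
      _ = _ := by ring
  -- the cases `r = 1, 2` have a sum of two reciprocals as a factor of the second kernel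
  have key (K₁ K₂ : ℤ → ℤ × ℤ → ℝ≥0∞)
      (h : ∀ k i, kerQuart r k i ≤ K₁ k i * K₂ k i)
      (h₁ : ∀ k, ∑' i, K₁ k i ^ 2 * x (e3 k i (r.succAbove 0)) ^ 2 ≤
        (1 + zetaTwo) ^ 2 * ∑' k, x k ^ 2)
      (h₂ : ∑' k, ∑' i, K₂ k i ^ 2 * y (e3 k i (r.succAbove 1)) ^ 2 ≤
        (4 * (1 + zetaTwo)) ^ 2 * ∑' k, y k ^ 2) :
      l2 (fun k => ∑' i, kerQuart r k i * (x (e3 k i (r.succAbove 0)) *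
        y (e3 k i (r.succAbove 1)))) ≤ 4 * (1 + zetaTwo) ^ 2 * (l2 x * l2 y) := by
    refine (l2_mono fun k => ENNReal.tsum_le_tsum fun i => ?_).trans
      ((l2_bilinear_le h₁ h₂).trans_eq (by ring))
    gcongr
    exact h k i
  have inner (l : ℤ) : ∑' k, ∑' i, ((invAbs i + invAbs (k - l)) * invAbs (k - i)) ^ 2 ≤
      (4 * (1 + zetaTwo)) ^ 2 := by
    refine le_trans ?_ hc4
    calc _ ≤ ∑' k, ∑' i, 2 * (invAbs i ^ 2 * invAbs (k - i) ^ 2 +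
          invAbs (k - l) ^ 2 * invAbs (k - i) ^ 2) := by
          refine ENNReal.tsum_le_tsum fun k => ENNReal.tsum_le_tsum fun i => ?_
          rw [mul_pow, ← add_mul, ← mul_assoc]
          gcongr
          exact add_sq_le_two_mul _ _
      _ = _ := by
          simp_rw [ENNReal.tsum_mul_left, ENNReal.tsum_add]
          congr 2
          · rw [ENNReal.tsum_comm]
            simp_rw [ENNReal.tsum_mul_left, tsum_invAbs_sub_right, ENNReal.tsum_mul_right]
            rfl
          · simp_rw [ENNReal.tsum_mul_left, tsum_invAbs_sub_left, ENNReal.tsum_mul_right,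
              tsum_invAbs_sub_right]
  have rot (F : ℤ → ℤ → ℤ → ℝ≥0∞) : ∑' k, ∑' i : ℤ × ℤ, F k i.1 i.2 =
      ∑' j, ∑' k, ∑' i, F k i j := by
    simp_rw [tsum_pair]
    calc _ = ∑' k, ∑' j, ∑' i, F k i j := tsum_congr fun k => ENNReal.tsum_comm
      _ = _ := ENNReal.tsum_comm
  have rot' (F : ℤ → ℤ → ℤ → ℝ≥0∞) : ∑' k, ∑' i : ℤ × ℤ, F k i.1 i.2 =
      ∑' l, ∑' k, ∑' i, F k i (k - i - l) := by
    rw [← rot (fun k i l => F k i (k - i - l))]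
    simp_rw [tsum_pair, fun k i => tsum_sub_left (F k i) (k - i)]
  have fin (G : ℤ → ℤ → ℤ → ℝ≥0∞)
      (hG : ∀ l, ∑' k, ∑' i, G l k i ^ 2 ≤ (4 * (1 + zetaTwo)) ^ 2) :
      ∑' l, ∑' k, ∑' i, G l k i ^ 2 * y l ^ 2 ≤ (4 * (1 + zetaTwo)) ^ 2 * ∑' k, y k ^ 2 := by
    simp_rw [ENNReal.tsum_mul_right]
    rw [← ENNReal.tsum_mul_left]
    refine ENNReal.tsum_le_tsum fun l => ?_
    gcongr
    exact hG l
  fin_cases r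
  · refine key (fun k i => invAbs (k - i.1)) (fun k i => invAbs (i.1 + i.2) * invAbs (k - i.2))
      (fun k i => ?_) (fun k => ?_) ?_
    · simp only [kerQuart, e3]
      calc _ = (‖(i.1 : ℂ)‖ₑ * invAbs i.1) *
            (invAbs (k - i.1) * (invAbs (i.1 + i.2) * invAbs (k - i.2))) := by simp; ring
        _ ≤ 1 * _ := by gcongr; exact enorm_mul_invAbs_le _
        _ = _ := by rw [one_mul]
    · refine (le_of_eq ?_).trans (mul_le_mul_left hc1 _)
      exact tsum_pair_mul_left (fun i _ => invAbs (k - i) ^ 2) (fun i j => x j ^ 2)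
        (tsum_invAbs_sub_left k) (fun _ _ => rfl) (fun _ => rfl)
    · refine (rot' (fun k i j => (invAbs (i + j) * invAbs (k - j)) ^ 2 *
        y (k - i - j) ^ 2)).trans_le ?_
      simp_rw [sub_sub_cancel]
      refine fin (fun l k i => invAbs (i + (k - i - l)) * invAbs (k - (k - i - l))) fun l => ?_
      refine (le_of_eq ?_).trans (hc2.trans ?_)
      · simp_rw [mul_pow, show ∀ k i, i + (k - i - l) = k - l by intros; ring,
          show ∀ k i, k - (k - i - l) = l + i by intros; ring, ENNReal.tsum_mul_left,
          tsum_invAbs_add, ENNReal.tsum_mul_right, tsum_invAbs_sub_right]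
      · gcongr
        exact le_mul_of_one_le_left' (by norm_num)
  · refine key (fun k i => invAbs (k - i.2))
      (fun k i => (invAbs i.1 + invAbs (i.1 + i.2)) * invAbs (k - i.1))
      (fun k i => ?_) (fun k => ?_) ?_
    · simp only [kerQuart, e3]
      have := enorm_mul_invAbs_mul_le i.2 (i.1 + i.2) i.1 (Or.inr (by ring))
      calc _ = (invAbs (i.1 + i.2) * invAbs i.1 * ‖(i.2 : ℂ)‖ₑ) *
            (invAbs (k - i.1) * invAbs (k - i.2)) := by simp; ring
        _ ≤ (invAbs (i.1 + i.2) + invAbs i.1) * (invAbs (k - i.1) * invAbs (k - i.2)) := by gcongr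
        _ = _ := by ring
    · refine (le_of_eq ?_).trans (mul_le_mul_left hc1 _)
      rw [mul_comm]
      refine Eq.trans ?_ (tsum_pair_mul_left (fun i _ => x i ^ 2) (fun i j => invAbs (k - j) ^ 2)
        rfl (fun _ _ => rfl) (fun _ => tsum_invAbs_sub_left k))
      exact tsum_congr fun i => mul_comm _ _
    · refine (rot' (fun k i j => ((invAbs i + invAbs (i + j)) * invAbs (k - i)) ^ 2 *
        y (k - i - j) ^ 2)).trans_le ?_
      simp_rw [sub_sub_cancel, show ∀ k i l : ℤ, i + (k - i - l) = k - l by intros; ring]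
      exact fin (fun l k i => (invAbs i + invAbs (k - l)) * invAbs (k - i)) inner
  · refine key (fun k i => invAbs (i.1 + i.2))
      (fun k i => (invAbs i.1 + invAbs (k - i.2)) * invAbs (k - i.1))
      (fun k i => ?_) (fun k => ?_) ?_
    · simp only [kerQuart, e3]
      have := enorm_mul_invAbs_mul_le (k - i.1 - i.2) (k - i.2) i.1 (Or.inr (by ring))
      calc _ = (invAbs (k - i.2) * invAbs i.1 * ‖((k - i.1 - i.2 : ℤ) : ℂ)‖ₑ) *
            (invAbs (k - i.1) * invAbs (i.1 + i.2)) := by simp; ring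
        _ ≤ (invAbs (k - i.2) + invAbs i.1) * (invAbs (k - i.1) * invAbs (i.1 + i.2)) := by gcongr
        _ = _ := by ring
    · refine (le_of_eq ?_).trans (mul_le_mul_left hc1 _)
      rw [mul_comm]
      refine Eq.trans ?_ (tsum_pair_mul_left (fun i _ => x i ^ 2) (fun i j => invAbs (i + j) ^ 2)
        rfl (fun _ _ => rfl) tsum_invAbs_add)
      exact tsum_congr fun i => mul_comm _ _
    · refine (rot (fun k i j => ((invAbs i + invAbs (k - j)) * invAbs (k - i)) ^ 2 *
        y j ^ 2)).trans_le ?_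
      exact fin (fun l k i => (invAbs i + invAbs (k - l)) * invAbs (k - i)) inner

/-! ### Differences of multilinear forms in weighted spaces -/

/-- The Sobolev weight `|k|^s`. -/
noncomputable def wt (s : ℝ) (k : ℤ) : ℝ≥0∞ := ENNReal.ofReal (|(k : ℝ)| ^ s)

lemma wt_sum_le {s : ℝ} (hs : 0 ≤ s) {n : ℕ} [NeZero n] (l : Fin n → ℤ) :
    wt s (∑ j, l j) ≤ ENNReal.ofReal ((n : ℝ) ^ s) * ∑ j, wt s (l j) := by
  obtain ⟨j, -, hj⟩ := Finset.exists_max_image Finset.univ (fun j => |l j|) ⟨0, Finset.mem_univ 0⟩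
  have h1 : |∑ j, l j| ≤ n * |l j| := by
    refine (Finset.abs_sum_le_sum_abs _ _).trans ((Finset.sum_le_card_nsmul _ _ _ hj).trans_eq ?_)
    simp
  have h2 : |((∑ j, l j : ℤ) : ℝ)| ^ s ≤ (n : ℝ) ^ s * |(l j : ℝ)| ^ s := by
    rw [← Real.mul_rpow (by positivity) (by positivity)]
    exact Real.rpow_le_rpow (by positivity) (by exact_mod_cast h1) hs
  calc wt s (∑ j, l j) ≤ ENNReal.ofReal ((n : ℝ) ^ s) * wt s (l j) := by
        rw [wt, wt, ← ENNReal.ofReal_mul (by positivity)]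
        exact ENNReal.ofReal_le_ofReal h2
    _ ≤ _ := by
        gcongr
        exact Finset.single_le_sum (f := fun j => wt s (l j)) (fun _ _ => zero_le)
          (Finset.mem_univ j)

lemma enorm_prod_sub_prod_le {ι : Type*} [DecidableEq ι] (s : Finset ι) (a b : ι → ℂ) :
    ‖∏ j ∈ s, a j - ∏ j ∈ s, b j‖ₑ ≤
      ∑ j ∈ s, ‖a j - b j‖ₑ * ∏ i ∈ s.erase j, (‖a i‖ₑ + ‖b i‖ₑ) := by
  induction s using Finset.induction_on with
  | empty => simp
  | insert j s hj ih =>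
    rw [Finset.prod_insert hj, Finset.prod_insert hj, Finset.sum_insert hj,
      Finset.erase_insert hj]
    have h1 : ‖∏ i ∈ s, a i‖ₑ ≤ ∏ i ∈ s, (‖a i‖ₑ + ‖b i‖ₑ) := by
      rw [show ‖∏ i ∈ s, a i‖ₑ = ∏ i ∈ s, ‖a i‖ₑ by
        simp only [enorm, nnnorm_prod, ENNReal.ofNNReal_finsetProd]]
      exact Finset.prod_le_prod' fun i _ => le_self_add
    calc _ = ‖(a j - b j) * ∏ i ∈ s, a i + b j * (∏ i ∈ s, a i - ∏ i ∈ s, b i)‖ₑ := by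
          congr 1; ring
      _ ≤ ‖a j - b j‖ₑ * ‖∏ i ∈ s, a i‖ₑ + ‖b j‖ₑ * ‖∏ i ∈ s, a i - ∏ i ∈ s, b i‖ₑ := by
          refine (enorm_add_le _ _).trans_eq ?_
          rw [enorm_mul, enorm_mul]
      _ ≤ _ := by
          gcongr
          refine (mul_le_mul_right ih _).trans ?_
          rw [Finset.mul_sum]
          refine Finset.sum_le_sum fun i hi => ?_
          have hij : j ≠ i := fun h => hj (h ▸ hi)
          rw [Finset.erase_insert_of_ne hij, Finset.prod_insert (by simp [hj])]
          calc _ = ‖a i - b i‖ₑ * (‖b j‖ₑ * ∏ i ∈ s.erase i, (‖a i‖ₑ + ‖b i‖ₑ)) := by ring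
            _ ≤ _ := by gcongr; exact le_add_self

lemma l2_sum_le {α ι : Type*} (s : Finset ι) (f : ι → α → ℝ≥0∞) :
    l2 (fun k => ∑ j ∈ s, f j k) ≤ ∑ j ∈ s, l2 (f j) := by
  classical
  induction s using Finset.induction_on with
  | empty => simp [l2]
  | insert j s hj ih =>
    simp_rw [Finset.sum_insert hj]
    exact (l2_add_le _ _).trans (by gcongr)

/-- The smallness and size parameters that control the differences of multilinear forms at `v`
and `w`: with `y = |v - w|` and `q = |v| + |w|`, a product of an unweighted `y` and a weighted `q`
is bounded by the weighted `y`. This holds both for `w = 0` with `L` depending only on the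
unweighted norm of `v`, and in general with `L` depending on the weighted norms. -/
structure DiffBound (s : ℝ) (L : ℝ≥0∞) (v w : ℤ → ℂ) : Prop where
  sum_le : l2 (fun k => ‖v k‖ₑ + ‖w k‖ₑ) ≤ L
  mul_le : l2 (fun k => ‖v k - w k‖ₑ) * l2 (fun k => wt s k * (‖v k‖ₑ + ‖w k‖ₑ)) ≤
    L * l2 (fun k => wt s k * ‖v k - w k‖ₑ)

lemma FormBound.weighted_diff {J : Type*} {n : ℕ} [NeZero n] {K : ℤ → J → ℝ≥0∞}
    {e : ℤ → J → Fin n → ℤ} {κ : ℝ≥0∞} (hb : FormBound K e κ) (he : ∀ k i, ∑ j, e k i j = k)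
    {s : ℝ} (hs : 0 ≤ s) {L : ℝ≥0∞} {v w : ℤ → ℂ} (h : DiffBound s L v w) :
    l2 (fun k => wt s k * ∑' i, K k i * ‖∏ j, v (e k i j) - ∏ j, w (e k i j)‖ₑ) ≤
      (ENNReal.ofReal ((n : ℝ) ^ s) * n ^ 2 * L ^ (n - 1)) * κ *
        l2 (fun k => wt s k * ‖v k - w k‖ₑ) := by
  set y : ℤ → ℝ≥0∞ := fun k => ‖v k - w k‖ₑ with hy
  set q : ℤ → ℝ≥0∞ := fun k => ‖v k‖ₑ + ‖w k‖ₑ with hq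
  set c := ENNReal.ofReal ((n : ℝ) ^ s)
  let F (l j i : Fin n) (k : ℤ) : ℝ≥0∞ := (if i = l then wt s k else 1) * if i = j then y k else q k
  have hF (l j : Fin n) (g : Fin n → ℤ) :
      wt s (g l) * (y (g j) * ∏ i ∈ Finset.univ.erase j, q (g i)) = ∏ i, F l j i (g i) := by
    simp only [F, Finset.prod_mul_distrib]
    congr 1
    · simp
    · rw [← Finset.mul_prod_erase _ _ (Finset.mem_univ j), if_pos rfl]
      congr 1
      exact Finset.prod_congr rfl fun i hi => by rw [if_neg (Finset.ne_of_mem_erase hi)]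
  have hpt (k : ℤ) : wt s k * ∑' i, K k i * ‖∏ j, v (e k i j) - ∏ j, w (e k i j)‖ₑ ≤
      c * ∑ l, ∑ j, posForm K e (F l j) k := by
    have hsum : ∑ l, ∑ j, posForm K e (F l j) k =
        ∑' i, K k i * ∑ l, ∑ j, ∏ i', F l j i' (e k i i') := by
      simp only [Finset.mul_sum]
      rw [Summable.tsum_finsetSum fun _ _ => ENNReal.summable]
      refine Finset.sum_congr rfl fun l _ => ?_
      rw [Summable.tsum_finsetSum fun _ _ => ENNReal.summable]
      rfl
    rw [hsum, ← ENNReal.tsum_mul_left, ← ENNReal.tsum_mul_left]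
    refine ENNReal.tsum_le_tsum fun i => ?_
    calc wt s k * (K k i * ‖∏ j, v (e k i j) - ∏ j, w (e k i j)‖ₑ)
        ≤ (c * ∑ l, wt s (e k i l)) * (K k i * ∑ j, y (e k i j) *
            ∏ i' ∈ Finset.univ.erase j, q (e k i i')) := by
          gcongr
          · conv_lhs => rw [← he k i]
            exact wt_sum_le hs _
          · exact enorm_prod_sub_prod_le _ _ _
      _ = _ := by
          simp_rw [← hF, ← Finset.mul_sum, ← Finset.sum_mul]
          ring
  have hl2 (l j : Fin n) : ∏ i, l2 (F l j i) ≤ L ^ (n - 1) * l2 (fun k => wt s k * y k) := by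
    have hcard : (Finset.univ.erase j).card = n - 1 := by simp
    rw [← Finset.mul_prod_erase _ _ (Finset.mem_univ j)]
    rcases eq_or_ne l j with rfl | hlj
    · rw [mul_comm]
      gcongr
      · rw [← hcard]
        refine Finset.prod_le_pow_card _ _ _ fun i hi => ?_
        simpa [F, if_neg (Finset.ne_of_mem_erase hi)] using h.sum_le
      · simp [F]
    · have hmem : l ∈ Finset.univ.erase j := Finset.mem_erase.2 ⟨hlj, Finset.mem_univ l⟩
      have hcard2 : ((Finset.univ.erase j).erase l).card + 1 = n - 1 := by
        rw [Finset.card_erase_of_mem hmem, hcard]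
        have := Finset.card_pos.2 ⟨l, hmem⟩
        omega
      rw [← Finset.mul_prod_erase _ _ hmem, ← hcard2, ← mul_assoc, pow_succ]
      have h1 : l2 (F l j j) * l2 (F l j l) ≤ L * l2 (fun k => wt s k * y k) := by
        simpa [F, hlj, hlj.symm] using h.mul_le
      have h2 : ∏ x ∈ (Finset.univ.erase j).erase l, l2 (F l j x) ≤
          L ^ ((Finset.univ.erase j).erase l).card := by
        refine Finset.prod_le_pow_card _ _ _ fun i hi => ?_
        have h3 := Finset.mem_erase.1 hi
        have h4 := Finset.ne_of_mem_erase h3.2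
        simpa [F, h3.1, h4] using h.sum_le
      calc _ ≤ (L * l2 (fun k => wt s k * y k)) * L ^ ((Finset.univ.erase j).erase l).card := by
            gcongr
        _ = _ := by ring
  calc _ ≤ c * ∑ l, ∑ j, κ * (L ^ (n - 1) * l2 (fun k => wt s k * y k)) := by
        refine (l2_mono hpt).trans ?_
        rw [l2_const_mul]
        gcongr
        refine (l2_sum_le _ _).trans (Finset.sum_le_sum fun l _ => ?_)
        refine (l2_sum_le _ _).trans (Finset.sum_le_sum fun j _ => ?_)
        refine (hb _).trans ?_
        gcongr
        exact hl2 l j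
    _ = _ := by
        simp only [Finset.sum_const, Finset.card_univ, Fintype.card_fin, nsmul_eq_mul]
        ring

open Set

/-! ### Primitives of bounded measurable functions -/

/-- `F` is a primitive on `[0,T]` of the bounded measurable function `f`. -/
structure IsPrim (T : ℝ) (F f : ℝ → ℂ) : Prop where
  meas : AEStronglyMeasurable f (volume.restrict (Icc 0 T))
  bdd : ∃ C : ℝ, ∀ t ∈ Icc 0 T, ‖f t‖ ≤ C
  eq : ∀ t ∈ Icc 0 T, F t = F 0 + ∫ τ in (0 : ℝ)..t, f τ

namespace IsPrim
variable {T : ℝ} {F f G g : ℝ → ℂ}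

lemma integrableOn (h : IsPrim T F f) : IntegrableOn f (Icc 0 T) := by
  obtain ⟨C, hC⟩ := h.bdd
  have : IsFiniteMeasure (volume.restrict (Icc 0 T)) := ⟨by simp⟩
  exact ⟨h.meas, .of_bounded ((ae_restrict_iff' measurableSet_Icc).2 (.of_forall hC))⟩

lemma intervalIntegrable (h : IsPrim T F f) {a b : ℝ} (ha : a ∈ Icc 0 T) (hb : b ∈ Icc 0 T) :
    IntervalIntegrable f volume a b :=
  (h.integrableOn.mono_set (uIcc_subset_Icc ha hb)).intervalIntegrable

lemma sub_eq (h : IsPrim T F f) {a b : ℝ} (ha : a ∈ Icc 0 T) (hb : b ∈ Icc 0 T) :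
    F b - F a = ∫ τ in a..b, f τ := by
  have h0 : (0 : ℝ) ∈ Icc 0 T := ⟨le_rfl, ha.1.trans ha.2⟩
  rw [h.eq b hb, h.eq a ha, ← intervalIntegral.integral_interval_sub_left
    (h.intervalIntegrable h0 hb) (h.intervalIntegrable h0 ha)]
  ring

lemma norm_sub_le (h : IsPrim T F f) {C : ℝ} (hC : ∀ t ∈ Icc 0 T, ‖f t‖ ≤ C) {a b : ℝ}
    (ha : a ∈ Icc 0 T) (hb : b ∈ Icc 0 T) : ‖F b - F a‖ ≤ C * |b - a| := by
  rw [h.sub_eq ha hb]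
  exact intervalIntegral.norm_integral_le_of_norm_le_const fun x hx =>
    hC x (uIcc_subset_Icc ha hb (uIoc_subset_uIcc hx))

lemma lipschitzOnWith (h : IsPrim T F f) : ∃ C : ℝ≥0, LipschitzOnWith C F (Icc 0 T) := by
  obtain ⟨C, hC⟩ := h.bdd
  refine ⟨C.toNNReal, LipschitzOnWith.of_dist_le_mul fun x hx y hy => ?_⟩
  rw [dist_eq_norm, Real.dist_eq]
  exact (h.norm_sub_le hC hy hx).trans (by gcongr; exact Real.le_coe_toNNReal C)

lemma continuousOn (h : IsPrim T F f) : ContinuousOn F (Icc 0 T) :=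
  h.lipschitzOnWith.choose_spec.continuousOn

lemma ac (h : IsPrim T F f) (hT : 0 ≤ T) : AbsolutelyContinuousOnInterval F 0 T := by
  obtain ⟨C, hC⟩ := h.lipschitzOnWith
  exact LipschitzOnWith.absolutelyContinuousOnInterval (by rwa [uIcc_of_le hT])

lemma ae_hasDerivAt (h : IsPrim T F f) (hT : 0 ≤ T) :
    ∀ᵐ x, x ∈ Ioo 0 T → HasDerivAt F (f x) x := by
  have h0 : (0 : ℝ) ∈ Icc 0 T := ⟨le_rfl, hT⟩
  have := (h.intervalIntegrable h0 ⟨hT, le_rfl⟩).ae_hasDerivAt_integral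
  filter_upwards [this] with x hx hxT
  rw [uIcc_of_le hT] at hx
  have h1 := (hx (Ioo_subset_Icc_self hxT) 0 h0).const_add (F 0)
  refine h1.congr_of_eventuallyEq ?_
  filter_upwards [Ioo_mem_nhds hxT.1 hxT.2] with y hy
  exact h.eq y (Ioo_subset_Icc_self hy)

lemma of_ac (hT : 0 ≤ T) (hF : AbsolutelyContinuousOnInterval F 0 T)
    (meas : AEStronglyMeasurable f (volume.restrict (Icc 0 T)))
    (bdd : ∃ C : ℝ, ∀ t ∈ Icc 0 T, ‖f t‖ ≤ C)
    (hd : ∀ᵐ x, x ∈ Ioo 0 T → HasDerivAt F (f x) x) : IsPrim T F f := by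
  refine ⟨meas, bdd, ?_⟩
  have hP : IsPrim T (fun x => ∫ τ in (0 : ℝ)..x, f τ) f := ⟨meas, bdd, fun t _ => by simp⟩
  obtain ⟨C, hC⟩ := (hF.fun_sub (hP.ac hT)).const_of_ae_hasDerivAt_zero (by
    filter_upwards [hd, hP.ae_hasDerivAt hT, Measure.ae_ne volume 0, Measure.ae_ne volume T]
      with x h1 h2 h3 h4 hx
    rw [uIcc_of_le hT] at hx
    have hx' : x ∈ Ioo 0 T := ⟨lt_of_le_of_ne hx.1 (Ne.symm h3), lt_of_le_of_ne hx.2 h4⟩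
    simpa using (h1 hx').fun_sub (h2 hx'))
  intro t ht
  rw [uIcc_of_le hT] at hC
  have h1 := hC t ht
  have h2 := hC 0 ⟨le_rfl, hT⟩
  simp only [intervalIntegral.integral_same, sub_zero] at h2
  rw [h2, ← h1]; ring

lemma congr (h : IsPrim T F f) (hT : 0 ≤ T) (hF : EqOn F G (Icc 0 T)) (hf : EqOn f g (Icc 0 T)) :
    IsPrim T G g := by
  refine ⟨h.meas.congr ?_, ?_, fun t ht => ?_⟩
  · exact (ae_restrict_iff' measurableSet_Icc).2 (.of_forall hf)
  · obtain ⟨C, hC⟩ := h.bdd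
    exact ⟨C, fun t ht => hf ht ▸ hC t ht⟩
  · rw [← hF ht, ← hF ⟨le_rfl, hT⟩, h.eq t ht]
    congr 1
    refine intervalIntegral.integral_congr fun x hx => hf ?_
    exact uIcc_subset_Icc ⟨le_rfl, hT⟩ ht hx

lemma add (hF : IsPrim T F f) (hG : IsPrim T G g) :
    IsPrim T (fun t => F t + G t) (fun t => f t + g t) := by
  obtain ⟨C, hC⟩ := hF.bdd
  obtain ⟨D, hD⟩ := hG.bdd
  refine ⟨hF.meas.add hG.meas, ⟨C + D, fun t ht => (norm_add_le _ _).trans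
    (add_le_add (hC t ht) (hD t ht))⟩, fun t ht => ?_⟩
  have h0 : (0 : ℝ) ∈ Icc 0 T := ⟨le_rfl, ht.1.trans ht.2⟩
  rw [intervalIntegral.integral_add (hF.intervalIntegrable h0 ht) (hG.intervalIntegrable h0 ht),
    hF.eq t ht, hG.eq t ht]
  ring

lemma const_mul (hF : IsPrim T F f) (c : ℂ) : IsPrim T (fun t => c * F t) (fun t => c * f t) := by
  obtain ⟨C, hC⟩ := hF.bdd
  refine ⟨hF.meas.const_mul c, ⟨‖c‖ * C, fun t ht => ?_⟩, fun t ht => ?_⟩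
  · rw [norm_mul]
    gcongr
    exact hC t ht
  · rw [intervalIntegral.integral_const_mul, hF.eq t ht]
    ring

lemma sub (hF : IsPrim T F f) (hG : IsPrim T G g) :
    IsPrim T (fun t => F t - G t) (fun t => f t - g t) := by
  simpa [sub_eq_add_neg] using hF.add (hG.const_mul (-1))

lemma exists_bound (hF : IsPrim T F f) : ∃ C, ∀ t ∈ Icc 0 T, ‖F t‖ ≤ C :=
  isCompact_Icc.exists_bound_of_continuousOn hF.continuousOn

lemma mul (hF : IsPrim T F f) (hG : IsPrim T G g) (hT : 0 ≤ T) :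
    IsPrim T (fun t => F t * G t) (fun t => f t * G t + F t * g t) := by
  obtain ⟨C, hC⟩ := hF.bdd
  obtain ⟨D, hD⟩ := hG.bdd
  obtain ⟨C', hC'⟩ := hF.exists_bound
  obtain ⟨D', hD'⟩ := hG.exists_bound
  have mF := hF.continuousOn.aestronglyMeasurable measurableSet_Icc (μ := volume)
  have mG := hG.continuousOn.aestronglyMeasurable measurableSet_Icc (μ := volume)
  refine of_ac hT ((hF.ac hT).smul (hG.ac hT)) ((hF.meas.mul mG).add (mF.mul hG.meas))
    ⟨C * D' + C' * D, fun t ht => ?_⟩ ?_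
  · refine (norm_add_le _ _).trans ?_
    rw [norm_mul, norm_mul]
    have := (norm_nonneg _).trans (hC t ht)
    have := (norm_nonneg _).trans (hC' t ht)
    gcongr
    exacts [hC t ht, hD' t ht, hC' t ht, hD t ht]
  · filter_upwards [hF.ae_hasDerivAt hT, hG.ae_hasDerivAt hT] with x h1 h2 hx
    exact (h1 hx).mul (h2 hx)

lemma of_hasDerivWithinAt (hd : ∀ t ∈ Icc 0 T, HasDerivWithinAt F (f t) (Icc 0 T) t)
    (hf : ContinuousOn f (Icc 0 T)) : IsPrim T F f := by
  refine ⟨hf.aestronglyMeasurable measurableSet_Icc,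
    isCompact_Icc.exists_bound_of_continuousOn hf, fun t ht => ?_⟩
  have hsub : Icc 0 t ⊆ Icc 0 T := Icc_subset_Icc_right ht.2
  rw [intervalIntegral.integral_eq_sub_of_hasDerivAt_of_le ht.1
    (fun x hx => ((hd x (hsub hx)).mono hsub).continuousWithinAt)
    (fun x hx => (hd x (hsub (Ioo_subset_Icc_self hx))).hasDerivAt
      (Icc_mem_nhds hx.1 (hx.2.trans_le ht.2)))]
  · ring
  · exact (hf.mono (by rwa [uIcc_of_le ht.1])).intervalIntegrable

lemma tsum {ι : Type*} [Countable ι] {F f : ι → ℝ → ℂ} (h : ∀ i, IsPrim T (F i) (f i))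
    (hF : ∀ t ∈ Icc 0 T, ∑' i, ‖F i t‖ₑ ≠ ⊤) {C : ℝ≥0∞} (hC : C ≠ ⊤)
    (hf : ∀ t ∈ Icc 0 T, ∑' i, ‖f i t‖ₑ ≤ C) :
    IsPrim T (fun t => ∑' i, F i t) (fun t => ∑' i, f i t) := by
  have sF (t) (ht : t ∈ Icc 0 T) : Summable fun i => F i t :=
    .of_enorm (hF t ht)
  have sf (t) (ht : t ∈ Icc 0 T) : Summable fun i => f i t :=
    .of_enorm (ne_top_of_le_ne_top hC (hf t ht))
  refine ⟨?_, ⟨C.toReal, fun t ht => ?_⟩, fun t ht => ?_⟩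
  · refine aestronglyMeasurable_of_tendsto_ae (u := (atTop : Filter (Finset ι)))
      (f := fun s t => ∑ i ∈ s, f i t) (fun s => ?_)
      ((ae_restrict_iff' measurableSet_Icc).2 (.of_forall fun t ht => (sf t ht).hasSum))
    exact Finset.aestronglyMeasurable_fun_sum s fun i _ => (h i).meas
  · rw [← toReal_enorm]
    exact ENNReal.toReal_mono hC (enorm_tsum_le_tsum_enorm.trans (hf t ht))
  · have h0 : (0 : ℝ) ∈ Icc 0 T := ⟨le_rfl, ht.1.trans ht.2⟩
    have hsub : Ioc 0 t ⊆ Icc 0 T := fun x hx => ⟨hx.1.le, hx.2.trans ht.2⟩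
    have hint : ∫ τ in (0 : ℝ)..t, ∑' i, f i τ = ∑' i, ∫ τ in (0 : ℝ)..t, f i τ := by
      simp_rw [intervalIntegral.integral_of_le ht.1]
      refine integral_tsum (fun i => (h i).meas.mono_set hsub) ?_
      rw [← lintegral_tsum fun i => ((h i).meas.mono_set hsub).enorm]
      refine ne_top_of_le_ne_top ?_ (setLIntegral_mono_ae (g := fun _ => C) (by fun_prop)
        (.of_forall fun x hx => hf x (hsub hx)))
      simp [ENNReal.mul_eq_top, hC]
    rw [hint, ← (sF 0 h0).tsum_add]
    · exact tsum_congr fun i => (h i).eq t ht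
    · refine ((sF t ht).sub (sF 0 h0)).congr fun i => ?_
      rw [(h i).eq t ht]; ring

end IsPrim

/-! ### Oscillating multilinear forms -/

section

/-- The phase factor `exp (i θ t)`. -/
noncomputable def ph (θ : ℤ) (t : ℝ) : ℂ := Complex.exp (Complex.I * θ * t)

lemma enorm_ph (θ : ℤ) (t : ℝ) : ‖ph θ t‖ₑ = 1 := by
  rw [← ofReal_norm, ph, show Complex.I * θ * t = ((θ * t : ℝ) : ℂ) * Complex.I by push_cast; ring,
    Complex.norm_exp_ofReal_mul_I, ENNReal.ofReal_one]

lemma ph_add (θ η : ℤ) (t : ℝ) : ph (θ + η) t = ph θ t * ph η t := by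
  rw [ph, ph, ph, ← Complex.exp_add]
  congr 1; push_cast; ring

lemma isPrim_ph (T : ℝ) (θ : ℤ) : IsPrim T (ph θ) (fun t => Complex.I * θ * ph θ t) := by
  refine .of_hasDerivWithinAt (fun t _ => HasDerivAt.hasDerivWithinAt ?_) ?_
  · have h1 : HasDerivAt (fun t : ℝ => Complex.I * θ * (t : ℂ)) (Complex.I * θ * 1) t :=
      (Complex.ofRealCLM.hasDerivAt (x := t)).const_mul (Complex.I * (θ : ℂ))
    refine h1.cexp.congr_deriv ?_
    rw [ph]; ring
  · unfold ph; fun_prop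

variable {J : Type*} {n : ℕ}

/-- The `n`-linear form, on the diagonal, with coefficients `d` and phases `θ`. -/
noncomputable def form (d : ℤ → J → ℂ) (θ : ℤ → J → ℤ) (e : ℤ → J → Fin n → ℤ) (t : ℝ)
    (a : ℤ → ℂ) (k : ℤ) : ℂ := ∑' i, d k i * (ph (θ k i) t * ∏ j, a (e k i j))

lemma enorm_prod {ι : Type*} (s : Finset ι) (a : ι → ℂ) : ‖∏ j ∈ s, a j‖ₑ = ∏ j ∈ s, ‖a j‖ₑ := by
  simp only [enorm, nnnorm_prod, ENNReal.ofNNReal_finsetProd]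

lemma FormBound.tsum_enorm_le {K : ℤ → J → ℝ≥0∞} {e : ℤ → J → Fin n → ℤ} {κ : ℝ≥0∞}
    (h : FormBound K e κ) {d : ℤ → J → ℂ} (hd : ∀ k i, ‖d k i‖ₑ ≤ K k i) (θ : ℤ → J → ℤ)
    (t : ℝ) {a : ℤ → ℂ} {M : ℝ≥0∞} (ha : l2 (fun k => ‖a k‖ₑ) ≤ M) (k : ℤ) :
    ∑' i, ‖d k i * (ph (θ k i) t * ∏ j, a (e k i j))‖ₑ ≤ κ * M ^ n := by
  calc _ ≤ posForm K e (fun _ k => ‖a k‖ₑ) k := by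
        refine ENNReal.tsum_le_tsum fun i => ?_
        rw [enorm_mul, enorm_mul, enorm_ph, one_mul, enorm_prod]
        gcongr
        exact hd k i
    _ ≤ l2 (posForm K e (fun _ k => ‖a k‖ₑ)) := le_l2 _ k
    _ ≤ _ := by
        refine (h _).trans ?_
        gcongr
        simp only [Finset.prod_const, Finset.card_univ, Fintype.card_fin]
        gcongr

lemma enorm_form_sub_le {K : ℤ → J → ℝ≥0∞} {e : ℤ → J → Fin n → ℤ} {κ : ℝ≥0∞}
    (h : FormBound K e κ) (hκ : κ ≠ ⊤) {d : ℤ → J → ℂ} (hd : ∀ k i, ‖d k i‖ₑ ≤ K k i)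
    (θ : ℤ → J → ℤ) (t : ℝ) {v w : ℤ → ℂ} (hv : l2 (fun k => ‖v k‖ₑ) ≠ ⊤)
    (hw : l2 (fun k => ‖w k‖ₑ) ≠ ⊤) (k : ℤ) :
    ‖form d θ e t v k - form d θ e t w k‖ₑ ≤
      ∑' i, K k i * ‖∏ j, v (e k i j) - ∏ j, w (e k i j)‖ₑ := by
  have sv : Summable fun i => d k i * (ph (θ k i) t * ∏ j, v (e k i j)) :=
    .of_enorm (ne_top_of_le_ne_top (ENNReal.mul_ne_top hκ (ENNReal.pow_ne_top hv))
      (h.tsum_enorm_le hd θ t le_rfl k))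
  have sw : Summable fun i => d k i * (ph (θ k i) t * ∏ j, w (e k i j)) :=
    .of_enorm (ne_top_of_le_ne_top (ENNReal.mul_ne_top hκ (ENNReal.pow_ne_top hw))
      (h.tsum_enorm_le hd θ t le_rfl k))
  rw [form, form, ← sv.tsum_sub sw]
  refine enorm_tsum_le_tsum_enorm.trans (ENNReal.tsum_le_tsum fun i => ?_)
  rw [← mul_sub, ← mul_sub, enorm_mul, enorm_mul, enorm_ph, one_mul]
  gcongr
  exact hd k i

/-! ### The normal form of the equation -/

/-- Curves `u`, bounded in `ℓ²` by `M`, that solve `∂ₜ u_k = χ_k B₁(u, u)_k`. The multiplier `χ` is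
`1` for the KdV equation and the indicator function of `[-m, m]` for the Galerkin system. -/
structure IsCurve (χ : ℤ → ℂ) (T : ℝ) (M : ℝ≥0∞) (u : ℝ → ℤ → ℂ) : Prop where
  zero_mode : ∀ t ∈ Icc 0 T, u t 0 = 0
  l2_le : ∀ t ∈ Icc 0 T, l2 (fun k => ‖u t k‖ₑ) ≤ M
  prim : ∀ k, IsPrim T (fun t => u t k) (fun t => χ k * B₁ t (u t) (u t) k)

/-- Phases of the quadratic terms: `k³ - k₁³ - k₂³ = 3 k k₁ k₂`. -/
def θ2 (k i : ℤ) : ℤ := 3 * k * i * (k - i)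

/-- Phases of the cubic terms: `k³ - k₁³ - k₂³ - k₃³ = 3 (k₂ + k₃) (k₁ + k₂) (k₁ + k₃)`. -/
def θ3 (k : ℤ) (i : ℤ × ℤ) : ℤ := 3 * (k - i.1) * (i.1 + i.2) * (k - i.2)

/-- Phases of the quartic terms. -/
def θ4 (r : Fin 3) (k : ℤ) (i : (ℤ × ℤ) × ℤ) : ℤ := θ3 k i.1 + θ2 (e3 k i.1 r) i.2

variable (χ : ℤ → ℂ) (N : ℕ)

/-- Coefficients of the low-frequency quadratic terms. -/
noncomputable def coefLow (k i : ℤ) : ℂ :=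
  if |i| ≤ (N : ℤ) ∧ |k - i| ≤ (N : ℤ) then χ k * (Complex.I * k / 2) else 0

/-- Coefficients of the quadratic boundary terms. -/
noncomputable def coefBdry (k i : ℤ) : ℂ :=
  if |i| ≤ (N : ℤ) ∧ |k - i| ≤ (N : ℤ) then 0 else χ k / 6 * ((i : ℂ)⁻¹ * ((k - i : ℤ) : ℂ)⁻¹)

/-- Coefficients of all cubic terms produced by the first integration by parts. The time
derivative falls on either of two factors; the two contributions are equal by symmetry. -/
noncomputable def coefCubic (k : ℤ) (i : ℤ × ℤ) : ℂ :=
  -(Complex.I * ((k - i.1 : ℤ) : ℂ) * χ (k - i.1) * coefBdry χ N k i.1)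

/-- The frequency triples at which no second integration by parts is made: resonant triples and
triples of low frequencies. -/
def IsLow3 (k : ℤ) (i : ℤ × ℤ) : Prop :=
  θ3 k i = 0 ∨ |i.1| ≤ ((2 * N : ℕ) : ℤ) ∧ |i.2| ≤ ((2 * N : ℕ) : ℤ) ∧
    |k - i.1 - i.2| ≤ ((2 * N : ℕ) : ℤ)

open Classical in
/-- Coefficients of the remaining cubic terms. -/
noncomputable def coefRes (k : ℤ) (i : ℤ × ℤ) : ℂ :=
  if IsLow3 N k i then coefCubic χ N k i else 0

open Classical in
/-- Coefficients of the cubic boundary terms. -/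
noncomputable def coefBdry3 (k : ℤ) (i : ℤ × ℤ) : ℂ :=
  if IsLow3 N k i then 0 else coefCubic χ N k i * (Complex.I * θ3 k i)⁻¹

/-- Coefficients of the quartic terms, where the time derivative fell on the factor number `r` of
the cubic boundary term. -/
noncomputable def coefQuart (r : Fin 3) (k : ℤ) (i : (ℤ × ℤ) × ℤ) : ℂ :=
  -(coefBdry3 χ N k i.1 * (χ (e3 k i.1 r) * (Complex.I * e3 k i.1 r / 2)))

section bounds
variable {χ} (hχ : ∀ k, ‖χ k‖ₑ ≤ 1)
include hχ

lemma enorm_mul_half_le (k : ℤ) : ‖χ k * (Complex.I * k / 2)‖ₑ ≤ ‖(k : ℂ)‖ₑ := by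
  have h2 : ‖(2 : ℂ)⁻¹‖ₑ ≤ 1 := by
    rw [← ofReal_norm]
    exact ENNReal.ofReal_le_one.2 (by norm_num)
  have hI : ‖Complex.I‖ₑ = 1 := by rw [← ofReal_norm]; simp
  rw [div_eq_mul_inv, enorm_mul, enorm_mul, enorm_mul, hI, one_mul]
  calc _ ≤ 1 * (‖(k : ℂ)‖ₑ * 1) := by gcongr; exact hχ k
    _ = _ := by simp

lemma enorm_coefLow_le (k i : ℤ) : ‖coefLow χ N k i‖ₑ ≤ kerLow N k i := by
  unfold coefLow kerLow
  split_ifs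
  · exact enorm_mul_half_le hχ k
  · simp

lemma enorm_coefBdry_le (k i : ℤ) : ‖coefBdry χ N k i‖ₑ ≤ kerBdry N k i := by
  unfold coefBdry kerBdry
  split_ifs
  · simp
  · have h2 : ‖(6 : ℂ)⁻¹‖ₑ ≤ 1 := by
      rw [← ofReal_norm]
      exact ENNReal.ofReal_le_one.2 (by norm_num)
    rw [div_eq_mul_inv, enorm_mul, enorm_mul, enorm_mul]
    calc _ ≤ 1 * 1 * (‖(i : ℂ)⁻¹‖ₑ * ‖((k - i : ℤ) : ℂ)⁻¹‖ₑ) := by gcongr; exact hχ k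
      _ = _ := by rw [one_mul, one_mul]; rfl

lemma enorm_coefBdry_le' (k i : ℤ) : ‖coefBdry χ N k i‖ₑ ≤ invAbs i * invAbs (k - i) := by
  refine (enorm_coefBdry_le N hχ k i).trans ?_
  unfold kerBdry
  split_ifs <;> simp

lemma enorm_coefCubic_le (k : ℤ) (i : ℤ × ℤ) : ‖coefCubic χ N k i‖ₑ ≤ invAbs i.1 := by
  have hI : ‖Complex.I‖ₑ = 1 := by rw [← ofReal_norm]; simp
  rw [coefCubic, enorm_neg, enorm_mul, enorm_mul, enorm_mul, hI, one_mul]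
  calc _ ≤ ‖((k - i.1 : ℤ) : ℂ)‖ₑ * 1 * (invAbs i.1 * invAbs (k - i.1)) := by
        gcongr
        · exact hχ _
        · exact enorm_coefBdry_le' N hχ _ _
    _ = (‖((k - i.1 : ℤ) : ℂ)‖ₑ * invAbs (k - i.1)) * invAbs i.1 := by ring
    _ ≤ 1 * invAbs i.1 := by gcongr; exact enorm_mul_invAbs_le _
    _ = _ := one_mul _

lemma enorm_coefRes_le (k : ℤ) (i : ℤ × ℤ) : ‖coefRes χ N k i‖ₑ ≤ kerRes N k i := by
  unfold coefRes
  split_ifs with h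
  · rcases eq_or_ne (k - i.1) 0 with h0 | h0
    · simp [coefCubic, h0]
    have : i.2 = -i.1 ∨ i.2 = k ∨ |i.2| ≤ ((2 * N : ℕ) : ℤ) := by
      rcases h with h | h
      · simp only [θ3, mul_eq_zero, h0, or_false, OfNat.ofNat_ne_zero, false_or] at h
        omega
      · exact .inr (.inr h.2.1)
    rw [kerRes, if_pos this]
    exact enorm_coefCubic_le N hχ k i
  · simp

lemma enorm_coefBdry3_le (k : ℤ) (i : ℤ × ℤ) : ‖coefBdry3 χ N k i‖ₑ ≤ kerBdry3 N k i := by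
  unfold coefBdry3
  split_ifs with h
  · simp
  · have hI : ‖Complex.I⁻¹‖ₑ = 1 := by rw [← ofReal_norm]; simp
    have h3 : ‖((3 : ℤ) : ℂ)⁻¹‖ₑ ≤ 1 := invAbs_le_one 3
    rw [IsLow3, not_or] at h
    rw [kerBdry3, if_neg h.2, θ3]
    push_cast only [Int.cast_mul]
    simp only [mul_inv, enorm_mul, hI, one_mul]
    calc _ ≤ invAbs i.1 * (1 * invAbs (k - i.1) * invAbs (i.1 + i.2) * invAbs (k - i.2)) := by
          gcongr
          · exact enorm_coefCubic_le N hχ k i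
          all_goals exact le_rfl
      _ = _ := by ring

lemma enorm_coefQuart_le (r : Fin 3) (k : ℤ) (i : (ℤ × ℤ) × ℤ) :
    ‖coefQuart χ N r k i‖ₑ ≤ kerQuart r k i.1 := by
  rw [coefQuart, enorm_neg, enorm_mul, kerQuart]
  gcongr
  · refine (enorm_coefBdry3_le N hχ k i.1).trans ?_
    unfold kerBdry3
    split_ifs <;> simp
  · exact enorm_mul_half_le hχ _

end bounds

end

/-! ### Integration by parts in time -/

lemma B₁_eq (c : ℂ) (t : ℝ) (a : ℤ → ℂ) (k : ℤ) :
    c * B₁ t a a k = ∑' i, c * (Complex.I * k / 2) * (ph (θ2 k i) t * (a i * a (k - i))) := by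
  rw [B₁, ← tsum_mul_left, ← tsum_mul_left]
  refine tsum_congr fun i => ?_
  rw [ph, θ2]
  push_cast
  ring_nf

lemma tsum_enorm_mul_le {a : ℤ → ℂ} {M : ℝ≥0∞} (ha : l2 (fun k => ‖a k‖ₑ) ≤ M) (k : ℤ) :
    ∑' i, ‖a i‖ₑ * ‖a (k - i)‖ₑ ≤ M ^ 2 := by
  refine (tsum_mul_le_l2 _ _).trans ?_
  rw [pow_two]
  gcongr
  rw [l2, tsum_sub_left (fun i => ‖a i‖ₑ ^ 2) k]
  exact ha

/-- Expansion of a sum with the right-hand side of the equation as a factor. -/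
lemma tsum_mul_B₁_eq {χ : ℤ → ℂ} {J : Type*} {a : ℤ → ℂ} (t : ℝ) (g : J → ℂ) (m : J → ℤ)
    (G : J × ℤ → ℂ)
    (hG : ∀ i p, G (i, p) = g i * (χ (m i) * (Complex.I * m i / 2) *
      (ph (θ2 (m i) p) t * (a p * a (m i - p)))))
    (hfin : ∑' x, ‖G x‖ₑ ≠ ⊤) :
    ∑' i, ‖g i * (χ (m i) * B₁ t a a (m i))‖ₑ ≤ ∑' x, ‖G x‖ₑ ∧
      ∑' i, g i * (χ (m i) * B₁ t a a (m i)) = ∑' x, G x := by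
  have h1 (i : J) : g i * (χ (m i) * B₁ t a a (m i)) = ∑' p, G (i, p) := by
    rw [B₁_eq, ← tsum_mul_left]
    exact tsum_congr fun p => (hG i p).symm
  constructor
  · rw [tsum_pair]
    refine ENNReal.tsum_le_tsum fun i => ?_
    rw [h1]
    exact enorm_tsum_le_tsum_enorm
  · simp_rw [h1]
    exact ((Summable.of_enorm hfin).tsum_prod).symm

lemma l2_invAbs_ne_top : l2 invAbs ≠ ⊤ := by
  have h := zetaTwo_ne_top
  rw [zetaTwo, ← l2_sq] at h
  exact fun h' => h (by simp [h'])

lemma tsum_enorm_cubic_le {d : ℤ × ℤ → ℂ} (hd : ∀ i, ‖d i‖ₑ ≤ invAbs i.1) (θ : ℤ × ℤ → ℤ) (t : ℝ)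
    {a : ℤ → ℂ} {M : ℝ≥0∞} (ha : l2 (fun k => ‖a k‖ₑ) ≤ M) (k : ℤ) :
    ∑' i, ‖d i * (ph (θ i) t * ∏ j, a (e3 k i j))‖ₑ ≤ l2 invAbs * M * M ^ 2 := by
  rw [tsum_pair]
  calc _ ≤ ∑' i, invAbs i * ‖a i‖ₑ * ∑' j, ‖a j‖ₑ * ‖a (k - i - j)‖ₑ := by
        refine ENNReal.tsum_le_tsum fun i => ?_
        rw [← ENNReal.tsum_mul_left]
        refine ENNReal.tsum_le_tsum fun j => ?_
        simp only [e3, Fin.prod_univ_three, Matrix.cons_val]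
        rw [enorm_mul, enorm_mul, enorm_ph, one_mul, enorm_mul, enorm_mul, mul_assoc, mul_assoc]
        gcongr
        exact hd (i, j)
    _ ≤ ∑' i, invAbs i * ‖a i‖ₑ * M ^ 2 := by
        gcongr with i
        exact tsum_enorm_mul_le ha _
    _ ≤ _ := by
        rw [ENNReal.tsum_mul_right]
        gcongr
        exact (tsum_mul_le_l2 _ _).trans (by gcongr)

section
variable {χ : ℤ → ℂ} (hχ : ∀ k, ‖χ k‖ₑ ≤ 1)
include hχ

lemma tsum_enorm_B₁_le {a : ℤ → ℂ} {M : ℝ≥0∞} (ha : l2 (fun k => ‖a k‖ₑ) ≤ M) (t : ℝ) (k : ℤ) :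
    ∑' i, ‖χ k * (Complex.I * k / 2) * (ph (θ2 k i) t * (a i * a (k - i)))‖ₑ ≤
      ‖(k : ℂ)‖ₑ * M ^ 2 := by
  simp_rw [enorm_mul _ (ph _ _ * _), enorm_mul (ph _ _), enorm_ph, one_mul, enorm_mul (a _),
    ENNReal.tsum_mul_left]
  gcongr
  · exact enorm_mul_half_le hχ k
  · exact tsum_enorm_mul_le ha k

lemma enorm_B₁_le {a : ℤ → ℂ} {M : ℝ≥0∞} (ha : l2 (fun k => ‖a k‖ₑ) ≤ M) (t : ℝ) (k : ℤ) :
    ‖χ k * B₁ t a a k‖ₑ ≤ ‖(k : ℂ)‖ₑ * M ^ 2 := by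
  rw [B₁_eq]
  exact enorm_tsum_le_tsum_enorm.trans (tsum_enorm_B₁_le hχ ha t k)

end

section
variable {χ : ℤ → ℂ} (hχ : ∀ k, ‖χ k‖ₑ ≤ 1) (N : ℕ) {T : ℝ} {M : ℝ≥0∞} {u : ℝ → ℤ → ℂ}

lemma θ2_symm (k i : ℤ) : θ2 k (k - i) = θ2 k i := by unfold θ2; ring

lemma coefBdry_symm (k i : ℤ) : coefBdry χ N k (k - i) = coefBdry χ N k i := by
  unfold coefBdry
  simp only [sub_sub_cancel, and_comm, mul_comm]

lemma coefBdry_mul_phase (k i : ℤ) {b : ℂ} (hb : i = 0 ∨ k - i = 0 → b = 0) :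
    coefBdry χ N k i * (Complex.I * θ2 k i * b) =
      χ k * (Complex.I * k / 2) * b - coefLow χ N k i * b := by
  by_cases h0 : i = 0 ∨ k - i = 0
  · simp [hb h0]
  rw [not_or] at h0
  have h1 : (i : ℂ) ≠ 0 := by exact_mod_cast h0.1
  have h2 : ((k - i : ℤ) : ℂ) ≠ 0 := by exact_mod_cast h0.2
  unfold coefBdry coefLow
  split_ifs
  · ring
  · rw [θ2]
    push_cast at h2 ⊢
    field_simp
    ring

include hχ

/-- The first integration by parts: the quadratic terms with a high frequency are replaced by
boundary terms with two reciprocals and by cubic terms with a single one. -/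
lemma IsCurve.isPrim_cubic (hu : IsCurve χ T M u) (hM : M ≠ ⊤) (hT : 0 ≤ T) (k : ℤ) :
    IsPrim T (fun t => u t k - form (coefBdry χ N) θ2 e2 t (u t) k)
      (fun t => form (coefLow χ N) θ2 e2 t (u t) k + form (coefCubic χ N) θ3 e3 t (u t) k) := by
  have l2top := l2_invAbs_ne_top
  have topG : l2 invAbs * M * M ^ 2 ≠ ⊤ := by finiteness
  have topA : ‖(k : ℂ)‖ₑ * M ^ 2 ≠ ⊤ := by finiteness
  have topL : (2 * N * (2 * N + 1)) * M ^ 2 ≠ ⊤ := by finiteness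
  have topQ : M ^ 2 ≠ ⊤ := by finiteness
  have topC : (‖(k : ℂ)‖ₑ * M ^ 2 + (2 * N * (2 * N + 1)) * M ^ 2) +
      (l2 invAbs * M * M ^ 2 + l2 invAbs * M * M ^ 2) ≠ ⊤ := by finiteness
  set u' : ℤ → ℝ → ℂ := fun k t => χ k * B₁ t (u t) (u t) k with hu'
  -- the boundary terms and their derivatives
  let Q (i : ℤ) (t : ℝ) : ℂ := coefBdry χ N k i * (ph (θ2 k i) t * (u t i * u t (k - i)))
  let A (i : ℤ) (t : ℝ) : ℂ := χ k * (Complex.I * k / 2) * (ph (θ2 k i) t * (u t i * u t (k - i)))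
  let L (i : ℤ) (t : ℝ) : ℂ := coefLow χ N k i * (ph (θ2 k i) t * (u t i * u t (k - i)))
  let R (i : ℤ) (t : ℝ) : ℂ := coefBdry χ N k i * (ph (θ2 k i) t * u t i) * u' (k - i) t
  let G (t : ℝ) (x : ℤ × ℤ) : ℂ := coefCubic χ N k x *
    (ph (θ3 k x) t * (u t x.1 * u t x.2 * u t (k - x.1 - x.2)))
  have bA (t : ℝ) (ht : t ∈ Icc 0 T) : ∑' i, ‖A i t‖ₑ ≤ ‖(k : ℂ)‖ₑ * M ^ 2 :=
    tsum_enorm_B₁_le hχ (hu.l2_le t ht) t k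
  have bL (t : ℝ) (ht : t ∈ Icc 0 T) : ∑' i, ‖L i t‖ₑ ≤ (2 * N * (2 * N + 1)) * M ^ 2 := by
    simpa [e2, Fin.prod_univ_two, L] using
      (formBound_kerLow N).tsum_enorm_le (enorm_coefLow_le N hχ) θ2 t (hu.l2_le t ht) k
  have bQ (t : ℝ) (ht : t ∈ Icc 0 T) : ∑' i, ‖Q i t‖ₑ ≤ M ^ 2 := by
    refine (ENNReal.tsum_le_tsum fun i => ?_).trans (tsum_enorm_mul_le (hu.l2_le t ht) k)
    rw [enorm_mul, enorm_mul, enorm_ph, one_mul, enorm_mul]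
    refine mul_le_of_le_one_left' ((enorm_coefBdry_le' N hχ k i).trans ?_)
    exact mul_le_one' (invAbs_le_one _) (invAbs_le_one _)
  have bG (t : ℝ) (ht : t ∈ Icc 0 T) : ∑' x, ‖G t x‖ₑ ≤ l2 invAbs * M * M ^ 2 := by
    simpa only [G, e3, Fin.prod_univ_three, Matrix.cons_val] using
      tsum_enorm_cubic_le (enorm_coefCubic_le N hχ k) (θ3 k) t (hu.l2_le t ht) k
  have expR (t : ℝ) (ht : t ∈ Icc 0 T) : ∑' i, ‖(-2 : ℂ) * R i t‖ₑ ≤ ∑' x, ‖G t x‖ₑ ∧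
      ∑' i, (-2 : ℂ) * R i t = ∑' x, G t x := by
    simp only [R, ← mul_assoc]
    refine tsum_mul_B₁_eq t
      (fun i => -2 * coefBdry χ N k i * ph (θ2 k i) t * u t i) (fun i => k - i) _ (fun i p => ?_)
      (ne_top_of_le_ne_top topG (bG t ht))
    have : θ3 k (i, p) = θ2 k i + θ2 (k - i) p := by unfold θ3 θ2; ring
    simp only [G, this, ph_add, coefCubic]
    push_cast
    ring
  have bR (t : ℝ) (ht : t ∈ Icc 0 T) : ∑' i, ‖R i t‖ₑ ≤ l2 invAbs * M * M ^ 2 := by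
    refine le_trans (ENNReal.tsum_le_tsum fun i => ?_) ((expR t ht).1.trans (bG t ht))
    rw [enorm_mul (-2 : ℂ)]
    refine le_mul_of_one_le_left' ?_
    rw [← ofReal_norm, ENNReal.one_le_ofReal]
    norm_num
  have symR (i : ℤ) (t : ℝ) : R (k - i) t =
      coefBdry χ N k i * (ph (θ2 k i) t * (u' i t * u t (k - i))) := by
    simp only [R, coefBdry_symm, θ2_symm, sub_sub_cancel]
    ring
  have hprim (i : ℤ) : IsPrim T (Q i)
      (fun t => (A i t - L i t) + (R (k - i) t + R i t)) := by
    refine (((isPrim_ph T (θ2 k i)).mul ((hu.prim i).mul (hu.prim (k - i)) hT) hT).const_mul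
      (coefBdry χ N k i)).congr hT (fun t _ => rfl) fun t ht => ?_
    have := coefBdry_mul_phase (χ := χ) N k i (b := ph (θ2 k i) t * (u t i * u t (k - i))) (by
      rintro (h | h) <;> simp [h, hu.zero_mode t ht])
    rw [symR]
    simp only [A, L, R, ← this, hu']
    ring
  have hsum := IsPrim.tsum hprim (fun t ht => ne_top_of_le_ne_top topQ (bQ t ht)) topC
    fun t ht => by
      calc _ ≤ ∑' i, ((‖A i t‖ₑ + ‖L i t‖ₑ) + (‖R (k - i) t‖ₑ + ‖R i t‖ₑ)) := by
            refine ENNReal.tsum_le_tsum fun i => (enorm_add_le _ _).trans ?_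
            gcongr
            · exact enorm_sub_le
            · exact enorm_add_le _ _
        _ ≤ _ := by
            rw [ENNReal.tsum_add, ENNReal.tsum_add, ENNReal.tsum_add,
              tsum_sub_left (fun i => ‖R i t‖ₑ)]
            gcongr
            exacts [bA t ht, bL t ht, bR t ht, bR t ht]
  refine ((hu.prim k).sub hsum).congr hT (fun t _ => ?_) fun t ht => ?_
  · simp [form, e2, Fin.prod_univ_two, Q]
  · have sA : Summable fun i => A i t :=
      .of_enorm (ne_top_of_le_ne_top topA (bA t ht))
    have sL : Summable fun i => L i t :=
      .of_enorm (ne_top_of_le_ne_top topL (bL t ht))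
    have sR : Summable fun i => R i t :=
      .of_enorm (ne_top_of_le_ne_top topG (bR t ht))
    have sR' : Summable fun i => R (k - i) t := (Equiv.subLeft k).summable_iff.2 sR
    have eR : ∑' i, R (k - i) t = ∑' i, R i t := (Equiv.subLeft k).tsum_eq fun i => R i t
    have e1 := (expR t ht).2
    rw [tsum_mul_left] at e1
    have e3' : form (coefCubic χ N) θ3 e3 t (u t) k = ∑' x, G t x := by
      simp [form, e3, Fin.prod_univ_three, G]
    have e2' : form (coefLow χ N) θ2 e2 t (u t) k = ∑' x, L x t := by
      simp [form, e2, Fin.prod_univ_two, L]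
    simp only
    rw [(sA.sub sL).tsum_add (sR'.add sR), sA.tsum_sub sL, sR'.tsum_add sR, eR, e3', e2', ← e1,
      B₁_eq]
    simp only [A]
    ring

end

section
variable {χ : ℤ → ℂ} (hχ : ∀ k, ‖χ k‖ₑ ≤ 1) (N : ℕ) {T : ℝ} {M : ℝ≥0∞} {u : ℝ → ℤ → ℂ}

lemma coefBdry3_mul_phase (k : ℤ) (i : ℤ × ℤ) (b : ℂ) :
    coefBdry3 χ N k i * (Complex.I * θ3 k i * b) =
      coefCubic χ N k i * b - coefRes χ N k i * b := by
  unfold coefBdry3 coefRes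
  split_ifs with h
  · ring
  · have : (θ3 k i : ℂ) ≠ 0 := by
      rw [IsLow3, not_or] at h
      exact_mod_cast h.1
    field_simp
    ring

lemma kerBdry3_le (k : ℤ) (i : ℤ × ℤ) : kerBdry3 N k i ≤ invAbs i.1 := by
  unfold kerBdry3
  split_ifs
  · simp
  · calc _ ≤ invAbs i.1 * 1 * 1 * 1 := by gcongr <;> exact invAbs_le_one _
      _ = _ := by simp

include hχ

/-- The normal form of the equation, obtained by integrating by parts in time twice. All forms in
it are bounded on `ℓ²`. -/
lemma IsCurve.isPrim_normalForm (hu : IsCurve χ T M u) (hM : M ≠ ⊤) (hT : 0 ≤ T) (k : ℤ) :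
    IsPrim T (fun t => u t k - form (coefBdry χ N) θ2 e2 t (u t) k -
        form (coefBdry3 χ N) θ3 e3 t (u t) k)
      (fun t => form (coefLow χ N) θ2 e2 t (u t) k + form (coefRes χ N) θ3 e3 t (u t) k +
        ∑ r, form (coefQuart χ N r) (θ4 r) (e4 r) t (u t) k) := by
  have hζ := zetaTwo_ne_top
  have l2top := l2_invAbs_ne_top
  have topG : 4 * (1 + zetaTwo) ^ 2 * M ^ 4 ≠ ⊤ := by finiteness
  have topB : l2 invAbs * M * M ^ 2 ≠ ⊤ := by finiteness
  have topR : (1 + zetaTwo) * (4 * N + 3) * M ^ 3 ≠ ⊤ := by finiteness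
  have topC : (l2 invAbs * M * M ^ 2 + (1 + zetaTwo) * (4 * N + 3) * M ^ 3) +
      ∑ r : Fin 3, 4 * (1 + zetaTwo) ^ 2 * M ^ 4 ≠ ⊤ :=
    ENNReal.add_ne_top.2 ⟨ENNReal.add_ne_top.2 ⟨topB, topR⟩, ENNReal.sum_ne_top.2 fun _ _ => topG⟩
  set u' : ℤ → ℝ → ℂ := fun k t => χ k * B₁ t (u t) (u t) k with hu'
  let P (i : ℤ × ℤ) (t : ℝ) : ℂ := ph (θ3 k i) t * ∏ j, u t (e3 k i j)
  let S (r : Fin 3) (i : ℤ × ℤ) (t : ℝ) : ℂ := coefBdry3 χ N k i * ph (θ3 k i) t *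
    (u t (e3 k i (r.succAbove 0)) * u t (e3 k i (r.succAbove 1))) * u' (e3 k i r) t
  let G (r : Fin 3) (t : ℝ) (x : (ℤ × ℤ) × ℤ) : ℂ := coefQuart χ N r k x *
    (ph (θ4 r k x) t * ∏ j, u t (e4 r k x j))
  have bG (r : Fin 3) (t : ℝ) (ht : t ∈ Icc 0 T) :
      ∑' x, ‖G r t x‖ₑ ≤ 4 * (1 + zetaTwo) ^ 2 * M ^ 4 :=
    (formBound_kerQuart r).tsum_enorm_le (enorm_coefQuart_le N hχ r) (θ4 r) t (hu.l2_le t ht) k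
  have expS (r : Fin 3) (t : ℝ) (ht : t ∈ Icc 0 T) :
      ∑' i, ‖-S r i t‖ₑ ≤ ∑' x, ‖G r t x‖ₑ ∧ ∑' i, -S r i t = ∑' x, G r t x := by
    simp only [S, ← neg_mul]
    refine tsum_mul_B₁_eq t (fun i => -coefBdry3 χ N k i * ph (θ3 k i) t *
      (u t (e3 k i (r.succAbove 0)) * u t (e3 k i (r.succAbove 1)))) (fun i => e3 k i r) _
      (fun i p => ?_) (ne_top_of_le_ne_top topG (bG r t ht))
    simp only [G, θ4, ph_add, coefQuart, e4, Fin.prod_univ_four, Matrix.cons_val]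
    ring
  have bS (r : Fin 3) (t : ℝ) (ht : t ∈ Icc 0 T) :
      ∑' i, ‖S r i t‖ₑ ≤ 4 * (1 + zetaTwo) ^ 2 * M ^ 4 := by
    simpa using (expS r t ht).1.trans (bG r t ht)
  have bRes (t : ℝ) (ht : t ∈ Icc 0 T) :
      ∑' i, ‖coefRes χ N k i * P i t‖ₑ ≤ (1 + zetaTwo) * (4 * N + 3) * M ^ 3 :=
    (formBound_kerRes N).tsum_enorm_le (enorm_coefRes_le N hχ) θ3 t (hu.l2_le t ht) k
  have bBdry (t : ℝ) (ht : t ∈ Icc 0 T) :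
      ∑' i, ‖coefBdry3 χ N k i * P i t‖ₑ ≤ l2 invAbs * M * M ^ 2 :=
    tsum_enorm_cubic_le (fun i => (enorm_coefBdry3_le N hχ k i).trans (kerBdry3_le N k i))
      (θ3 k) t (hu.l2_le t ht) k
  have bCub (t : ℝ) (ht : t ∈ Icc 0 T) :
      ∑' i, ‖coefCubic χ N k i * P i t‖ₑ ≤ l2 invAbs * M * M ^ 2 :=
    tsum_enorm_cubic_le (enorm_coefCubic_le N hχ k) (θ3 k) t (hu.l2_le t ht) k
  have hprim (i : ℤ × ℤ) : IsPrim T (fun t => coefBdry3 χ N k i * P i t)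
      (fun t => (coefCubic χ N k i * P i t - coefRes χ N k i * P i t) + ∑ r, S r i t) := by
    refine (((isPrim_ph T (θ3 k i)).mul (((hu.prim (e3 k i 0)).mul (hu.prim (e3 k i 1)) hT).mul
      (hu.prim (e3 k i 2)) hT) hT).const_mul (coefBdry3 χ N k i)).congr hT
      (fun t _ => ?_) fun t ht => ?_
    · simp [P, Fin.prod_univ_three]
    · simp only
      rw [← coefBdry3_mul_phase]
      simp only [P, S, Fin.prod_univ_three, Fin.sum_univ_three, hu',
        show (0 : Fin 3).succAbove (0 : Fin 2) = 1 from rfl,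
        show (0 : Fin 3).succAbove (1 : Fin 2) = 2 from rfl,
        show (1 : Fin 3).succAbove (0 : Fin 2) = 0 from rfl,
        show (1 : Fin 3).succAbove (1 : Fin 2) = 2 from rfl,
        show (2 : Fin 3).succAbove (0 : Fin 2) = 0 from rfl,
        show (2 : Fin 3).succAbove (1 : Fin 2) = 1 from rfl]
      ring
  have hsum := IsPrim.tsum hprim (fun t ht => ne_top_of_le_ne_top topB (bBdry t ht)) topC
    fun t ht => by
      calc _ ≤ ∑' i, ((‖coefCubic χ N k i * P i t‖ₑ + ‖coefRes χ N k i * P i t‖ₑ) +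
            ∑ r, ‖S r i t‖ₑ) := by
            refine ENNReal.tsum_le_tsum fun i => (enorm_add_le _ _).trans ?_
            gcongr
            · exact enorm_sub_le
            · exact enorm_sum_le _ _
        _ ≤ _ := by
            rw [ENNReal.tsum_add, ENNReal.tsum_add,
              Summable.tsum_finsetSum fun _ _ => ENNReal.summable]
            gcongr with r
            exacts [bCub t ht, bRes t ht, bS r t ht]
  refine ((hu.isPrim_cubic hχ N hM hT k).sub hsum).congr hT (fun t _ => rfl) fun t ht => ?_
  have sC : Summable fun i => coefCubic χ N k i * P i t :=
    .of_enorm (ne_top_of_le_ne_top topB (bCub t ht))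
  have sR : Summable fun i => coefRes χ N k i * P i t :=
    .of_enorm (ne_top_of_le_ne_top topR (bRes t ht))
  have sS (r : Fin 3) : Summable fun i => S r i t :=
    .of_enorm (ne_top_of_le_ne_top topG (bS r t ht))
  have eS (r : Fin 3) : form (coefQuart χ N r) (θ4 r) (e4 r) t (u t) k = -∑' i, S r i t := by
    rw [← tsum_neg, (expS r t ht).2]
    rfl
  simp only
  rw [(sC.sub sR).tsum_add (summable_sum fun r _ => sS r), sC.tsum_sub sR,
    Summable.tsum_finsetSum fun r _ => sS r]
  simp_rw [eS, Finset.sum_neg_distrib]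
  change _ + form (coefCubic χ N) θ3 e3 t (u t) k - (form (coefCubic χ N) θ3 e3 t (u t) k -
    form (coefRes χ N) θ3 e3 t (u t) k + _) = _
  ring

end

/-! ### The Lipschitz estimate -/

lemma FormBound.form_diff {J : Type*} {n : ℕ} [NeZero n] {K : ℤ → J → ℝ≥0∞}
    {e : ℤ → J → Fin n → ℤ} {κ : ℝ≥0∞} (hb : FormBound K e κ) (hκ : κ ≠ ⊤)
    (he : ∀ k i, ∑ j, e k i j = k) {d : ℤ → J → ℂ} (hd : ∀ k i, ‖d k i‖ₑ ≤ K k i)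
    (θ : ℤ → J → ℤ) (t : ℝ) {s : ℝ} (hs : 0 ≤ s) {L : ℝ≥0∞} (hL : L ≠ ⊤) {v w : ℤ → ℂ}
    (h : DiffBound s L v w) :
    l2 (fun k => wt s k * ‖form d θ e t v k - form d θ e t w k‖ₑ) ≤
      (ENNReal.ofReal ((n : ℝ) ^ s) * n ^ 2 * L ^ (n - 1)) * κ *
        l2 (fun k => wt s k * ‖v k - w k‖ₑ) := by
  refine (l2_mono fun k => ?_).trans (hb.weighted_diff he hs h)
  gcongr
  refine enorm_form_sub_le hb hκ hd θ t ?_ ?_ k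
  · exact ne_top_of_le_ne_top hL ((l2_mono fun k => le_self_add).trans h.sum_le)
  · exact ne_top_of_le_ne_top hL ((l2_mono fun k => le_add_self).trans h.sum_le)

/-- Minkowski's integral inequality for sequences. -/
lemma l2_lintegral_le {α β : Type*} [Countable β] [MeasurableSpace α] (μ : Measure α)
    {G : β → α → ℝ≥0∞} (hG : ∀ k, AEMeasurable (G k) μ) (hfin : ∀ k, ∫⁻ x, G k x ∂μ ≠ ⊤) :
    l2 (fun k => ∫⁻ x, G k x ∂μ) ≤ ∫⁻ x, l2 (fun k => G k x) ∂μ := by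
  classical
  rw [l2_le_iff, ENNReal.tsum_eq_iSup_sum]
  refine iSup_le fun s => ?_
  set F : β → ℝ≥0∞ := fun k => if k ∈ s then ∫⁻ x, G k x ∂μ else 0 with hF
  have e1 : ∑ k ∈ s, (∫⁻ x, G k x ∂μ) ^ 2 = l2 F ^ 2 := by
    rw [l2_sq, tsum_eq_sum (s := s) fun k hk => by simp [hF, hk]]
    exact Finset.sum_congr rfl fun k hk => by simp [hF, hk]
  have e2 : l2 F ^ 2 ≤ l2 F * ∫⁻ x, l2 (fun k => G k x) ∂μ := by
    calc l2 F ^ 2 = ∑' k, ∫⁻ x, F k * G k x ∂μ := by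
          rw [l2_sq]
          refine tsum_congr fun k => ?_
          rw [lintegral_const_mul'' _ (hG k)]
          by_cases hk : k ∈ s <;> simp [hF, hk, pow_two]
      _ = ∫⁻ x, ∑' k, F k * G k x ∂μ :=
          (lintegral_tsum fun k => (hG k).const_mul _).symm
      _ ≤ ∫⁻ x, l2 F * l2 (fun k => G k x) ∂μ := lintegral_mono fun x => tsum_mul_le_l2 _ _
      _ = _ := by
          refine lintegral_const_mul'' _ ?_
          unfold l2
          exact (AEMeasurable.tsum fun k => (hG k).pow_const 2).pow_const _
  have htop : l2 F ≠ ⊤ := by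
    intro h
    have := e1.symm ▸ (ENNReal.sum_ne_top.2 fun k _ => ENNReal.pow_ne_top (n := 2) (hfin k) :
      ∑ k ∈ s, (∫⁻ x, G k x ∂μ) ^ 2 ≠ ⊤)
    simp [h] at this
  rw [e1]
  rcases eq_or_ne (l2 F) 0 with h0 | h0
  · simp [h0]
  · gcongr
    rw [pow_two] at e2
    exact (ENNReal.mul_le_mul_iff_right h0 htop).1 e2

lemma le_two_mul_of_le_add_half {a b : ℝ≥0∞} (ha : a ≠ ⊤) (h : a ≤ b + a / 2) : a ≤ 2 * b := by
  have h1 : a / 2 ≤ b := by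
    have h2 : a / 2 + a / 2 ≤ b + a / 2 := by rwa [ENNReal.add_halves]
    exact (ENNReal.add_le_add_iff_right (by finiteness)).1 h2
  calc a = a / 2 + a / 2 := (ENNReal.add_halves a).symm
    _ ≤ b + b := by gcongr
    _ = _ := (two_mul b).symm

lemma lintegral_exp_le {c : ℝ} (hc : 0 < c) {t : ℝ} (ht : 0 ≤ t) :
    ∫⁻ τ in Ioc 0 t, ENNReal.ofReal (Real.exp (c * τ)) ≤
      ENNReal.ofReal c⁻¹ * ENNReal.ofReal (Real.exp (c * t)) := by
  have hi : IntegrableOn (fun τ => Real.exp (c * τ)) (Ioc 0 t) := by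
    have : Continuous fun τ => Real.exp (c * τ) := by fun_prop
    exact (this.intervalIntegrable 0 t).1
  rw [← ofReal_integral_eq_lintegral_ofReal hi (.of_forall fun _ => (Real.exp_pos _).le),
    ← ENNReal.ofReal_mul (by positivity), ← intervalIntegral.integral_of_le ht,
    intervalIntegral.integral_comp_mul_left _ hc.ne', integral_exp, smul_eq_mul]
  refine ENNReal.ofReal_le_ofReal ?_
  gcongr
  simp

/-- A Gronwall inequality. No measurability of `y` is needed, because the supremum of
`exp (-2 c t) y t` is compared with itself. -/
lemma gronwall {T : ℝ} {y : ℝ → ℝ≥0∞} {S y₀ : ℝ≥0∞} (hS : S ≠ ⊤) (hy : ∀ t ∈ Icc 0 T, y t ≤ S)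
    {c : ℝ} (hc : 0 < c)
    (h : ∀ g : ℝ → ℝ≥0∞, Measurable g → (∀ t ∈ Icc 0 T, y t ≤ g t) → ∀ t ∈ Icc 0 T,
      y t ≤ y₀ + ENNReal.ofReal c * ∫⁻ τ in Ioc 0 t, g τ) :
    ∀ t ∈ Icc 0 T, y t ≤ 2 * ENNReal.ofReal (Real.exp (2 * c * T)) * y₀ := by
  set E : ℝ → ℝ≥0∞ := fun t => ENNReal.ofReal (Real.exp (2 * c * t)) with hE
  set E' : ℝ → ℝ≥0∞ := fun t => ENNReal.ofReal (Real.exp (-(2 * c * t))) with hE'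
  have hEE (t : ℝ) : E t * E' t = 1 := by
    rw [hE, hE', ← ENNReal.ofReal_mul (Real.exp_pos _).le, ← Real.exp_add]
    simp
  set A := ⨆ t ∈ Icc 0 T, y t * E' t with hA
  have hE1 (t : ℝ) (ht : t ∈ Icc 0 T) : E' t ≤ 1 := by
    rw [hE', ENNReal.ofReal_le_one, Real.exp_le_one_iff]
    have := mul_nonneg hc.le ht.1
    linarith
  have hyA (t : ℝ) (ht : t ∈ Icc 0 T) : y t ≤ A * E t := by
    calc y t = y t * E' t * E t := by rw [mul_assoc, mul_comm (E' t), hEE, mul_one]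
      _ ≤ _ := by gcongr; exact le_iSup₂_of_le t ht le_rfl
  have hAtop : A ≠ ⊤ := by
    refine ne_top_of_le_ne_top hS (iSup₂_le fun t ht => ?_)
    calc _ ≤ S * 1 := by gcongr; exacts [hy t ht, hE1 t ht]
      _ = S := mul_one S
  have hA2 : A ≤ 2 * y₀ := by
    refine le_two_mul_of_le_add_half hAtop (iSup₂_le fun t ht => ?_)
    have h1 := h (fun t => A * E t) (by fun_prop) hyA t ht
    have hcancel : ENNReal.ofReal c * ENNReal.ofReal (2 * c)⁻¹ = 2⁻¹ := by
      rw [← ENNReal.ofReal_mul hc.le, show c * (2 * c)⁻¹ = 2⁻¹ by field_simp,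
        ENNReal.ofReal_inv_of_pos two_pos]
      simp
    have h2 : ENNReal.ofReal c * ∫⁻ τ in Ioc 0 t, A * E τ ≤ A / 2 * E t := by
      rw [lintegral_const_mul' _ _ hAtop]
      calc _ ≤ ENNReal.ofReal c * (A * (ENNReal.ofReal (2 * c)⁻¹ * E t)) := by
            gcongr
            exact lintegral_exp_le (by positivity) ht.1
        _ = ENNReal.ofReal c * ENNReal.ofReal (2 * c)⁻¹ * A * E t := by ring
        _ = _ := by rw [hcancel, mul_comm _ A]; rfl
    calc y t * E' t ≤ (y₀ + A / 2 * E t) * E' t := by gcongr; exact h1.trans (by gcongr)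
      _ = y₀ * E' t + A / 2 * (E t * E' t) := by ring
      _ ≤ y₀ * 1 + A / 2 * 1 := by rw [hEE]; gcongr; exact hE1 t ht
      _ = _ := by simp
  intro t ht
  calc y t ≤ A * E t := hyA t ht
    _ ≤ 2 * y₀ * E T := by
        gcongr
        refine ENNReal.ofReal_le_ofReal (Real.exp_le_exp.2 ?_)
        gcongr
        exact ht.2
    _ = _ := by rw [hE]; ring

/-- The main estimate: in the normal form the boundary terms are small, by the choice of the cutoff
`N`, and all the other terms are Lipschitz, so that the Gronwall inequality applies. The constant
depends on the curves only through the parameter `L` of `DiffBound`, and neither on their `ℓ²` bound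
`M` nor on the bound `S`, whose finiteness is all that is used. -/
theorem exists_lipschitz {s T : ℝ} (hs : 0 ≤ s) (hT : 0 ≤ T) {L : ℝ≥0∞} (hL : L ≠ ⊤) :
    ∃ K : ℝ≥0∞, K ≠ ⊤ ∧ ∀ (χ : ℤ → ℂ) (M S : ℝ≥0∞) (v w : ℝ → ℤ → ℂ), (∀ k, ‖χ k‖ₑ ≤ 1) →
      M ≠ ⊤ → S ≠ ⊤ → IsCurve χ T M v → IsCurve χ T M w →
      (∀ t ∈ Icc 0 T, DiffBound s L (v t) (w t)) →
      (∀ t ∈ Icc 0 T, l2 (fun k => wt s k * ‖v t k - w t k‖ₑ) ≤ S) →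
      ∀ t ∈ Icc 0 T, l2 (fun k => wt s k * ‖v t k - w t k‖ₑ) ≤
        K * l2 (fun k => wt s k * ‖v 0 k - w 0 k‖ₑ) := by
  have hζ := zetaTwo_ne_top
  let A (n : ℕ) : ℝ≥0∞ := ENNReal.ofReal ((n : ℝ) ^ s) * n ^ 2 * L ^ (n - 1)
  have hA (n : ℕ) : A n ≠ ⊤ := by finiteness
  -- the cutoff `N` makes the boundary terms small
  obtain ⟨N, hN, hN0⟩ : ∃ N : ℕ,
      (A 2 + A 3) * (2 * (1 + zetaTwo)) * (N : ℝ≥0∞)⁻¹ ≤ 2⁻¹ ∧ N ≠ 0 := by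
    have h1 : Tendsto (fun N : ℕ => (A 2 + A 3) * (2 * (1 + zetaTwo)) * (N : ℝ≥0∞)⁻¹) atTop
        (𝓝 ((A 2 + A 3) * (2 * (1 + zetaTwo)) * 0)) := by
      refine ENNReal.Tendsto.const_mul ENNReal.tendsto_inv_nat_nhds_zero (.inr ?_)
      have := hA 2; have := hA 3
      finiteness
    rw [mul_zero] at h1
    exact ((h1.eventually_le_const (by simp)).and (eventually_ne_atTop 0)).exists
  set Λ : ℝ≥0∞ := A 2 * (2 * N * (2 * N + 1)) + A 3 * ((1 + zetaTwo) * (4 * N + 3)) +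
    3 * (A 4 * (4 * (1 + zetaTwo) ^ 2)) with hΛ
  have hΛtop : Λ ≠ ⊤ := by
    have := hA 2; have := hA 3; have := hA 4
    finiteness
  set c : ℝ := (2 * Λ).toReal + 1
  have hc : 0 < c := by positivity
  have hΛc : 2 * Λ ≤ ENNReal.ofReal c := by
    rw [← ENNReal.ofReal_toReal (a := 2 * Λ) (by finiteness)]
    exact ENNReal.ofReal_le_ofReal (by simp [c])
  refine ⟨2 * ENNReal.ofReal (Real.exp (2 * c * T)) * 3, by finiteness, ?_⟩
  intro χ M S v w hχ hM hS hv hw hd hbd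
  set y : ℝ → ℝ≥0∞ := fun t => l2 (fun k => wt s k * ‖v t k - w t k‖ₑ) with hy
  have h0 : (0 : ℝ) ∈ Icc 0 T := ⟨le_rfl, hT⟩
  let D (t : ℝ) (a : ℤ → ℂ) (k : ℤ) : ℂ :=
    form (coefBdry χ N) θ2 e2 t a k + form (coefBdry3 χ N) θ3 e3 t a k
  let F (t : ℝ) (a : ℤ → ℂ) (k : ℤ) : ℂ :=
    form (coefLow χ N) θ2 e2 t a k + form (coefRes χ N) θ3 e3 t a k +
        ∑ r, form (coefQuart χ N r) (θ4 r) (e4 r) t a k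
  have hD (t : ℝ) (ht : t ∈ Icc 0 T) :
      l2 (fun k => wt s k * ‖D t (v t) k - D t (w t) k‖ₑ) ≤ 2⁻¹ * y t := by
    have i2 := (formBound_kerBdry N).form_diff (by finiteness) sum_e2 (enorm_coefBdry_le N hχ) θ2 t
      hs hL (hd t ht)
    have i3 := (formBound_kerBdry3 N).form_diff (by finiteness) sum_e3 (enorm_coefBdry3_le N hχ)
      θ3 t hs hL (hd t ht)
    calc _ ≤ l2 (fun k => wt s k * ‖form (coefBdry χ N) θ2 e2 t (v t) k -
            form (coefBdry χ N) θ2 e2 t (w t) k‖ₑ + wt s k *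
            ‖form (coefBdry3 χ N) θ3 e3 t (v t) k - form (coefBdry3 χ N) θ3 e3 t (w t) k‖ₑ) := by
          refine l2_mono fun k => ?_
          rw [← mul_add]
          gcongr
          refine le_trans (le_of_eq ?_) (enorm_add_le _ _)
          congr 1; simp only [D]; ring
      _ ≤ A 2 * (2 * (1 + zetaTwo) * (N : ℝ≥0∞)⁻¹) * y t +
          A 3 * (2 * (1 + zetaTwo) * (N : ℝ≥0∞)⁻¹) * y t :=
          (l2_add_le _ _).trans (add_le_add i2 i3)
      _ = (A 2 + A 3) * (2 * (1 + zetaTwo)) * (N : ℝ≥0∞)⁻¹ * y t := by ring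
      _ ≤ _ := by gcongr
  have hF (t : ℝ) (ht : t ∈ Icc 0 T) :
      l2 (fun k => wt s k * ‖F t (v t) k - F t (w t) k‖ₑ) ≤ Λ * y t := by
    have i2 := (formBound_kerLow N).form_diff (by finiteness) sum_e2 (enorm_coefLow_le N hχ) θ2 t
      hs hL (hd t ht)
    have i3 := (formBound_kerRes N).form_diff (by finiteness) sum_e3 (enorm_coefRes_le N hχ)
      θ3 t hs hL (hd t ht)
    have i4 (r : Fin 3) := (formBound_kerQuart r).form_diff (by finiteness) (sum_e4 r)
      (enorm_coefQuart_le N hχ r) (θ4 r) t hs hL (hd t ht)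
    calc _ ≤ l2 (fun k => wt s k * ‖form (coefLow χ N) θ2 e2 t (v t) k -
            form (coefLow χ N) θ2 e2 t (w t) k‖ₑ + wt s k *
            ‖form (coefRes χ N) θ3 e3 t (v t) k - form (coefRes χ N) θ3 e3 t (w t) k‖ₑ +
            ∑ r, wt s k * ‖form (coefQuart χ N r) (θ4 r) (e4 r) t (v t) k -
              form (coefQuart χ N r) (θ4 r) (e4 r) t (w t) k‖ₑ) := by
          refine l2_mono fun k => ?_
          rw [← Finset.mul_sum, ← mul_add, ← mul_add]
          gcongr
          refine le_trans (le_of_eq ?_) ((enorm_add_le _ _).trans (add_le_add (enorm_add_le _ _)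
            (enorm_sum_le _ _)))
          congr 1
          simp only [F, Finset.sum_sub_distrib]
          ring
      _ ≤ A 2 * (2 * N * (2 * N + 1)) * y t + A 3 * ((1 + zetaTwo) * (4 * N + 3)) * y t +
          ∑ r : Fin 3, A 4 * (4 * (1 + zetaTwo) ^ 2) * y t := by
          refine (l2_add_le _ _).trans (add_le_add ((l2_add_le _ _).trans (add_le_add i2 i3)) ?_)
          exact (l2_sum_le _ _).trans (Finset.sum_le_sum fun r _ => i4 r)
      _ = _ := by
          simp only [Finset.sum_const, Finset.card_univ, Fintype.card_fin, nsmul_eq_mul, hΛ]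
          push_cast
          ring
  have hprim (k : ℤ) : IsPrim T (fun t => (v t k - w t k) - (D t (v t) k - D t (w t) k))
      (fun t => F t (v t) k - F t (w t) k) :=
    ((hv.isPrim_normalForm hχ N hM hT k).sub (hw.isPrim_normalForm hχ N hM hT k)).congr hT
      (fun t _ => by simp only [D]; ring) (fun t _ => rfl)
  have main := gronwall (y₀ := 3 * y 0) hS hbd hc fun g hg hyg t ht => by
    have hsub : Ioc 0 t ⊆ Icc 0 T := fun x hx => ⟨hx.1.le, hx.2.trans ht.2⟩
    have hint : l2 (fun k => wt s k * ‖∫ τ in (0 : ℝ)..t, F τ (v τ) k - F τ (w τ) k‖ₑ) ≤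
        Λ * ∫⁻ τ in Ioc 0 t, g τ := by
      have meas (k : ℤ) : AEMeasurable (fun τ => wt s k * ‖F τ (v τ) k - F τ (w τ) k‖ₑ)
          (volume.restrict (Ioc 0 t)) :=
        ((hprim k).meas.mono_set hsub).enorm.const_mul _
      have hwt (k : ℤ) : wt s k ≠ ⊤ := ENNReal.ofReal_ne_top
      calc _ ≤ l2 (fun k => ∫⁻ τ in Ioc 0 t, wt s k * ‖F τ (v τ) k - F τ (w τ) k‖ₑ) := by
            refine l2_mono fun k => ?_
            rw [lintegral_const_mul' _ _ (hwt k), intervalIntegral.integral_of_le ht.1]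
            gcongr
            exact enorm_integral_le_lintegral_enorm _
        _ ≤ ∫⁻ τ in Ioc 0 t, l2 (fun k => wt s k * ‖F τ (v τ) k - F τ (w τ) k‖ₑ) := by
            refine l2_lintegral_le _ meas fun k => ?_
            rw [lintegral_const_mul' _ _ (hwt k)]
            exact ENNReal.mul_ne_top (hwt k)
              ((hprim k).integrableOn.mono_set hsub).hasFiniteIntegral.ne
        _ ≤ ∫⁻ τ in Ioc 0 t, Λ * g τ := by
            refine setLIntegral_mono (hg.const_mul _) fun τ hτ => ?_
            exact (hF τ (hsub hτ)).trans (by gcongr; exact hyg τ (hsub hτ))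
        _ = _ := lintegral_const_mul' _ _ hΛtop
    have hyt : y t ≤ (y 0 + 2⁻¹ * y 0 + Λ * ∫⁻ τ in Ioc 0 t, g τ) + y t / 2 := by
      calc y t ≤ l2 (fun k => wt s k * ‖v 0 k - w 0 k‖ₑ +
              wt s k * ‖D 0 (v 0) k - D 0 (w 0) k‖ₑ +
              wt s k * ‖∫ τ in (0 : ℝ)..t, F τ (v τ) k - F τ (w τ) k‖ₑ +
              wt s k * ‖D t (v t) k - D t (w t) k‖ₑ) := by
            refine l2_mono fun k => ?_
            rw [← mul_add, ← mul_add, ← mul_add]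
            gcongr
            have := (hprim k).eq t ht
            rw [sub_eq_iff_eq_add] at this
            rw [this]
            refine (enorm_add_le _ _).trans ?_
            gcongr
            refine (enorm_add_le _ _).trans ?_
            gcongr
            exact enorm_sub_le
        _ ≤ y 0 + 2⁻¹ * y 0 + (Λ * ∫⁻ τ in Ioc 0 t, g τ) + 2⁻¹ * y t := by
            refine (l2_add_le _ _).trans (add_le_add ((l2_add_le _ _).trans (add_le_add
              ((l2_add_le _ _).trans (add_le_add le_rfl (hD 0 h0))) hint)) (hD t ht))
        _ = _ := by rw [ENNReal.div_eq_inv_mul]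
    calc y t ≤ 2 * (y 0 + 2⁻¹ * y 0 + Λ * ∫⁻ τ in Ioc 0 t, g τ) :=
          le_two_mul_of_le_add_half (ne_top_of_le_ne_top hS (hbd t ht)) hyt
      _ = (2 + 2 * 2⁻¹) * y 0 + 2 * Λ * ∫⁻ τ in Ioc 0 t, g τ := by ring
      _ ≤ 3 * y 0 + ENNReal.ofReal c * ∫⁻ τ in Ioc 0 t, g τ := by
          rw [ENNReal.mul_inv_cancel (by simp) (by simp), show (2 + 1 : ℝ≥0∞) = 3 by norm_num]
          gcongr
  intro t ht
  rw [mul_assoc]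
  exact main t ht

/-! ### Sobolev norms and solutions -/

/-- The norm of `Ḣ^s` with values in `[0, ∞]`. -/
noncomputable def hnorm (s : ℝ) (a : ℤ → ℂ) : ℝ≥0∞ := l2 (fun k => wt s k * ‖a k‖ₑ)

lemma wt_zero (k : ℤ) : wt 0 k = 1 := by simp [wt]

lemma hnorm_zero_eq (a : ℤ → ℂ) : hnorm 0 a = l2 (fun k => ‖a k‖ₑ) := by simp [hnorm, wt_zero]

lemma wt_mul_enorm_sq (s : ℝ) (a : ℤ → ℂ) (k : ℤ) :
    (wt s k * ‖a k‖ₑ) ^ 2 = ENNReal.ofReal (|(k : ℝ)| ^ (2 * s) * ‖a k‖ ^ 2) := by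
  rw [wt, ← ofReal_norm, ← ENNReal.ofReal_mul (by positivity), ← ENNReal.ofReal_pow (by positivity),
    mul_pow, mul_comm 2 s, Real.rpow_mul (abs_nonneg _)]
  norm_num

lemma hnorm_sq (s : ℝ) (a : ℤ → ℂ) :
    hnorm s a ^ 2 = ∑' k : ℤ, ENNReal.ofReal (|(k : ℝ)| ^ (2 * s) * ‖a k‖ ^ 2) := by
  rw [hnorm, l2_sq]
  exact tsum_congr fun k => wt_mul_enorm_sq s a k

lemma summable_iff_hnorm {s : ℝ} {a : ℤ → ℂ} :
    (Summable fun k : ℤ => |(k : ℝ)| ^ (2 * s) * ‖a k‖ ^ 2) ↔ hnorm s a ≠ ⊤ := by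
  have hnn (k : ℤ) : 0 ≤ |(k : ℝ)| ^ (2 * s) * ‖a k‖ ^ 2 := by positivity
  have h1 : hnorm s a ≠ ⊤ ↔ hnorm s a ^ 2 ≠ ⊤ := by simp
  rw [h1, hnorm_sq]
  constructor
  · intro h
    rw [← ENNReal.ofReal_tsum_of_nonneg hnn h]
    exact ENNReal.ofReal_ne_top
  · intro h
    refine (ENNReal.summable_toReal h).congr fun k => ENNReal.toReal_ofReal (hnn k)

/-- The equality holds without any summability assumption: both sides are zero when `a` is not in
the space. -/
lemma normHdot_eq_toReal (s : ℝ) (a : ℤ → ℂ) : normHdot s a = (hnorm s a).toReal := by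
  have hnn (k : ℤ) : 0 ≤ |(k : ℝ)| ^ (2 * s) * ‖a k‖ ^ 2 := by positivity
  rw [normHdot, Real.sqrt_eq_iff_eq_sq (tsum_nonneg hnn) ENNReal.toReal_nonneg,
    ← ENNReal.toReal_pow, hnorm_sq, ENNReal.tsum_toReal_eq fun _ => ENNReal.ofReal_ne_top]
  exact tsum_congr fun k => (ENNReal.toReal_ofReal (hnn k)).symm

lemma MemHdot.hnorm_ne_top {s : ℝ} {a : ℤ → ℂ} (h : MemHdot s a) : hnorm s a ≠ ⊤ :=
  summable_iff_hnorm.1 h.summable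

lemma ofReal_normHdot {s : ℝ} {a : ℤ → ℂ} (h : hnorm s a ≠ ⊤) :
    ENNReal.ofReal (normHdot s a) = hnorm s a := by
  rw [normHdot_eq_toReal, ENNReal.ofReal_toReal h]

lemma hnorm_mono_exponent {s σ : ℝ} (h : σ ≤ s) {a : ℤ → ℂ} (h0 : a 0 = 0) :
    hnorm σ a ≤ hnorm s a := by
  refine l2_mono fun k => ?_
  rcases eq_or_ne k 0 with rfl | hk
  · simp [h0]
  · gcongr
    exact ENNReal.ofReal_le_ofReal (Real.rpow_le_rpow_of_exponent_le
      (by exact_mod_cast Int.one_le_abs hk) h)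

lemma l2_le_hnorm {s : ℝ} (hs : 0 ≤ s) {a : ℤ → ℂ} (h0 : a 0 = 0) :
    l2 (fun k => ‖a k‖ₑ) ≤ hnorm s a := by
  rw [← hnorm_zero_eq]
  exact hnorm_mono_exponent hs h0

lemma hnorm_add_le (s : ℝ) (a b : ℤ → ℂ) : hnorm s (a + b) ≤ hnorm s a + hnorm s b := by
  refine (l2_mono fun k => ?_).trans (l2_add_le _ _)
  rw [← mul_add]
  gcongr
  exact enorm_add_le _ _

lemma hnorm_neg (s : ℝ) (a : ℤ → ℂ) : hnorm s (-a) = hnorm s a := by simp [hnorm]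

lemma hnorm_sub_le (s : ℝ) (a b : ℤ → ℂ) : hnorm s (a - b) ≤ hnorm s a + hnorm s b := by
  rw [sub_eq_add_neg, ← hnorm_neg s b]
  exact hnorm_add_le s a (-b)

lemma IsCurve.mono {χ : ℤ → ℂ} {T : ℝ} {M M' : ℝ≥0∞} {u : ℝ → ℤ → ℂ} (h : IsCurve χ T M u)
    (hM : M ≤ M') : IsCurve χ T M' u :=
  ⟨h.zero_mode, fun t ht => (h.l2_le t ht).trans hM, h.prim⟩

lemma isCurve_zero (χ : ℤ → ℂ) (T : ℝ) (M : ℝ≥0∞) : IsCurve χ T M 0 :=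
  ⟨fun _ _ => rfl, fun _ _ => by simp [l2], fun k => by
    refine ⟨?_, ⟨0, fun t _ => ?_⟩, fun t _ => ?_⟩
    · simpa [B₁] using aestronglyMeasurable_const
    · simp [B₁]
    · simp [B₁]⟩

/-- A priori bound: the `Ḣ^s` norm is controlled with a constant that depends only on an `ℓ²`
bound. -/
lemma exists_apriori {s T : ℝ} (hs : 0 ≤ s) (hT : 0 ≤ T) {L : ℝ≥0∞} (hL : L ≠ ⊤) :
    ∃ K : ℝ≥0∞, K ≠ ⊤ ∧ ∀ (χ : ℤ → ℂ) (S : ℝ≥0∞) (u : ℝ → ℤ → ℂ), (∀ k, ‖χ k‖ₑ ≤ 1) →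
      S ≠ ⊤ → IsCurve χ T L u → (∀ t ∈ Icc 0 T, hnorm s (u t) ≤ S) →
      ∀ t ∈ Icc 0 T, hnorm s (u t) ≤ K * hnorm s (u 0) := by
  obtain ⟨K, hK, h⟩ := exists_lipschitz hs hT hL
  refine ⟨K, hK, fun χ S u hχ hS hu hb t ht => ?_⟩
  have := h χ L S u 0 hχ hL hS hu (isCurve_zero χ T L) (fun t ht => ⟨?_, ?_⟩) ?_ t ht
  · simpa [hnorm] using this
  · simpa using hu.l2_le t ht
  · simp only [Pi.zero_apply, sub_zero, enorm_zero, add_zero]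
    gcongr
    exact hu.l2_le t ht
  · intro t ht
    simpa [hnorm] using hb t ht

/-- Lipschitz dependence on the initial data in `Ḣ^s`, for curves bounded in `Ḣ^s`. -/
lemma exists_lipschitz_hnorm {s T : ℝ} (hs : 0 ≤ s) (hT : 0 ≤ T) {L : ℝ≥0∞} (hL : L ≠ ⊤) :
    ∃ K : ℝ≥0∞, K ≠ ⊤ ∧ ∀ (χ : ℤ → ℂ) (M : ℝ≥0∞) (v w : ℝ → ℤ → ℂ), (∀ k, ‖χ k‖ₑ ≤ 1) → M ≠ ⊤ →
      IsCurve χ T M v → IsCurve χ T M w →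
      (∀ t ∈ Icc 0 T, hnorm s (v t) + hnorm s (w t) ≤ L) →
      ∀ t ∈ Icc 0 T, hnorm s (v t - w t) ≤ K * hnorm s (v 0 - w 0) := by
  obtain ⟨K, hK, h⟩ := exists_lipschitz hs hT hL
  refine ⟨K, hK, fun χ M v w hχ hM hv hw hb t ht => ?_⟩
  refine h χ M L v w hχ hM hL hv hw (fun t ht => ⟨?_, ?_⟩) (fun t ht => ?_) t ht
  · refine (l2_add_le _ _).trans (le_trans ?_ (hb t ht))
    exact add_le_add (l2_le_hnorm hs (hv.zero_mode t ht)) (l2_le_hnorm hs (hw.zero_mode t ht))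
  · rw [mul_comm L]
    have hz : (v t - w t) 0 = 0 := by simp [hv.zero_mode t ht, hw.zero_mode t ht]
    gcongr
    · exact l2_le_hnorm hs hz
    · simp_rw [mul_add]
      exact (l2_add_le _ _).trans (hb t ht)
  · exact (hnorm_sub_le s _ _).trans (hb t ht)

lemma le_of_ae_le_of_continuousOn {T : ℝ} (hT : 0 < T) {f : ℝ → ℝ} {c : ℝ}
    (hf : ContinuousOn f (Icc 0 T)) (h : ∀ᵐ t ∂(volume.restrict (Icc 0 T)), f t ≤ c) :
    ∀ t ∈ Icc 0 T, f t ≤ c := by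
  have := Measure.eqOn_Icc_of_ae_eq (μ := volume) hT.ne (f := f) (g := fun t => min (f t) c)
    (by filter_upwards [h] with t ht using (min_eq_left ht).symm) hf
    (hf.inf continuousOn_const)
  intro t ht
  rw [this ht]
  exact min_le_right _ _

lemma ofReal_sum_norm_sq (s : Finset ℤ) (a : ℤ → ℂ) :
    ∑ k ∈ s, ‖a k‖ₑ ^ 2 = ENNReal.ofReal (∑ k ∈ s, ‖a k‖ ^ 2) := by
  rw [ENNReal.ofReal_sum_of_nonneg fun _ _ => by positivity]
  exact Finset.sum_congr rfl fun k _ => by rw [ENNReal.ofReal_pow (norm_nonneg _), ofReal_norm]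

/-- An `ℓ²` bound that holds for almost every time holds for all times. -/
lemma l2_le_of_ae {T : ℝ} (hT : 0 < T) {u : ℝ → ℤ → ℂ} {M : ℝ≥0∞} (hM : M ≠ ⊤)
    (hc : ∀ k, ContinuousOn (fun t => u t k) (Icc 0 T))
    (h : ∀ᵐ t ∂(volume.restrict (Icc 0 T)), l2 (fun k => ‖u t k‖ₑ) ≤ M) :
    ∀ t ∈ Icc 0 T, l2 (fun k => ‖u t k‖ₑ) ≤ M := by
  intro t ht
  rw [l2_le_iff, ENNReal.tsum_eq_iSup_sum]
  refine iSup_le fun s => ?_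
  have hM2 : M ^ 2 ≠ ⊤ := by finiteness
  rw [ofReal_sum_norm_sq, ENNReal.ofReal_le_iff_le_toReal hM2]
  refine le_of_ae_le_of_continuousOn hT (f := fun t => ∑ k ∈ s, ‖u t k‖ ^ 2)
    (continuousOn_finsetSum s fun k _ => ((hc k).norm.pow 2)) ?_ t ht
  filter_upwards [h] with t ht
  rw [← ENNReal.ofReal_le_iff_le_toReal hM2, ← ofReal_sum_norm_sq]
  exact (ENNReal.sum_le_tsum s).trans (l2_le_iff.1 ht)

lemma aestronglyMeasurable_B₁ {T : ℝ} {u : ℝ → ℤ → ℂ} {M : ℝ≥0∞} (hM : M ≠ ⊤)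
    (hm : ∀ k, AEStronglyMeasurable (fun t => u t k) (volume.restrict (Icc 0 T)))
    (h : ∀ᵐ t ∂(volume.restrict (Icc 0 T)), l2 (fun k => ‖u t k‖ₑ) ≤ M) (k : ℤ) :
    AEStronglyMeasurable (fun t => B₁ t (u t) (u t) k) (volume.restrict (Icc 0 T)) := by
  refine aestronglyMeasurable_of_tendsto_ae (u := (atTop : Filter (Finset ℤ)))
    (f := fun s t => ∑ i ∈ s, 1 * (Complex.I * k / 2) * (ph (θ2 k i) t * (u t i * u t (k - i))))
    (fun s => Finset.aestronglyMeasurable_fun_sum s fun i _ => ?_) ?_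
  · have : Continuous (ph (θ2 k i)) := by unfold ph; fun_prop
    exact (this.aestronglyMeasurable.mul ((hm i).mul (hm (k - i)))).const_mul _
  · filter_upwards [h] with t ht
    rw [← one_mul (B₁ t (u t) (u t) k), B₁_eq]
    refine (Summable.of_enorm ?_).hasSum
    exact ne_top_of_le_ne_top (by finiteness) (tsum_enorm_B₁_le (χ := fun _ => 1) (by simp) ht t k)

lemma IsSolution.isCurve {T : ℝ} (hT : 0 < T) {v₀ : ℤ → ℂ} {v : ℝ → ℤ → ℂ}
    (h : IsSolution T v₀ v) : ∃ M : ℝ≥0∞, M ≠ ⊤ ∧ IsCurve (fun _ => 1) T M v := by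
  obtain ⟨M, hM⟩ := h.memLinfty.bounded
  have hae : ∀ᵐ t ∂(volume.restrict (Icc 0 T)), l2 (fun k => ‖v t k‖ₑ) ≤ ENNReal.ofReal M := by
    filter_upwards [hM] with t ht
    rw [← hnorm_zero_eq, ← ofReal_normHdot ht.1.hnorm_ne_top]
    exact ENNReal.ofReal_le_ofReal ht.2
  have meas (k : ℤ) := aestronglyMeasurable_B₁ ENNReal.ofReal_ne_top
    (fun k => (h.memLinfty.aemeasurable k).aestronglyMeasurable) hae k
  have hint (k : ℤ) : IntegrableOn (fun t => B₁ t (v t) (v t) k) (Icc 0 T) := by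
    have : IsFiniteMeasure (volume.restrict (Icc 0 T)) := ⟨by simp⟩
    refine ⟨meas k, .of_bounded (C := (‖(k : ℂ)‖ₑ * ENNReal.ofReal M ^ 2).toReal) ?_⟩
    filter_upwards [hae] with t ht
    have := enorm_B₁_le (χ := fun _ => 1) (by simp) ht t k
    rw [one_mul] at this
    rw [← toReal_enorm]
    exact ENNReal.toReal_mono (by finiteness) this
  have heq (t : ℝ) (ht : t ∈ Icc 0 T) (k : ℤ) :
      v t k = v 0 k + ∫ τ in (0 : ℝ)..t, B₁ τ (v τ) (v τ) k := by
    rcases eq_or_ne k 0 with rfl | hk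
    · simp [B₁, h.zero_mode t ht, h.zero_mode 0 ⟨le_rfl, hT.le⟩]
    · rw [← h.integrated t ht k hk]; ring
  have hcont (k : ℤ) : ContinuousOn (fun t => v t k) (Icc 0 T) := by
    refine ContinuousOn.congr (f := fun t => v 0 k + ∫ τ in (0 : ℝ)..t, B₁ τ (v τ) (v τ) k) ?_
      fun t ht => heq t ht k
    refine continuousOn_const.add ?_
    have := intervalIntegral.continuousOn_primitive_interval (μ := volume) (a := 0) (b := T)
      (f := fun τ => B₁ τ (v τ) (v τ) k) (by rw [uIcc_of_le hT.le]; exact hint k)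
    rwa [uIcc_of_le hT.le] at this
  have hl2 := l2_le_of_ae hT ENNReal.ofReal_ne_top hcont hae
  refine ⟨ENNReal.ofReal M, ENNReal.ofReal_ne_top, h.zero_mode, hl2, fun k => ?_⟩
  simp_rw [one_mul]
  refine ⟨meas k, ⟨(‖(k : ℂ)‖ₑ * ENNReal.ofReal M ^ 2).toReal, fun t ht => ?_⟩,
    fun t ht => heq t ht k⟩
  have := enorm_B₁_le (χ := fun _ => 1) (by simp) (hl2 t ht) t k
  rw [one_mul] at this
  rw [← toReal_enorm]
  exact ENNReal.toReal_mono (by finiteness) this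

/-- Solutions that are merely bounded in `ℓ²` are unique. -/
lemma IsSolution.unique {T : ℝ} (hT : 0 < T) {v₀ : ℤ → ℂ} {v w : ℝ → ℤ → ℂ}
    (hv : IsSolution T v₀ v) (hw : IsSolution T v₀ w) : ∀ t ∈ Icc 0 T, w t = v t := by
  obtain ⟨M₁, hM₁, hv'⟩ := hv.isCurve hT
  obtain ⟨M₂, hM₂, hw'⟩ := hw.isCurve hT
  obtain ⟨K, -, h⟩ := exists_lipschitz_hnorm (s := 0) le_rfl hT.le (L := M₂ + M₁) (by finiteness)
  intro t ht
  have h1 := h _ (M₂ + M₁) w v (by simp) (by finiteness) (hw'.mono le_self_add)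
    (hv'.mono le_add_self) (fun t ht => by
      rw [hnorm_zero_eq, hnorm_zero_eq]
      exact add_le_add (hw'.l2_le t ht) (hv'.l2_le t ht)) t ht
  rw [hv.initial, hw.initial, sub_self] at h1
  have h0 : hnorm 0 (0 : ℤ → ℂ) = 0 := by simp [hnorm, l2]
  rw [h0, mul_zero, hnorm_zero_eq] at h1
  funext k
  have h2 := (le_l2 (fun k => ‖(w t - v t) k‖ₑ) k).trans h1
  simpa [sub_eq_zero] using h2

/-! ### The Galerkin system -/

/-- The right-hand side of the equation preserves the reality condition. -/
lemma B₁_neg {a : ℤ → ℂ} (ha : ∀ k, a (-k) = (starRingEnd ℂ) (a k)) (t : ℝ) (k : ℤ) :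
    B₁ t a a (-k) = (starRingEnd ℂ) (B₁ t a a k) := by
  rw [B₁, B₁, map_mul, ← (Equiv.neg ℤ).tsum_eq, Complex.conj_tsum]
  congr 1
  · simp [map_ofNat (starRingEnd ℂ) 2]
  · refine tsum_congr fun i => ?_
    rw [map_mul, map_mul, ← ha, ← ha, ← Complex.exp_conj]
    simp only [Equiv.neg_apply, map_mul, Complex.conj_I, Complex.conj_ofReal, map_ofNat,
      map_intCast]
    rw [show -k - -i = -(k - i) by ring]
    congr 3
    push_cast
    ring

/-- Conservation of the `L²` norm, in infinitesimal form: `∑ₖ a₋ₖ B₁(a, a)ₖ` is a sum over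
`k₁ + k₂ + k₃ = 0` of `k₃` times a function symmetric in the three frequencies. -/
lemma tsum_mul_B₁_eq_zero {a : ℤ → ℂ} {m : ℕ} (ha : ∀ k, (m : ℤ) < |k| → a k = 0) (t : ℝ) :
    ∑' k, a (-k) * B₁ t a a k = 0 := by
  let X (p q r : ℤ) : ℂ := ph (-3 * p * q * r) t * (a p * a q * a r)
  have hX1 (p q r : ℤ) : X p q r = X q p r := by
    simp only [X, show -3 * q * p * r = -3 * p * q * r by ring]; ring
  have hX2 (p q r : ℤ) : X p q r = X r q p := by
    simp only [X, show -3 * r * q * p = -3 * p * q * r by ring]; ring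
  have hsupp (g : ℤ × ℤ → ℂ) : Summable fun x : ℤ × ℤ => g x * X x.1 x.2 (-x.1 - x.2) := by
    refine summable_of_ne_finset_zero
      (s := Finset.Icc (-(m : ℤ)) m ×ˢ Finset.Icc (-(m : ℤ)) m) fun x hx => ?_
    rw [Finset.mem_product, Finset.mem_Icc, Finset.mem_Icc, ← abs_le, ← abs_le, not_and_or, not_le,
      not_le] at hx
    rcases hx with h | h <;> simp [X, ha _ h]
  let W1 := ∑' x : ℤ × ℤ, (x.1 : ℂ) * X x.1 x.2 (-x.1 - x.2)
  let W2 := ∑' x : ℤ × ℤ, (x.2 : ℂ) * X x.1 x.2 (-x.1 - x.2)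
  let W3 := ∑' x : ℤ × ℤ, ((-x.1 - x.2 : ℤ) : ℂ) * X x.1 x.2 (-x.1 - x.2)
  have h12 : W1 = W2 := by
    refine ((Equiv.prodComm ℤ ℤ).tsum_eq _).symm.trans (tsum_congr fun x => ?_)
    simp only [Equiv.prodComm_apply, Prod.fst_swap, Prod.snd_swap]
    rw [hX1, show -x.2 - x.1 = -x.1 - x.2 by ring]
  let σ : ℤ × ℤ ≃ ℤ × ℤ :=
    { toFun := fun x => (-x.1 - x.2, x.2)
      invFun := fun x => (-x.1 - x.2, x.2)
      left_inv := fun x => by ext <;> simp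
      right_inv := fun x => by ext <;> simp }
  have h13 : W1 = W3 := by
    refine (σ.tsum_eq _).symm.trans (tsum_congr fun x => ?_)
    simp only [σ, Equiv.coe_fn_mk]
    rw [hX2, show -(-x.1 - x.2) - x.2 = x.1 by ring]
  have h0 : W1 + W2 + W3 = 0 := by
    simp only [W1, W2, W3]
    rw [← (hsupp _).tsum_add (hsupp _), ← ((hsupp _).add (hsupp _)).tsum_add (hsupp _)]
    refine (tsum_congr fun x => ?_).trans tsum_zero
    push_cast; ring
  have hW3 : W3 = 0 := by
    rw [← h12, ← h13] at h0
    have : (3 : ℂ) * W1 = 0 := by linear_combination h0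
    rw [← h13]
    simpa using this
  let τ : ℤ × ℤ ≃ ℤ × ℤ :=
    { toFun := fun x => (x.2, x.1 - x.2)
      invFun := fun x => (x.1 + x.2, x.1)
      left_inv := fun x => by ext <;> simp
      right_inv := fun x => by ext <;> simp }
  have hY : ∑' x : ℤ × ℤ, -(Complex.I / 2) * (((-(τ x).1 - (τ x).2 : ℤ) : ℂ) *
      X (τ x).1 (τ x).2 (-(τ x).1 - (τ x).2)) = 0 := by
    rw [tsum_mul_left, τ.tsum_eq fun x : ℤ × ℤ => ((-x.1 - x.2 : ℤ) : ℂ) * X x.1 x.2 (-x.1 - x.2)]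
    change _ * W3 = 0
    rw [hW3, mul_zero]
  have hsum : Summable fun x : ℤ × ℤ => -(Complex.I / 2) * (((-(τ x).1 - (τ x).2 : ℤ) : ℂ) *
      X (τ x).1 (τ x).2 (-(τ x).1 - (τ x).2)) :=
    ((τ.summable_iff (f := fun x : ℤ × ℤ => ((-x.1 - x.2 : ℤ) : ℂ) *
      X x.1 x.2 (-x.1 - x.2))).2 (hsupp _)).mul_left _
  rw [hsum.tsum_prod] at hY
  refine Eq.trans (tsum_congr fun k => ?_) hY
  rw [← one_mul (B₁ t a a k), B₁_eq, ← tsum_mul_left]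
  refine tsum_congr fun i => ?_
  have : -i - (k - i) = -k := by ring
  simp only [τ, Equiv.coe_fn_mk, X, this, θ2,
    show -3 * i * (k - i) * -k = 3 * k * i * (k - i) by ring]
  push_cast
  ring

section field
variable (m : ℕ)

/-- The phase space of the Galerkin system: the Fourier modes `|k| ≤ m`. -/
abbrev Modes : Type := ↥(Finset.Icc (-(m : ℤ)) m) → ℂ

variable {m}

/-- Extension by zero to all frequencies. -/
noncomputable def Modes.ext (x : Modes m) (k : ℤ) : ℂ :=
  if h : k ∈ Finset.Icc (-(m : ℤ)) m then x ⟨k, h⟩ else 0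

/-- The Fourier coefficients of the real part. -/
noncomputable def Modes.sym (x : Modes m) (k : ℤ) : ℂ :=
  (x.ext k + (starRingEnd ℂ) (x.ext (-k))) / 2

lemma Modes.ext_eq_zero (x : Modes m) {k : ℤ} (h : (m : ℤ) < |k|) : x.ext k = 0 := by
  rw [Modes.ext, dif_neg]
  rw [Finset.mem_Icc, ← abs_le, not_le]
  exact h

lemma Modes.sym_eq_zero (x : Modes m) {k : ℤ} (h : (m : ℤ) < |k|) : x.sym k = 0 := by
  rw [Modes.sym, x.ext_eq_zero h, x.ext_eq_zero (by rwa [abs_neg])]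
  simp

lemma Modes.sym_neg (x : Modes m) (k : ℤ) : x.sym (-k) = (starRingEnd ℂ) (x.sym k) := by
  simp [Modes.sym, add_comm, map_ofNat (starRingEnd ℂ) 2]

lemma Modes.contDiff_ext (k : ℤ) : ContDiff ℝ 1 fun x : Modes m => x.ext k := by
  unfold Modes.ext
  split_ifs
  · exact contDiff_apply ℝ ℂ _
  · exact contDiff_const

lemma Modes.contDiff_sym (k : ℤ) : ContDiff ℝ 1 fun x : Modes m => x.sym k := by
  unfold Modes.sym
  exact ((Modes.contDiff_ext k).add
    (Complex.conjCLE.contDiff.comp (Modes.contDiff_ext (-k)))).div_const _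

lemma B₁_eq_sum {a : ℤ → ℂ} (ha : ∀ k, (m : ℤ) < |k| → a k = 0) (t : ℝ) (k : ℤ) :
    B₁ t a a k = ∑ i ∈ Finset.Icc (-(m : ℤ)) m,
      (Complex.I * k / 2) * (ph (θ2 k i) t * (a i * a (k - i))) := by
  rw [← one_mul (B₁ t a a k), B₁_eq, tsum_eq_sum (s := Finset.Icc (-(m : ℤ)) m)]
  · simp
  · intro i hi
    rw [Finset.mem_Icc, ← abs_le, not_le] at hi
    simp [ha i hi]

lemma contDiff_galerkinField (k : ℤ) :
    ContDiff ℝ 1 fun p : ℝ × Modes m => B₁ p.1 p.2.sym p.2.sym k := by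
  simp_rw [fun p : ℝ × Modes m => B₁_eq_sum (fun k hk => p.2.sym_eq_zero hk) p.1 k]
  refine ContDiff.sum fun i _ => contDiff_const.mul (ContDiff.mul ?_ (ContDiff.mul ?_ ?_))
  · unfold ph
    exact (contDiff_const.mul (Complex.ofRealCLM.contDiff.comp contDiff_fst)).cexp
  · exact (Modes.contDiff_sym i).comp contDiff_snd
  · exact (Modes.contDiff_sym (k - i)).comp contDiff_snd

/-- Global existence for a `C¹` vector field that is cut off outside a ball: it is bounded, so that
the Picard–Lindelöf theorem applies directly on the whole time interval. -/
lemma exists_solution_cutoff {E : Type*} [NormedAddCommGroup E] [NormedSpace ℝ E]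
    [FiniteDimensional ℝ E] (F : ℝ × E → E) (hF : ContDiff ℝ 1 F) {T : ℝ} (hT : 0 ≤ T)
    (η : ContDiffBump (0 : E)) (x₀ : E) :
    ∃ α : ℝ → E, α 0 = x₀ ∧ ∀ t ∈ Icc 0 T,
      HasDerivWithinAt α (η (α t) • F (t, α t)) (Icc 0 T) t := by
  have hG : ContDiff ℝ 1 fun p : ℝ × E => η p.2 • F p := (η.contDiff.comp contDiff_snd).smul hF
  obtain ⟨C, hC⟩ := (isCompact_Icc (a := (0 : ℝ)) (b := T)).prod
    (isCompact_closedBall (0 : E) η.rOut) |>.exists_bound_of_continuousOn hG.continuous.continuousOn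
  have hbound (t : ℝ) (ht : t ∈ Icc 0 T) (x : E) : ‖η x • F (t, x)‖ ≤ C.toNNReal := by
    by_cases hx : x ∈ Metric.closedBall (0 : E) η.rOut
    · exact (hC (t, x) ⟨ht, hx⟩).trans (Real.le_coe_toNNReal C)
    · rw [η.zero_of_le_dist (not_le.1 hx).le]
      simp
  set a : ℝ≥0 := C.toNNReal * T.toNNReal with ha
  obtain ⟨K, hK⟩ := (hG.contDiffOn (s := Icc 0 T ×ˢ Metric.closedBall x₀ a)).exists_lipschitzOnWith
    one_ne_zero ((convex_Icc 0 T).prod (convex_closedBall x₀ _))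
    (isCompact_Icc.prod (isCompact_closedBall x₀ _))
  have h0 : (0 : ℝ) ∈ Icc 0 T := ⟨le_rfl, hT⟩
  have hPL : IsPicardLindelof (fun t x => η x • F (t, x)) (⟨0, h0⟩ : Icc (0 : ℝ) T) x₀ a 0
      C.toNNReal K := by
    refine ⟨fun t ht => ?_, fun x _ => ?_, fun t ht x _ => hbound t ht x, ?_⟩
    · intro x hx y hy
      have := hK (x := (t, x)) ⟨ht, hx⟩ (y := (t, y)) ⟨ht, hy⟩
      simpa [Prod.edist_eq] using this
    · exact (hG.continuous.comp (by fun_prop : Continuous fun t : ℝ => (t, x))).continuousOn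
    · simp [ha, hT]
  exact hPL.exists_eq_forall_mem_Icc_hasDerivWithinAt₀

lemma eq_of_hasDerivWithinAt_zero {T : ℝ} {f : ℝ → ℂ}
    (h : ∀ t ∈ Icc 0 T, HasDerivWithinAt f 0 (Icc 0 T) t) : ∀ t ∈ Icc 0 T, f t = f 0 := by
  intro t ht
  have := (IsPrim.of_hasDerivWithinAt (f := fun _ => 0) h continuousOn_const).eq t ht
  simpa using this

lemma Modes.hasDerivWithinAt_ext {α : ℝ → Modes m} {α' : Modes m} {S : Set ℝ} {t : ℝ}
    (h : HasDerivWithinAt α α' S t) (k : ℤ) :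
    HasDerivWithinAt (fun t => (α t).ext k) (α'.ext k) S t := by
  unfold Modes.ext
  split_ifs
  · exact hasDerivWithinAt_pi.1 h _
  · exact hasDerivWithinAt_const ..

lemma neg_mem_modes {k : ℤ} (h : k ∈ Finset.Icc (-(m : ℤ)) m) : -k ∈ Finset.Icc (-(m : ℤ)) m := by
  rw [Finset.mem_Icc] at h ⊢
  omega

/-- The Galerkin system has a global solution; it is real-valued and conserves the `L²` norm. -/
lemma exists_galerkin (m : ℕ) {T : ℝ} (hT : 0 ≤ T) {v₀ : ℤ → ℂ} (h0 : v₀ 0 = 0)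
    (hr : ∀ k, v₀ (-k) = (starRingEnd ℂ) (v₀ k)) :
    ∃ V : ℝ → ℤ → ℂ, IsGalerkinSolution m T v₀ V ∧
      (∀ t ∈ Icc 0 T, ∀ k, V t (-k) = (starRingEnd ℂ) (V t k)) ∧
      (∀ t ∈ Icc 0 T, l2 (fun k => ‖trunc m (V t) k‖ₑ) = l2 (fun k => ‖trunc m v₀ k‖ₑ)) ∧
      ∀ t k, (m : ℤ) < |k| → V t k = v₀ k := by
  set I := Finset.Icc (-(m : ℤ)) m with hI
  have hmem (k : ℤ) : k ∈ I ↔ |k| ≤ (m : ℤ) := by rw [hI, Finset.mem_Icc, abs_le]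
  let F (p : ℝ × Modes m) : Modes m := fun k => B₁ p.1 p.2.sym p.2.sym k
  have hF : ContDiff ℝ 1 F := contDiff_pi.2 fun k => contDiff_galerkinField k
  set E₀ : ℝ := ∑ k ∈ I, ‖v₀ k‖ ^ 2 with hE₀
  have hE₀' : 0 ≤ E₀ := Finset.sum_nonneg fun _ _ => by positivity
  let η : ContDiffBump (0 : Modes m) := ⟨1 + E₀, 2 + E₀, by linarith, by linarith⟩
  obtain ⟨α, hα0, hα⟩ := exists_solution_cutoff F hF hT η (fun k => v₀ k)
  set e : ℝ → ℤ → ℂ := fun t => (α t).ext with he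
  have e_zero (t : ℝ) (k : ℤ) (hk : (m : ℤ) < |k|) : e t k = 0 := (α t).ext_eq_zero hk
  have e_init (k : ℤ) (hk : k ∈ I) : e 0 k = v₀ k := by
    simp only [he, hα0, Modes.ext]
    rw [dif_pos hk]
  have e_deriv (t : ℝ) (ht : t ∈ Icc 0 T) (k : ℤ) (hk : k ∈ I) : HasDerivWithinAt (fun t => e t k)
      (η (α t) * B₁ t (α t).sym (α t).sym k) (Icc 0 T) t := by
    refine (Modes.hasDerivWithinAt_ext (hα t ht) k).congr_deriv ?_
    rw [Modes.ext, dif_pos hk]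
    simp [F]
  have e_real (t : ℝ) (ht : t ∈ Icc 0 T) (k : ℤ) : e t (-k) = (starRingEnd ℂ) (e t k) := by
    by_cases hk : k ∈ I
    · have hd : ∀ t ∈ Icc 0 T, HasDerivWithinAt (fun t => e t (-k) - (starRingEnd ℂ) (e t k)) 0
          (Icc 0 T) t := fun t ht => by
        refine ((e_deriv t ht (-k) (neg_mem_modes hk)).fun_sub
          (Complex.conjCLE.toContinuousLinearMap.hasFDerivAt.comp_hasDerivWithinAt t
            (e_deriv t ht k hk))).congr_deriv ?_
        rw [B₁_neg (α t).sym_neg]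
        simp
      have := eq_of_hasDerivWithinAt_zero hd t ht
      rw [e_init _ (neg_mem_modes hk), e_init _ hk, hr, sub_self] at this
      exact sub_eq_zero.1 this
    · rw [hmem, not_le] at hk
      rw [e_zero t k hk, e_zero t (-k) (by rwa [abs_neg]), map_zero]
  have e_sym (t : ℝ) (ht : t ∈ Icc 0 T) : (α t).sym = e t := by
    funext k
    have := e_real t ht (-k)
    rw [neg_neg] at this
    rw [Modes.sym]
    change (e t k + (starRingEnd ℂ) (e t (-k))) / 2 = _
    rw [← this]
    ring
  have e_sq (t : ℝ) (ht : t ∈ Icc 0 T) :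
      ∑ k ∈ I, e t k * e t (-k) = ((∑ k ∈ I, ‖e t k‖ ^ 2 : ℝ) : ℂ) := by
    push_cast
    refine Finset.sum_congr rfl fun k _ => ?_
    rw [e_real t ht, Complex.mul_conj']
  have energy (t : ℝ) (ht : t ∈ Icc 0 T) : ∑ k ∈ I, ‖e t k‖ ^ 2 = E₀ := by
    have hd : ∀ t ∈ Icc 0 T, HasDerivWithinAt (fun t => ∑ k ∈ I, e t k * e t (-k)) 0
        (Icc 0 T) t := fun t ht => by
      have h1 := HasDerivWithinAt.fun_sum fun k (hk : k ∈ I) =>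
        (e_deriv t ht k hk).fun_mul (e_deriv t ht (-k) (neg_mem_modes hk))
      refine h1.congr_deriv ?_
      have h2 : ∑ k ∈ I, e t (-k) * B₁ t (e t) (e t) k = 0 := by
        rw [← tsum_mul_B₁_eq_zero (e_zero t) t, tsum_eq_sum (s := I)]
        intro k hk
        rw [hmem, not_le] at hk
        rw [e_zero t (-k) (by rwa [abs_neg]), zero_mul]
      have h3 : ∑ k ∈ I, e t k * B₁ t (e t) (e t) (-k) = 0 := by
        rw [← h2]
        refine Finset.sum_nbij' (fun k => -k) (fun k => -k) (fun k hk => neg_mem_modes hk)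
          (fun k hk => neg_mem_modes hk) (by simp) (by simp) (by simp)
      rw [e_sym t ht, Finset.sum_add_distrib]
      calc _ = η (α t) * ∑ k ∈ I, e t (-k) * B₁ t (e t) (e t) k +
            η (α t) * ∑ k ∈ I, e t k * B₁ t (e t) (e t) (-k) := by
            rw [Finset.mul_sum, Finset.mul_sum]
            congr 1 <;> exact Finset.sum_congr rfl fun k _ => by ring
        _ = 0 := by rw [h2, h3]; simp
    have := eq_of_hasDerivWithinAt_zero hd t ht
    rw [e_sq t ht, e_sq 0 ⟨le_rfl, hT⟩] at this
    rw [Complex.ofReal_inj.1 this]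
    exact Finset.sum_congr rfl fun k hk => by rw [e_init k hk]
  have hη (t : ℝ) (ht : t ∈ Icc 0 T) : η (α t) = 1 := by
    refine η.one_of_mem_closedBall ?_
    rw [mem_closedBall_zero_iff, pi_norm_le_iff_of_nonneg η.rIn_pos.le]
    intro k
    have h1 : ‖e t k‖ ^ 2 ≤ E₀ := by
      rw [← energy t ht]
      exact Finset.single_le_sum (f := fun k => ‖e t k‖ ^ 2) (fun _ _ => by positivity) k.2
    have h2 : e t k = α t k := by simp only [he, Modes.ext]; rw [dif_pos k.2]
    rw [h2] at h1
    change ‖α t k‖ ≤ 1 + E₀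
    nlinarith [norm_nonneg (α t k)]
  let V (t : ℝ) (k : ℤ) : ℂ := if |k| ≤ (m : ℤ) then e t k else v₀ k
  have V_trunc (t : ℝ) : trunc m (V t) = e t := by
    funext k
    unfold trunc
    split_ifs with hk
    · simp [V, hk]
    · exact (e_zero t k (not_le.1 hk)).symm
  have e_zero_mode (t : ℝ) (ht : t ∈ Icc 0 T) : e t 0 = 0 := by
    have h0I : (0 : ℤ) ∈ I := by simp [hmem]
    rw [eq_of_hasDerivWithinAt_zero (fun t ht => (e_deriv t ht 0 h0I).congr_deriv (by simp [B₁]))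
      t ht, e_init 0 h0I, h0]
  refine ⟨V, ⟨fun t ht => ?_, ?_, fun t ht k _ => ?_⟩, fun t ht k => ?_, fun t ht => ?_,
    fun t k hk => if_neg (not_le.2 hk)⟩
  · simp [V, e_zero_mode t ht]
  · funext k
    simp only [V]
    split_ifs with hk
    · exact e_init k ((hmem k).2 hk)
    · rfl
  · rw [V_trunc, trunc]
    split_ifs with hk
    · simp only [V, hk, if_true]
      refine (e_deriv t ht k ((hmem k).2 hk)).congr_deriv ?_
      rw [hη t ht, e_sym t ht]
      simp
    · simp only [V, hk, if_false]
      exact hasDerivWithinAt_const ..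
  · simp only [V, abs_neg]
    split_ifs
    · exact e_real t ht k
    · exact hr k
  · rw [V_trunc]
    have h1 (a : ℤ → ℂ) (ha : ∀ k, (m : ℤ) < |k| → a k = 0) :
        ∑' k, ‖a k‖ₑ ^ 2 = ENNReal.ofReal (∑ k ∈ I, ‖a k‖ ^ 2) := by
      rw [← ofReal_sum_norm_sq, tsum_eq_sum (s := I)]
      intro k hk
      rw [hmem, not_le] at hk
      simp [ha k hk]
    unfold l2
    rw [h1 _ (e_zero t), h1 (trunc m v₀) fun k hk => if_neg (not_le.2 hk), energy t ht]
    congr 3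
    exact Finset.sum_congr rfl fun k hk => by rw [trunc, if_pos ((hmem k).1 hk)]

end field

/-! ### Convergence of Fourier coefficients -/

lemma hnorm_le_of_tendsto {ι : Type*} {l : Filter ι} [l.NeBot] {s : ℝ} {a : ι → ℤ → ℂ} {b : ℤ → ℂ}
    {S : ℝ≥0∞} (ha : ∀ j, hnorm s (a j) ≤ S) (hc : ∀ k, Tendsto (fun j => a j k) l (𝓝 (b k))) :
    hnorm s b ≤ S := by
  rw [hnorm, l2_le_iff, ENNReal.tsum_eq_iSup_sum]
  refine iSup_le fun F => ?_
  refine le_of_tendsto' (f := fun j => ∑ k ∈ F, (wt s k * ‖a j k‖ₑ) ^ 2) (x := l) ?_ fun j =>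
    (ENNReal.sum_le_tsum F).trans (l2_le_iff.1 (ha j))
  refine tendsto_finsetSum _ fun k _ => ENNReal.Tendsto.pow ?_
  exact ENNReal.Tendsto.const_mul (hc k).enorm (.inr ENNReal.ofReal_ne_top)

lemma l2_le_sum {f : ℤ → ℝ≥0∞} (F : Finset ℤ) (hf : ∀ k ∉ F, f k = 0) : l2 f ≤ ∑ k ∈ F, f k := by
  rw [l2_le_iff, tsum_eq_sum (s := F) fun k hk => by simp [hf k hk], pow_two, Finset.sum_mul]
  refine Finset.sum_le_sum fun k hk => ?_
  rw [pow_two]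
  gcongr
  exact Finset.single_le_sum (f := f) (fun _ _ => zero_le) hk

/-- Low frequencies converge one by one, high frequencies are small in the weaker norm. -/
lemma tendsto_hnorm_sub {ι : Type*} {l : Filter ι} {s σ : ℝ} (hσ : σ < s) {a : ι → ℤ → ℂ}
    {b : ℤ → ℂ} {S : ℝ≥0∞} (hS : S ≠ ⊤) (ha : ∀ᶠ j in l, hnorm s (a j) ≤ S) (hb : hnorm s b ≤ S)
    (hc : ∀ k, Tendsto (fun j => a j k) l (𝓝 (b k))) :
    Tendsto (fun j => hnorm σ (a j - b)) l (𝓝 0) := by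
  have hS2 : S + S ≠ ⊤ := by finiteness
  have htail : Tendsto (fun n : ℕ => ENNReal.ofReal ((n : ℝ) ^ (σ - s)) * (S + S)) atTop (𝓝 0) := by
    have h1 : Tendsto (fun n : ℕ => (n : ℝ) ^ (σ - s)) atTop (𝓝 0) := by
      have := (tendsto_rpow_neg_atTop (sub_pos.2 hσ)).comp tendsto_natCast_atTop_atTop
      simpa [Function.comp_def] using this
    have h2 := ENNReal.Tendsto.mul_const (ENNReal.tendsto_ofReal h1) (.inr hS2)
    simpa using h2
  rw [ENNReal.tendsto_nhds_zero]
  intro ε hε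
  have hε2 : 0 < ε / 2 := ENNReal.half_pos hε.ne'
  obtain ⟨n, hn, hn1⟩ := ((ENNReal.tendsto_nhds_zero.1 htail _ hε2).and
    (eventually_ge_atTop 1)).exists
  set F := Finset.Icc (-(n : ℤ)) n with hF
  have hlow : Tendsto (fun j => ∑ k ∈ F, wt σ k * ‖(a j - b) k‖ₑ) l (𝓝 0) := by
    rw [← Finset.sum_const_zero (ι := ℤ) (s := F)]
    refine tendsto_finsetSum _ fun k _ => ?_
    have h1 : Tendsto (fun j => ‖(a j - b) k‖ₑ) l (𝓝 0) := by
      simpa using ((hc k).sub_const (b k)).enorm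
    simpa [wt] using ENNReal.Tendsto.const_mul h1
      (.inr (ENNReal.ofReal_ne_top (r := |(k : ℝ)| ^ σ)))
  filter_upwards [ENNReal.tendsto_nhds_zero.1 hlow _ hε2, ha] with j hj haj
  have hd : hnorm s (a j - b) ≤ S + S := (hnorm_sub_le s _ _).trans (add_le_add haj hb)
  have hle (k : ℤ) : wt σ k * ‖(a j - b) k‖ₑ ≤ (if k ∈ F then wt σ k * ‖(a j - b) k‖ₑ else 0) +
      ENNReal.ofReal ((n : ℝ) ^ (σ - s)) * (wt s k * ‖(a j - b) k‖ₑ) := by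
    split_ifs with hk
    · exact le_self_add
    · rw [hF, Finset.mem_Icc, ← abs_le, not_le] at hk
      have hk' : (n : ℝ) ≤ |(k : ℝ)| := by exact_mod_cast hk.le
      have hn0 : (0 : ℝ) < n := by exact_mod_cast hn1
      rw [zero_add, ← mul_assoc]
      gcongr
      rw [wt, wt, ← ENNReal.ofReal_mul (by positivity)]
      refine ENNReal.ofReal_le_ofReal ?_
      have : |(k : ℝ)| ^ σ = |(k : ℝ)| ^ (σ - s) * |(k : ℝ)| ^ s := by
        rw [← Real.rpow_add (hn0.trans_le hk')]; ring_nf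
      rw [this]
      gcongr ?_ * _
      exact Real.rpow_le_rpow_of_nonpos hn0 hk' (by linarith)
  calc hnorm σ (a j - b) ≤ _ := l2_mono hle
    _ ≤ _ := l2_add_le _ _
    _ ≤ ε / 2 + ε / 2 := by
        refine add_le_add ((l2_le_sum F fun k hk => if_neg hk).trans ?_) ?_
        · refine le_trans (Finset.sum_le_sum fun k hk => ?_) hj
          rw [if_pos hk]
        · rw [l2_const_mul]
          exact (mul_le_mul_right hd _).trans hn
    _ = ε := ENNReal.add_halves ε

lemma enorm_B₁_sub_le {a b : ℤ → ℂ} {M : ℝ≥0∞} (hM : M ≠ ⊤) (ha : hnorm 0 a ≤ M)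
    (hb : hnorm 0 b ≤ M) (t : ℝ) (k : ℤ) :
    ‖B₁ t a a k - B₁ t b b k‖ₑ ≤ ‖(k : ℂ)‖ₑ * (2 * M * hnorm 0 (a - b)) := by
  rw [hnorm_zero_eq] at ha hb ⊢
  have top : ‖(k : ℂ)‖ₑ * M ^ 2 ≠ ⊤ := by finiteness
  have hχ : ∀ k : ℤ, ‖(fun _ => 1 : ℤ → ℂ) k‖ₑ ≤ 1 := by simp
  have sa := Summable.of_enorm (ne_top_of_le_ne_top top (tsum_enorm_B₁_le hχ ha t k))
  have sb := Summable.of_enorm (ne_top_of_le_ne_top top (tsum_enorm_B₁_le hχ hb t k))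
  rw [← one_mul (B₁ t a a k), ← one_mul (B₁ t b b k), B₁_eq, B₁_eq, ← sa.tsum_sub sb]
  refine enorm_tsum_le_tsum_enorm.trans ?_
  calc _ ≤ ∑' i, ‖(k : ℂ)‖ₑ * (‖(a - b) i‖ₑ * ‖a (k - i)‖ₑ + ‖b i‖ₑ * ‖(a - b) (k - i)‖ₑ) := by
        refine ENNReal.tsum_le_tsum fun i => ?_
        have : (a i * a (k - i)) - b i * b (k - i) =
          (a - b) i * a (k - i) + b i * (a - b) (k - i) := by simp only [Pi.sub_apply]; ring
        rw [← mul_sub, ← mul_sub, this, enorm_mul, enorm_mul (ph _ _), enorm_ph, one_mul (‖_‖ₑ)]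
        gcongr
        · exact enorm_mul_half_le hχ k
        · refine (enorm_add_le _ _).trans_eq ?_
          rw [enorm_mul, enorm_mul]
    _ ≤ _ := by
        rw [ENNReal.tsum_mul_left, ENNReal.tsum_add]
        gcongr
        refine (add_le_add (tsum_mul_le_l2 _ _) (tsum_mul_le_l2 _ _)).trans ?_
        have e (c : ℤ → ℂ) : l2 (fun i => ‖c (k - i)‖ₑ) = l2 (fun i => ‖c i‖ₑ) := by
          rw [l2, tsum_sub_left (fun i => ‖c i‖ₑ ^ 2) k]; rfl
        rw [e, e (a - b), two_mul, add_mul, mul_comm]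
        gcongr

/-- A diagonal form of the Arzelà–Ascoli theorem: equi-Lipschitz coefficients converge along a
subsequence once they converge at rational times. -/
lemma exists_subseq_tendsto {T : ℝ} (hT : 0 ≤ T) (V : ℕ → ℝ → ℤ → ℂ) (C D : ℤ → ℝ)
    (hb : ∀ j, ∀ t ∈ Icc 0 T, ∀ k, ‖V j t k‖ ≤ C k)
    (hl : ∀ j k, ∀ x ∈ Icc 0 T, ∀ y ∈ Icc 0 T, ‖V j y k - V j x k‖ ≤ D k * |y - x|) :
    ∃ φ : ℕ → ℕ, StrictMono φ ∧ ∃ v : ℝ → ℤ → ℂ, ∀ t ∈ Icc 0 T, ∀ k,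
      Tendsto (fun j => V (φ j) t k) atTop (𝓝 (v t k)) := by
  let q (r : ℚ) : ℝ := projIcc 0 T hT r
  have hq (r : ℚ) : q r ∈ Icc 0 T := (projIcc 0 T hT r).2
  have hD (k : ℤ) (x y : ℝ) (j : ℕ) (hx : x ∈ Icc 0 T) (hy : y ∈ Icc 0 T) :
      ‖V j y k - V j x k‖ ≤ |D k| * |y - x| :=
    (hl j k x hx y hy).trans (by gcongr; exact le_abs_self _)
  obtain ⟨x, -, φ, hφ, hx⟩ := (isCompact_univ_pi (X := fun _ : ℚ × ℤ => ℂ)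
    (s := fun i => Metric.closedBall 0 (C i.2)) fun i => isCompact_closedBall 0 _).isSeqCompact
    (x := fun j i => V j (q i.1) i.2) fun j i _ => by simpa using hb j (q i.1) (hq i.1) i.2
  refine ⟨φ, hφ, ?_⟩
  rw [tendsto_pi_nhds] at hx
  have hcauchy (t : ℝ) (ht : t ∈ Icc 0 T) (k : ℤ) : CauchySeq fun j => V (φ j) t k := by
    rw [Metric.cauchySeq_iff']
    intro ε hε
    have hδ : 0 < ε / (4 * (|D k| + 1)) := by positivity
    obtain ⟨r, hr1, hr2⟩ := exists_rat_btwn (lt_add_of_pos_right t hδ)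
    have hr : |q r - t| ≤ ε / (4 * (|D k| + 1)) := by
      have h1 : q r ≤ max t r := by
        simp only [q, coe_projIcc]
        exact max_le (ht.1.trans (le_max_left _ _)) ((min_le_right _ _).trans (le_max_right _ _))
      have h2 : t ≤ q r := by
        simp only [q, coe_projIcc]
        exact (le_min ht.2 hr1.le).trans (le_max_right _ _)
      rw [max_eq_right hr1.le] at h1
      rw [abs_of_nonneg (by linarith)]
      linarith
    have hDr : |D k| * |q r - t| ≤ ε / 4 := by
      calc |D k| * |q r - t| ≤ (|D k| + 1) * (ε / (4 * (|D k| + 1))) := by gcongr; linarith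
        _ = ε / 4 := by field_simp
    obtain ⟨N, hN⟩ := Metric.cauchySeq_iff'.1 (hx (r, k)).cauchySeq (ε / 2) (by positivity)
    refine ⟨N, fun n hn => ?_⟩
    have h1 := hN n hn
    have h2 := hD k (q r) t (φ n) (hq r) ht
    have h3 := hD k t (q r) (φ N) ht (hq r)
    rw [abs_sub_comm] at h2
    simp only [Function.comp_apply] at h1
    rw [dist_eq_norm] at h1 ⊢
    calc ‖V (φ n) t k - V (φ N) t k‖ = ‖(V (φ n) t k - V (φ n) (q r) k) +
          (V (φ n) (q r) k - V (φ N) (q r) k) + (V (φ N) (q r) k - V (φ N) t k)‖ := by congr 1; ring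
      _ ≤ _ := norm_add₃_le
      _ < ε := by linarith
  have hex (t : ℝ) (k : ℤ) : ∃ y, t ∈ Icc 0 T → Tendsto (fun j => V (φ j) t k) atTop (𝓝 y) := by
    by_cases ht : t ∈ Icc 0 T
    · obtain ⟨y, hy⟩ := cauchySeq_tendsto_of_complete (hcauchy t ht k)
      exact ⟨y, fun _ => hy⟩
    · exact ⟨0, fun h => absurd h ht⟩
  choose v hv using hex
  exact ⟨v, fun t ht k => hv t k ht⟩

/-! ### Uniform bounds for the Galerkin solutions -/

lemma enorm_trunc_le (m : ℕ) (a : ℤ → ℂ) (k : ℤ) : ‖trunc m a k‖ₑ ≤ ‖a k‖ₑ := by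
  unfold trunc
  split_ifs <;> simp

lemma hnorm_trunc_le (s : ℝ) (m : ℕ) (a : ℤ → ℂ) : hnorm s (trunc m a) ≤ hnorm s a :=
  l2_mono fun k => by gcongr; exact enorm_trunc_le m a k

lemma hnorm_trunc_le_mul_l2 {s : ℝ} (hs : 0 ≤ s) (m : ℕ) (a : ℤ → ℂ) :
    hnorm s (trunc m a) ≤ wt s m * l2 (fun k => ‖trunc m a k‖ₑ) := by
  rw [← l2_const_mul]
  refine l2_mono fun k => ?_
  by_cases hk : |k| ≤ (m : ℤ)
  · gcongr
    refine ENNReal.ofReal_le_ofReal (Real.rpow_le_rpow (abs_nonneg _) ?_ hs)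
    rw [Int.cast_natCast, Nat.abs_cast]
    exact_mod_cast hk
  · simp [trunc, hk]

/-- The symbol of `Π_m`. -/
def cutoff (m : ℕ) (k : ℤ) : ℂ := if |k| ≤ (m : ℤ) then 1 else 0

lemma enorm_cutoff_le (m : ℕ) (k : ℤ) : ‖cutoff m k‖ₑ ≤ 1 := by
  unfold cutoff
  split_ifs <;> simp

lemma trunc_eq_cutoff_mul (m : ℕ) (a : ℤ → ℂ) (k : ℤ) : trunc m a k = cutoff m k * a k := by
  unfold trunc cutoff
  split_ifs <;> simp

namespace IsGalerkinSolution
variable {m : ℕ} {T : ℝ} {v₀ : ℤ → ℂ} {V : ℝ → ℤ → ℂ}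

lemma continuousOn (h : IsGalerkinSolution m T v₀ V) (k : ℤ) :
    ContinuousOn (fun t => V t k) (Icc 0 T) := by
  rcases eq_or_ne k 0 with rfl | hk
  · exact continuousOn_const.congr fun t ht => h.zero_mode t ht
  · exact fun t ht => (h.deriv t ht k hk).continuousWithinAt

lemma isCurve (h : IsGalerkinSolution m T v₀ V) {L : ℝ≥0∞}
    (hL : ∀ t ∈ Icc 0 T, l2 (fun k => ‖trunc m (V t) k‖ₑ) ≤ L) :
    IsCurve (cutoff m) T L (fun t => trunc m (V t)) := by
  refine ⟨fun t ht => by simp [trunc, h.zero_mode t ht], hL, fun k => ?_⟩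
  have hcont (i : ℤ) : ContinuousOn (fun t => trunc m (V t) i) (Icc 0 T) := by
    simp_rw [trunc_eq_cutoff_mul]
    exact continuousOn_const.mul (h.continuousOn i)
  refine IsPrim.of_hasDerivWithinAt (fun t ht => ?_) ?_
  · simp_rw [trunc_eq_cutoff_mul m _ k]
    rcases eq_or_ne k 0 with rfl | hk
    · have : HasDerivWithinAt (fun _ : ℝ => (0 : ℂ)) 0 (Icc 0 T) t := hasDerivWithinAt_const ..
      refine (this.congr (fun τ hτ => ?_) ?_).congr_deriv ?_
      · simp [h.zero_mode τ hτ]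
      · simp [h.zero_mode t ht]
      · simp [B₁]
    · refine ((h.deriv t ht k hk).const_mul (cutoff m k)).congr_deriv ?_
      rw [trunc]
      split_ifs with hkm <;> simp [cutoff, hkm]
  · refine continuousOn_const.mul ?_
    have hz (t : ℝ) : ∀ k, (m : ℤ) < |k| → trunc m (V t) k = 0 := fun k hk => if_neg (not_le.2 hk)
    simp_rw [fun t => B₁_eq_sum (hz t) t k]
    refine continuousOn_finsetSum _ fun i _ => continuousOn_const.mul ?_
    have : Continuous (ph (θ2 k i)) := by unfold ph; fun_prop
    exact this.continuousOn.mul ((hcont i).mul (hcont (k - i)))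

end IsGalerkinSolution

lemma hnorm_le_of_high_eq {s : ℝ} {m : ℕ} {a b : ℤ → ℂ} (h : ∀ k, (m : ℤ) < |k| → a k = b k) :
    hnorm s a ≤ hnorm s (trunc m a) + hnorm s b := by
  refine (l2_mono fun k => ?_).trans (l2_add_le _ _)
  by_cases hk : |k| ≤ (m : ℤ)
  · simp [trunc, hk]
  · simp [h k (not_le.1 hk)]

lemma l2_eq_of_high_eq {m : ℕ} {a b : ℤ → ℂ} (h : ∀ k, (m : ℤ) < |k| → a k = b k)
    (hlow : l2 (fun k => ‖trunc m a k‖ₑ) = l2 (fun k => ‖trunc m b k‖ₑ)) :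
    hnorm 0 a = hnorm 0 b := by
  have split (c : ℤ → ℂ) : ∑' k, ‖c k‖ₑ ^ 2 =
      l2 (fun k => ‖trunc m c k‖ₑ) ^ 2 + ∑' k, ‖c k - trunc m c k‖ₑ ^ 2 := by
    rw [l2_sq, ← ENNReal.tsum_add]
    refine tsum_congr fun k => ?_
    unfold trunc
    split_ifs <;> simp
  have : ∑' k, ‖a k‖ₑ ^ 2 = ∑' k, ‖b k‖ₑ ^ 2 := by
    rw [split a, split b, hlow]
    congr 2
    funext k
    by_cases hk : |k| ≤ (m : ℤ)
    · simp [trunc, hk]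
    · simp [trunc, hk, h k (not_le.1 hk)]
  rw [hnorm_zero_eq, hnorm_zero_eq, l2, l2, this]

/-- Galerkin solutions with bounds that do not depend on the number of modes. -/
lemma exists_galerkin_bounded {s T : ℝ} (hs : 0 ≤ s) (hT : 0 ≤ T) {L : ℝ≥0∞} (hL : L ≠ ⊤) :
    ∃ K : ℝ≥0∞, K ≠ ⊤ ∧ ∀ v₀ : ℤ → ℂ, MemHdot s v₀ → hnorm 0 v₀ ≤ L → ∀ m, ∃ V : ℝ → ℤ → ℂ,
      IsGalerkinSolution m T v₀ V ∧
      (∀ t ∈ Icc 0 T, ∀ k, V t (-k) = (starRingEnd ℂ) (V t k)) ∧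
      (∀ t ∈ Icc 0 T, hnorm 0 (V t) = hnorm 0 v₀) ∧
      (∀ t ∈ Icc 0 T, hnorm s (V t) ≤ K * hnorm s v₀) ∧
      (∀ t k, (m : ℤ) < |k| → V t k = v₀ k) ∧
      IsCurve (cutoff m) T L (fun t => trunc m (V t)) := by
  obtain ⟨K, hK, hap⟩ := exists_apriori hs hT hL
  refine ⟨K + 1, by finiteness, fun v₀ hv₀ hvL m => ?_⟩
  obtain ⟨V, hV, hreal, hl2, hhigh⟩ := exists_galerkin m hT hv₀.zero_mode hv₀.real_valued
  have hl2L : ∀ t ∈ Icc 0 T, l2 (fun k => ‖trunc m (V t) k‖ₑ) ≤ L := fun t ht => by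
    rw [hl2 t ht, ← hnorm_zero_eq]
    exact (hnorm_trunc_le 0 m v₀).trans hvL
  have hcurve := hV.isCurve hl2L
  refine ⟨V, hV, hreal, fun t ht => l2_eq_of_high_eq (hhigh t) (hl2 t ht), fun t ht => ?_, hhigh,
    hcurve⟩
  have htr := hap (cutoff m) (wt s m * L) _ (enorm_cutoff_le m)
    (ENNReal.mul_ne_top ENNReal.ofReal_ne_top hL) hcurve (fun t ht =>
      (hnorm_trunc_le_mul_l2 hs m (V t)).trans (by gcongr; exact hl2L t ht)) t ht
  refine (hnorm_le_of_high_eq (hhigh t)).trans ?_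
  rw [add_mul, one_mul]
  gcongr
  refine htr.trans ?_
  rw [hV.initial]
  gcongr
  exact hnorm_trunc_le s m v₀

/-! ### Passage to the limit -/

/-- The Galerkin construction for initial data in `Ḣ^s`: a subsequence of the Galerkin solutions
converges coefficientwise, at every time, to a solution. -/
lemma exists_solution {s T : ℝ} (hs : 0 < s) (hT : 0 < T) {L : ℝ≥0∞} (hL : L ≠ ⊤) :
    ∃ K : ℝ≥0∞, K ≠ ⊤ ∧ ∀ v₀ : ℤ → ℂ, MemHdot s v₀ → hnorm 0 v₀ ≤ L →
      ∃ (v : ℝ → ℤ → ℂ) (φ : ℕ → ℕ) (V : ℕ → ℝ → ℤ → ℂ), StrictMono φ ∧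
        (∀ j, IsGalerkinSolution (φ j) T v₀ (V j)) ∧
        (∀ j, ∀ t ∈ Icc 0 T, MemHdot s (V j t) ∧ hnorm s (V j t) ≤ K * hnorm s v₀) ∧
        IsSolution T v₀ v ∧
        (∀ t ∈ Icc 0 T, MemHdot s (v t) ∧ hnorm s (v t) ≤ K * hnorm s v₀ ∧
          hnorm 0 (v t) = hnorm 0 v₀) ∧
        ∀ t ∈ Icc 0 T, ∀ k, Tendsto (fun j => V j t k) atTop (𝓝 (v t k)) := by
  obtain ⟨K, hK, hgal⟩ := exists_galerkin_bounded hs.le hT.le hL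
  refine ⟨K, hK, fun v₀ hv₀ hvL => ?_⟩
  choose W hW hreal hcons hbound hhigh hcurve using hgal v₀ hv₀ hvL
  have h0T : (0 : ℝ) ∈ Icc 0 T := ⟨le_rfl, hT.le⟩
  have hS : K * hnorm s v₀ ≠ ⊤ := ENNReal.mul_ne_top hK hv₀.hnorm_ne_top
  have hderiv (m : ℕ) (k : ℤ) : ∀ t ∈ Icc 0 T,
      ‖cutoff m k * B₁ t (trunc m (W m t)) (trunc m (W m t)) k‖ ≤
        (‖(k : ℂ)‖ₑ * L ^ 2).toReal := fun t ht => by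
    rw [← toReal_enorm]
    exact ENNReal.toReal_mono (by finiteness)
      (enorm_B₁_le (enorm_cutoff_le m) ((hcurve m).l2_le t ht) t k)
  obtain ⟨φ, hφ, v, hv⟩ := exists_subseq_tendsto hT.le W (fun _ => L.toReal)
    (fun k => (‖(k : ℂ)‖ₑ * L ^ 2).toReal) (fun m t ht k => by
      rw [← toReal_enorm]
      refine ENNReal.toReal_mono hL ((le_l2 (fun k => ‖W m t k‖ₑ) k).trans ?_)
      rw [← hnorm_zero_eq, hcons m t ht]
      exact hvL) (fun m k x hx y hy => by
      by_cases hk : |k| ≤ (m : ℤ)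
      · have := ((hcurve m).prim k).norm_sub_le (hderiv m k) hx hy
        simpa [trunc, hk] using this
      · rw [hhigh m x k (not_le.1 hk), hhigh m y k (not_le.1 hk), sub_self, norm_zero]
        positivity)
  have hv0 : v 0 = v₀ := by
    funext k
    refine tendsto_nhds_unique (hv 0 h0T k) ?_
    simp_rw [(hW _).initial]
    exact tendsto_const_nhds
  have hzero : ∀ t ∈ Icc 0 T, v t 0 = 0 := fun t ht => by
    refine tendsto_nhds_unique (hv t ht 0) ?_
    simp_rw [fun j => (hW (φ j)).zero_mode t ht]
    exact tendsto_const_nhds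
  have hvs : ∀ t ∈ Icc 0 T, hnorm s (v t) ≤ K * hnorm s v₀ := fun t ht =>
    hnorm_le_of_tendsto (fun j => hbound (φ j) t ht) (hv t ht)
  have hvL : ∀ t ∈ Icc 0 T, hnorm 0 (v t) ≤ L := fun t ht =>
    hnorm_le_of_tendsto (fun j => (hcons (φ j) t ht).trans_le hvL) (hv t ht)
  have hmem : ∀ t ∈ Icc 0 T, MemHdot s (v t) := fun t ht => by
    refine ⟨hzero t ht, fun k => ?_, summable_iff_hnorm.2 (ne_top_of_le_ne_top hS (hvs t ht))⟩
    refine tendsto_nhds_unique (hv t ht (-k)) ?_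
    simp_rw [fun j => hreal (φ j) t ht k]
    exact (Complex.continuous_conj.tendsto _).comp (hv t ht k)
  have hcoe : Tendsto (fun j => ((φ j : ℕ) : ℤ)) atTop atTop :=
    tendsto_natCast_atTop_atTop.comp hφ.tendsto_atTop
  have htr : ∀ t ∈ Icc 0 T, ∀ k, Tendsto (fun j => trunc (φ j) (W (φ j) t) k) atTop
      (𝓝 (v t k)) := fun t ht k => by
    refine (hv t ht k).congr' ?_
    filter_upwards [hcoe.eventually_ge_atTop |k|] with j hj
    rw [trunc, if_pos hj]
  have hB : ∀ t ∈ Icc 0 T, ∀ k, Tendsto (fun j => cutoff (φ j) k *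
      B₁ t (trunc (φ j) (W (φ j) t)) (trunc (φ j) (W (φ j) t)) k) atTop
      (𝓝 (B₁ t (v t) (v t) k)) := fun t ht k => by
    have h1 : Tendsto (fun j => hnorm 0 (trunc (φ j) (W (φ j) t) - v t)) atTop (𝓝 0) :=
      tendsto_hnorm_sub hs hS (.of_forall fun j => (hnorm_trunc_le _ _ _).trans (hbound (φ j) t ht))
        (hvs t ht) (htr t ht)
    have h2 : Tendsto (fun j => B₁ t (trunc (φ j) (W (φ j) t)) (trunc (φ j) (W (φ j) t)) k) atTop
        (𝓝 (B₁ t (v t) (v t) k)) := by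
      rw [tendsto_iff_edist_tendsto_0]
      simp_rw [edist_eq_enorm_sub]
      have h3 := ENNReal.Tendsto.const_mul (a := ‖(k : ℂ)‖ₑ)
        (ENNReal.Tendsto.const_mul (a := 2 * L) h1 (.inr (by finiteness))) (.inr enorm_ne_top)
      simp only [mul_zero] at h3
      refine tendsto_of_tendsto_of_tendsto_of_le_of_le tendsto_const_nhds h3 (fun _ => zero_le)
        fun j => enorm_B₁_sub_le hL ?_ (hvL t ht) t k
      rw [hnorm_zero_eq]
      exact (hcurve (φ j)).l2_le t ht
    refine h2.congr' ?_
    filter_upwards [hcoe.eventually_ge_atTop |k|] with j hj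
    rw [cutoff, if_pos hj, one_mul]
  have hint : ∀ t ∈ Icc 0 T, ∀ k, v t k - v 0 k = ∫ τ in (0 : ℝ)..t, B₁ τ (v τ) (v τ) k := by
    intro t ht k
    have hsub : uIoc 0 t ⊆ Icc 0 T := by
      rw [uIoc_of_le ht.1]
      exact Ioc_subset_Icc_self.trans (Icc_subset_Icc_right ht.2)
    have h1 : Tendsto (fun j => ∫ τ in (0 : ℝ)..t, cutoff (φ j) k *
        B₁ τ (trunc (φ j) (W (φ j) τ)) (trunc (φ j) (W (φ j) τ)) k) atTop
        (𝓝 (∫ τ in (0 : ℝ)..t, B₁ τ (v τ) (v τ) k)) := by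
      refine intervalIntegral.tendsto_integral_filter_of_dominated_convergence
        (fun _ => (‖(k : ℂ)‖ₑ * L ^ 2).toReal) (.of_forall fun j =>
          ((hcurve (φ j)).prim k).meas.mono_measure (Measure.restrict_mono hsub le_rfl))
        (.of_forall fun j => .of_forall fun τ hτ => hderiv (φ j) k τ (hsub hτ))
        intervalIntegrable_const (.of_forall fun τ hτ => hB τ (hsub hτ) k)
    refine tendsto_nhds_unique ((htr t ht k).sub (htr 0 h0T k)) (h1.congr fun j => ?_)
    exact (((hcurve (φ j)).prim k).sub_eq h0T ht).symm
  have hcont (k : ℤ) : AEMeasurable (fun t => v t k) (volume.restrict (Icc 0 T)) := by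
    refine aemeasurable_of_tendsto_metrizable_ae atTop (f := fun j t => W (φ j) t k)
      (fun j => ((hW (φ j)).continuousOn k).aemeasurable measurableSet_Icc) ?_
    exact (ae_restrict_iff' measurableSet_Icc).2 (.of_forall fun t ht => hv t ht k)
  refine ⟨v, φ, fun j => W (φ j), hφ, fun j => hW (φ j), fun j t ht => ⟨⟨(hW (φ j)).zero_mode t ht,
    hreal (φ j) t ht, summable_iff_hnorm.2 (ne_top_of_le_ne_top hS (hbound (φ j) t ht))⟩,
    hbound (φ j) t ht⟩, ⟨⟨hcont, L.toReal, ?_⟩, hzero, hv0, fun t ht k _ => hint t ht k⟩,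
    fun t ht => ⟨hmem t ht, hvs t ht, ?_⟩, hv⟩
  · refine (ae_restrict_iff' measurableSet_Icc).2 (.of_forall fun t ht => ⟨⟨hzero t ht,
      (hmem t ht).real_valued, summable_iff_hnorm.2 (ne_top_of_le_ne_top hL (hvL t ht))⟩, ?_⟩)
    rw [normHdot_eq_toReal]
    exact ENNReal.toReal_mono hL (hvL t ht)
  · have h1 : Tendsto (fun j => hnorm 0 (W (φ j) t - v t)) atTop (𝓝 0) :=
      tendsto_hnorm_sub hs hS (.of_forall fun j => hbound (φ j) t ht) (hvs t ht)
        (hv t ht)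
    refine le_antisymm (hnorm_le_of_tendsto (fun j => (hcons (φ j) t ht).le) (hv t ht)) ?_
    have h2 : Tendsto (fun j => hnorm 0 (W (φ j) t - v t) + hnorm 0 (v t)) atTop
        (𝓝 (0 + hnorm 0 (v t))) := h1.add_const _
    rw [zero_add] at h2
    refine ge_of_tendsto' h2 fun j => ?_
    rw [← hcons (φ j) t ht]
    refine le_trans (le_of_eq ?_) (hnorm_add_le 0 _ _)
    simp

/-! ### Modes of convergence -/

lemma aemeasurable_hnorm {μ : Measure ℝ} {u : ℝ → ℤ → ℂ}
    (hu : ∀ k, AEMeasurable (fun t => u t k) μ) (s : ℝ) :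
    AEMeasurable (fun t => hnorm s (u t)) μ := by
  unfold hnorm l2
  exact (AEMeasurable.tsum fun k =>
    (((hu k).enorm.const_mul (wt s k)).pow_const 2)).pow_const _

lemma ae_Icc {T : ℝ} {p : ℝ → Prop} (h : ∀ t ∈ Icc 0 T, p t) :
    ∀ᵐ t ∂(volume.restrict (Icc 0 T)), p t :=
  (ae_restrict_iff' measurableSet_Icc).2 (.of_forall h)

lemma memLinfty_of_forall {s T : ℝ} {u : ℝ → ℤ → ℂ} {S : ℝ≥0∞} (hS : S ≠ ⊤)
    (hm : ∀ k, AEMeasurable (fun t => u t k) (volume.restrict (Icc 0 T)))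
    (hu : ∀ t ∈ Icc 0 T, MemHdot s (u t) ∧ hnorm s (u t) ≤ S) : MemLinfty s T u := by
  refine ⟨hm, S.toReal, ae_Icc fun t ht => ⟨(hu t ht).1, ?_⟩⟩
  rw [normHdot_eq_toReal]
  exact ENNReal.toReal_mono hS (hu t ht).2

section convergence
variable {s T : ℝ} {V : ℕ → ℝ → ℤ → ℂ} {v : ℝ → ℤ → ℂ} {S : ℝ≥0∞}

lemma tendstoLp_of_tendsto {σ p : ℝ} (hσ : σ < s) (hp : 0 < p) (hS : S ≠ ⊤)
    (hVm : ∀ j k, AEMeasurable (fun t => V j t k) (volume.restrict (Icc 0 T)))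
    (hvm : ∀ k, AEMeasurable (fun t => v t k) (volume.restrict (Icc 0 T)))
    (hV : ∀ j, ∀ t ∈ Icc 0 T, MemHdot s (V j t) ∧ hnorm s (V j t) ≤ S)
    (hv : ∀ t ∈ Icc 0 T, MemHdot s (v t) ∧ hnorm s (v t) ≤ S)
    (h : ∀ t ∈ Icc 0 T, ∀ k, Tendsto (fun j => V j t k) atTop (𝓝 (v t k))) :
    TendstoLp σ T p V v := by
  have hle (j : ℕ) : ∀ t ∈ Icc 0 T, hnorm σ (V j t - v t) ≤ S + S := fun t ht => by
    refine (hnorm_sub_le σ _ _).trans (add_le_add ?_ ?_)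
    · exact (hnorm_mono_exponent hσ.le (hV j t ht).1.zero_mode).trans (hV j t ht).2
    · exact (hnorm_mono_exponent hσ.le (hv t ht).1.zero_mode).trans (hv t ht).2
  have hofReal (j : ℕ) : ∀ t ∈ Icc 0 T,
      ENNReal.ofReal (normHdot σ (V j t - v t)) = hnorm σ (V j t - v t) := fun t ht =>
    ofReal_normHdot (ne_top_of_le_ne_top (by finiteness) (hle j t ht))
  have e (j : ℕ) : ∫⁻ t in Icc 0 T, ENNReal.ofReal (normHdot σ (V j t - v t)) ^ p =
      ∫⁻ t in Icc 0 T, hnorm σ (V j t - v t) ^ p :=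
    lintegral_congr_ae (ae_Icc fun t ht => by simp only [hofReal j t ht])
  unfold TendstoLp
  simp_rw [e]
  have := tendsto_lintegral_of_dominated_convergence' (μ := volume.restrict (Icc 0 T))
    (F := fun j t => hnorm σ (V j t - v t) ^ p) (f := fun _ => 0) (fun _ => (S + S) ^ p)
    (fun j => (aemeasurable_hnorm (fun k => (hVm j k).sub (hvm k)) σ).pow_const p)
    (fun j => ae_Icc fun t ht => ENNReal.rpow_le_rpow (hle j t ht) hp.le)
    (by
      rw [lintegral_const]
      exact ENNReal.mul_ne_top (ENNReal.rpow_ne_top_of_nonneg hp.le (by finiteness)) (by simp))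
    (ae_Icc fun t ht => by
      have h1 := tendsto_hnorm_sub hσ hS (.of_forall fun j => (hV j t ht).2) (hv t ht).2 (h t ht)
      have h2 := (ENNReal.continuous_rpow_const (y := p)).continuousAt.tendsto.comp h1
      simpa [ENNReal.zero_rpow_of_pos hp, Function.comp_def] using h2)
  simpa using this

lemma enorm_mul_conj_le {a g : ℤ → ℂ} (ha : a 0 = 0) (s : ℝ) (k : ℤ) :
    ‖a k * (starRingEnd ℂ) (g k)‖ₑ ≤ (wt s k * ‖a k‖ₑ) * (wt (-s) k * ‖g k‖ₑ) := by
  rcases eq_or_ne k 0 with rfl | hk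
  · simp [ha]
  · have hk' : 0 < |(k : ℝ)| := by positivity
    have hw : wt s k * wt (-s) k = 1 := by
      rw [wt, wt, ← ENNReal.ofReal_mul (by positivity), ← Real.rpow_add hk']
      simp
    rw [enorm_mul, RCLike.enorm_conj]
    calc ‖a k‖ₑ * ‖g k‖ₑ = (wt s k * wt (-s) k) * (‖a k‖ₑ * ‖g k‖ₑ) := by rw [hw, one_mul]
      _ ≤ _ := le_of_eq (by ring)

/-- The duality between `Ḣ^s` and `Ḣ^(-s)`. -/
lemma tsum_enorm_mul_conj_le {a g : ℤ → ℂ} (ha : a 0 = 0) (s : ℝ) :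
    ∑' k, ‖a k * (starRingEnd ℂ) (g k)‖ₑ ≤ hnorm s a * hnorm (-s) g :=
  (ENNReal.tsum_le_tsum (enorm_mul_conj_le ha s)).trans (tsum_mul_le_l2 _ _)

/-- Coefficientwise convergence of a bounded sequence in `Ḣ^s` is weak convergence. -/
lemma tendsto_tsum_mul_conj {a : ℕ → ℤ → ℂ} {b g : ℤ → ℂ} (hS : S ≠ ⊤)
    (ha : ∀ j, hnorm s (a j) ≤ S) (hb : hnorm s b ≤ S) (ha0 : ∀ j, a j 0 = 0) (hb0 : b 0 = 0)
    (hg : hnorm (-s) g ≠ ⊤) (hc : ∀ k, Tendsto (fun j => a j k) atTop (𝓝 (b k))) :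
    Tendsto (fun j => ∑' k, a j k * (starRingEnd ℂ) (g k)) atTop
      (𝓝 (∑' k, b k * (starRingEnd ℂ) (g k))) := by
  have hg2 : ∑' k, (wt (-s) k * ‖g k‖ₑ) ^ 2 ≠ ⊤ := by
    rw [← l2_sq]
    exact ENNReal.pow_ne_top hg
  have htail : Tendsto (fun F : Finset ℤ => (S + S) *
      (∑' k : {x // x ∉ F}, (wt (-s) k * ‖g k‖ₑ) ^ 2) ^ (1 / 2 : ℝ)) atTop (𝓝 0) := by
    have h1 := (ENNReal.continuous_rpow_const (y := 1 / 2)).continuousAt.tendsto.comp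
      (ENNReal.tendsto_tsum_compl_atTop_zero hg2)
    have h2 := ENNReal.Tendsto.const_mul h1 (.inr (by finiteness : S + S ≠ ⊤))
    simpa [Function.comp_def] using h2
  rw [tendsto_iff_edist_tendsto_0, ENNReal.tendsto_nhds_zero]
  intro ε hε
  have hε2 : 0 < ε / 2 := ENNReal.half_pos hε.ne'
  obtain ⟨F, hF⟩ := (ENNReal.tendsto_nhds_zero.1 htail _ hε2).exists
  have hlow : Tendsto (fun j => ∑ k ∈ F, ‖(a j - b) k * (starRingEnd ℂ) (g k)‖ₑ) atTop (𝓝 0) := by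
    rw [← Finset.sum_const_zero (ι := ℤ) (s := F)]
    refine tendsto_finsetSum _ fun k _ => ?_
    simpa using (((hc k).sub_const (b k)).mul_const ((starRingEnd ℂ) (g k))).enorm
  filter_upwards [ENNReal.tendsto_nhds_zero.1 hlow _ hε2] with j hj
  have hd : hnorm s (a j - b) ≤ S + S := (hnorm_sub_le s _ _).trans (add_le_add (ha j) hb)
  have hd0 : (a j - b) 0 = 0 := by simp [ha0, hb0]
  have hsum {c : ℤ → ℂ} (hc0 : c 0 = 0) (hcS : hnorm s c ≤ S) :
      Summable fun k => c k * (starRingEnd ℂ) (g k) :=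
    .of_enorm (ne_top_of_le_ne_top (ENNReal.mul_ne_top (ne_top_of_le_ne_top hS hcS) hg)
      (tsum_enorm_mul_conj_le hc0 s))
  rw [edist_eq_enorm_sub, ← (hsum (ha0 j) (ha j)).tsum_sub (hsum hb0 hb)]
  simp_rw [← sub_mul]
  refine enorm_tsum_le_tsum_enorm.trans ?_
  have hsplit : ∑' k, ‖(a j - b) k * (starRingEnd ℂ) (g k)‖ₑ =
      ∑ k ∈ F, ‖(a j - b) k * (starRingEnd ℂ) (g k)‖ₑ +
        ∑' k : {x // x ∉ F}, ‖(a j - b) k * (starRingEnd ℂ) (g k)‖ₑ :=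
    (ENNReal.sum_add_tsum_compl F fun k => ‖(a j - b) k * (starRingEnd ℂ) (g k)‖ₑ).symm
  refine hsplit.trans_le ?_
  rw [← ENNReal.add_halves ε]
  refine add_le_add hj (le_trans ?_ hF)
  calc _ ≤ ∑' k : {x // x ∉ F}, (wt s k * ‖(a j - b) k‖ₑ) * (wt (-s) k * ‖g k‖ₑ) :=
        ENNReal.tsum_le_tsum fun k => enorm_mul_conj_le hd0 s k
    _ ≤ _ := tsum_mul_le_l2 _ _
    _ ≤ _ := by
        refine mul_le_mul' (le_trans ?_ hd) le_rfl
        rw [l2_le_iff, hnorm, l2_sq]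
        exact ENNReal.tsum_comp_le_tsum_of_injective Subtype.val_injective _

lemma tendstoWeakStar_of_tendsto (hT : 0 ≤ T) (hS : S ≠ ⊤)
    (hVm : ∀ j k, AEMeasurable (fun t => V j t k) (volume.restrict (Icc 0 T)))
    (hV : ∀ j, ∀ t ∈ Icc 0 T, MemHdot s (V j t) ∧ hnorm s (V j t) ≤ S)
    (hv : ∀ t ∈ Icc 0 T, MemHdot s (v t) ∧ hnorm s (v t) ≤ S)
    (h : ∀ t ∈ Icc 0 T, ∀ k, Tendsto (fun j => V j t k) atTop (𝓝 (v t k))) :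
    TendstoWeakStar s T V v := by
  intro g hg
  simp_rw [intervalIntegral.integral_of_le hT, ← integral_Icc_eq_integral_Ioc]
  have hgm := aemeasurable_hnorm hg.aemeasurable (-s)
  have hgfin : ∫⁻ t in Icc 0 T, S * hnorm (-s) (g t) ≠ ⊤ := by
    rw [lintegral_const_mul'' _ hgm]
    refine ENNReal.mul_ne_top hS ?_
    rw [← lintegral_congr_ae (f := fun t => ENNReal.ofReal (normHdot (-s) (g t)))]
    · exact hg.finite.ne
    · filter_upwards [hg.mem] with t ht using ofReal_normHdot ht.hnorm_ne_top
  refine tendsto_integral_of_dominated_convergence (fun t => (S * hnorm (-s) (g t)).toReal)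
    (fun j => ?_) (integrable_toReal_of_lintegral_ne_top (hgm.const_mul S) hgfin) (fun j => ?_) ?_
  · refine aestronglyMeasurable_of_tendsto_ae (u := (atTop : Filter (Finset ℤ)))
      (f := fun F t => ∑ k ∈ F, V j t k * (starRingEnd ℂ) (g t k))
      (fun F => Finset.aestronglyMeasurable_fun_sum F fun k _ => ?_) ?_
    · exact ((hVm j k).mul (Complex.continuous_conj.measurable.comp_aemeasurable
        (hg.aemeasurable k))).aestronglyMeasurable
    · filter_upwards [hg.mem, ae_Icc (hV j)] with t hgt hVt
      refine (Summable.of_enorm ?_).hasSum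
      exact ne_top_of_le_ne_top (ENNReal.mul_ne_top hVt.1.hnorm_ne_top hgt.hnorm_ne_top)
        (tsum_enorm_mul_conj_le hVt.1.zero_mode s)
  · filter_upwards [hg.mem, ae_Icc (hV j)] with t hgt hVt
    rw [← toReal_enorm]
    refine ENNReal.toReal_mono (ENNReal.mul_ne_top hS hgt.hnorm_ne_top) ?_
    refine enorm_tsum_le_tsum_enorm.trans ((tsum_enorm_mul_conj_le hVt.1.zero_mode s).trans ?_)
    gcongr
    exact hVt.2
  · filter_upwards [hg.mem, ae_restrict_mem measurableSet_Icc] with t hgt ht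
    exact tendsto_tsum_mul_conj hS (fun j => (hV j t ht).2) (hv t ht).2
      (fun j => (hV j t ht).1.zero_mode) (hv t ht).1.zero_mode hgt.hnorm_ne_top (h t ht)

end convergence

/-! ### Continuity in time and dependence on the initial data -/

/-- Every solution with initial data in `Ḣ^s` is the one given by the Galerkin construction, hence
bounded in `Ḣ^s`. -/
lemma exists_bound_of_isSolution {s T : ℝ} (hs : 0 < s) (hT : 0 < T) {R : ℝ≥0∞} (hR : R ≠ ⊤) :
    ∃ K : ℝ≥0∞, K ≠ ⊤ ∧ ∀ (v₀ : ℤ → ℂ) (v : ℝ → ℤ → ℂ), MemHdot s v₀ → hnorm s v₀ ≤ R →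
      IsSolution T v₀ v → ∀ t ∈ Icc 0 T, MemHdot s (v t) ∧ hnorm s (v t) ≤ K := by
  obtain ⟨K, hK, h⟩ := exists_solution hs hT hR
  refine ⟨K * R, ENNReal.mul_ne_top hK hR, fun v₀ v hv₀ hvR hv t ht => ?_⟩
  obtain ⟨w, -, -, -, -, -, hw, hb, -⟩ :=
    h v₀ hv₀ ((hnorm_mono_exponent hs.le hv₀.zero_mode).trans hvR)
  rw [hw.unique hT hv t ht]
  exact ⟨(hb t ht).1, (hb t ht).2.1.trans (by gcongr)⟩

lemma exists_lipschitz_of_isSolution {s T : ℝ} (hs : 0 < s) (hT : 0 < T) {R : ℝ≥0∞} (hR : R ≠ ⊤) :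
    ∃ K : ℝ≥0∞, K ≠ ⊤ ∧ ∀ (v₀ w₀ : ℤ → ℂ) (v w : ℝ → ℤ → ℂ), MemHdot s v₀ → MemHdot s w₀ →
      hnorm s v₀ ≤ R → hnorm s w₀ ≤ R → IsSolution T v₀ v → IsSolution T w₀ w →
      ∀ t ∈ Icc 0 T, hnorm s (w t - v t) ≤ K * hnorm s (w₀ - v₀) := by
  obtain ⟨K₁, hK₁, hb⟩ := exists_bound_of_isSolution hs hT hR
  obtain ⟨K₂, hK₂, hl⟩ := exists_lipschitz_hnorm hs.le hT.le (L := K₁ + K₁) (by finiteness)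
  refine ⟨K₂, hK₂, fun v₀ w₀ v w hv₀ hw₀ hvR hwR hv hw t ht => ?_⟩
  obtain ⟨M₁, hM₁, hcv⟩ := hv.isCurve hT
  obtain ⟨M₂, hM₂, hcw⟩ := hw.isCurve hT
  have := hl _ (M₁ + M₂) w v (by simp) (by finiteness) (hcw.mono le_add_self)
    (hcv.mono le_self_add) (fun t ht => add_le_add (hb w₀ w hw₀ hwR hw t ht).2
      (hb v₀ v hv₀ hvR hv t ht).2) t ht
  rwa [hv.initial, hw.initial] at this

/-- Trigonometric polynomials belong to all the spaces `Ḣ^r`. -/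
lemma MemHdot.trunc {s : ℝ} {a : ℤ → ℂ} (ha : MemHdot s a) (r : ℝ) (m : ℕ) :
    MemHdot r (trunc m a) := by
  refine ⟨by simp [PeriodicKdV.trunc, ha.zero_mode], fun k => ?_, ?_⟩
  · simp only [PeriodicKdV.trunc, abs_neg]
    split_ifs
    · exact ha.real_valued k
    · simp
  · refine summable_of_ne_finset_zero (s := Finset.Icc (-(m : ℤ)) m) fun k hk => ?_
    rw [Finset.mem_Icc, ← abs_le] at hk
    simp [PeriodicKdV.trunc, hk]

lemma MemHdot.tendsto_trunc {s : ℝ} {a : ℤ → ℂ} (ha : MemHdot s a) :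
    Tendsto (fun m : ℕ => hnorm s (a - PeriodicKdV.trunc m a)) atTop (𝓝 0) := by
  have hsub (m : ℕ) (k : ℤ) : ‖(a - PeriodicKdV.trunc m a) k‖ ≤ ‖a k‖ := by
    rw [Pi.sub_apply, PeriodicKdV.trunc]
    split_ifs <;> simp
  have h1 : Tendsto (fun m : ℕ => normHdot s (a - PeriodicKdV.trunc m a)) atTop (𝓝 0) := by
    have h2 : Tendsto (fun m : ℕ => ∑' k : ℤ, |(k : ℝ)| ^ (2 * s) *
        ‖(a - PeriodicKdV.trunc m a) k‖ ^ 2) atTop (𝓝 (∑' _ : ℤ, (0 : ℝ))) := by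
      refine tendsto_tsum_of_dominated_convergence ha.summable (fun k => ?_)
        (.of_forall fun m k => ?_)
      · refine tendsto_const_nhds.congr' ?_
        filter_upwards [tendsto_natCast_atTop_atTop.eventually_ge_atTop |k|] with m hm
        simp [PeriodicKdV.trunc, hm]
      · rw [Real.norm_of_nonneg (by positivity)]
        gcongr
        exact hsub m k
    unfold normHdot
    simpa using h2.sqrt
  have hfin (m : ℕ) : hnorm s (a - PeriodicKdV.trunc m a) ≠ ⊤ := by
    refine ne_top_of_le_ne_top ha.hnorm_ne_top (l2_mono fun k => ?_)
    gcongr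
    exact enorm_le_iff_norm_le.2 (hsub m k)
  have h3 := ENNReal.tendsto_ofReal h1
  simp_rw [fun m => ofReal_normHdot (hfin m)] at h3
  simpa using h3

/-- Solutions with initial data in `Ḣ^s` are uniform limits of solutions with smooth initial data,
which are continuous by interpolation with a bound in `Ḣ^(s+1)`. -/
lemma IsSolution.memC {s T : ℝ} (hs : 0 < s) (hT : 0 < T) {v₀ : ℤ → ℂ} (hv₀ : MemHdot s v₀)
    {v : ℝ → ℤ → ℂ} (hv : IsSolution T v₀ v) : MemC s T v := by
  set R := hnorm s v₀ with hRdef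
  have hR : R ≠ ⊤ := hv₀.hnorm_ne_top
  obtain ⟨B, hB, hbd⟩ := exists_bound_of_isSolution hs hT hR
  obtain ⟨K, hK, hlip⟩ := exists_lipschitz_of_isSolution hs hT hR
  obtain ⟨K', hK', hsol⟩ := exists_solution (s := s + 1) (by linarith) hT hR
  refine ⟨fun t ht => (hbd v₀ v hv₀ le_rfl hv t ht).1, fun t₀ ht₀ => ?_⟩
  suffices h : Tendsto (fun t => hnorm s (v t - v t₀)) (𝓝[Icc 0 T] t₀) (𝓝 0) by
    simp_rw [normHdot_eq_toReal]
    simpa [Function.comp_def] using (ENNReal.tendsto_toReal ENNReal.zero_ne_top).comp h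
  rw [ENNReal.tendsto_nhds_zero]
  intro ε hε
  have hε3 : 0 < ε / 3 := ENNReal.div_pos hε.ne' (by norm_num)
  have hK0 : Tendsto (fun m : ℕ => K * hnorm s (v₀ - trunc m v₀)) atTop (𝓝 0) := by
    simpa using ENNReal.Tendsto.const_mul hv₀.tendsto_trunc (.inr hK)
  obtain ⟨m, hm⟩ := (ENNReal.tendsto_nhds_zero.1 hK0 _ hε3).exists
  obtain ⟨w, -, -, -, -, -, hw, hwb, -⟩ := hsol (trunc m v₀) (hv₀.trunc (s + 1) m)
    ((hnorm_trunc_le 0 m v₀).trans (hnorm_mono_exponent hs.le hv₀.zero_mode))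
  have hclose : ∀ t ∈ Icc 0 T, hnorm s (v t - w t) ≤ ε / 3 := fun t ht =>
    (hlip (trunc m v₀) v₀ w v (hv₀.trunc s m) hv₀ (hnorm_trunc_le s m v₀) le_rfl hw hv t
      ht).trans hm
  obtain ⟨M, -, hcw⟩ := hw.isCurve hT
  have hwc : Tendsto (fun t => hnorm s (w t - w t₀)) (𝓝[Icc 0 T] t₀) (𝓝 0) := by
    refine tendsto_hnorm_sub (s := s + 1) (by linarith)
      (ENNReal.mul_ne_top hK' (hv₀.trunc (s + 1) m).hnorm_ne_top) ?_ (hwb t₀ ht₀).2.1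
      fun k => (hcw.prim k).continuousOn t₀ ht₀
    filter_upwards [self_mem_nhdsWithin] with t ht using (hwb t ht).2.1
  filter_upwards [ENNReal.tendsto_nhds_zero.1 hwc _ hε3, self_mem_nhdsWithin] with t hwt ht
  calc hnorm s (v t - v t₀) = hnorm s ((v t - w t) + (w t - w t₀) - (v t₀ - w t₀)) := by
        congr 1; abel
    _ ≤ hnorm s (v t - w t) + hnorm s (w t - w t₀) + hnorm s (v t₀ - w t₀) :=
        (hnorm_sub_le s _ _).trans (by gcongr; exact hnorm_add_le s _ _)
    _ ≤ ε / 3 + ε / 3 + ε / 3 := by gcongr; exacts [hclose t ht, hclose t₀ ht₀]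
    _ = ε := ENNReal.add_thirds ε

end PeriodicKdV

theorem theoremT (s : ℝ) (hs : 1 / 2 < s) (T : ℝ) (hT : 0 < T) :
    -- the solution given by the Galerkin construction: uniqueness, continuity, conservation
    (∀ v₀ : ℤ → ℂ, PeriodicKdV.MemHdot s v₀ →
      ∃ v : ℝ → ℤ → ℂ,
        (∀ σ : ℝ, 0 < σ → σ < s → PeriodicKdV.IsGalerkinLimit s σ T v₀ v) ∧
        PeriodicKdV.IsSolution T v₀ v ∧
        (∀ w : ℝ → ℤ → ℂ, PeriodicKdV.IsSolution T v₀ w → ∀ t ∈ Set.Icc 0 T, w t = v t) ∧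
        PeriodicKdV.MemC s T v ∧
        (∀ t ∈ Set.Icc 0 T,
          PeriodicKdV.normHdot 0 (v t) = PeriodicKdV.normHdot 0 v₀)) ∧
    -- Lipschitz dependence on the initial data, with constants depending on
    -- `s`, `T` and the sum of the norms of the initial data only
    (∃ C' Tstar : ℝ → ℝ, (∀ R, 0 ≤ C' R) ∧ (∀ R, 0 < Tstar R) ∧
      ∀ v₀ w₀ : ℤ → ℂ, PeriodicKdV.MemHdot s v₀ → PeriodicKdV.MemHdot s w₀ →
      ∀ v w : ℝ → ℤ → ℂ, PeriodicKdV.IsSolution T v₀ v → PeriodicKdV.IsSolution T w₀ w →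
      ∀ t ∈ Set.Icc 0 T,
        PeriodicKdV.normHdot s (w t - v t) ≤
          (C' (PeriodicKdV.normHdot s v₀ + PeriodicKdV.normHdot s w₀) + 1) ^
              (⌊T / Tstar (PeriodicKdV.normHdot s v₀ + PeriodicKdV.normHdot s w₀)⌋₊ + 1) *
            PeriodicKdV.normHdot s (w₀ - v₀)) := by
  open PeriodicKdV in
  have hs0 : 0 < s := by linarith
  constructor
  · intro v₀ hv₀
    obtain ⟨K, hK, h⟩ := exists_solution hs0 hT
      (ne_top_of_le_ne_top hv₀.hnorm_ne_top (hnorm_mono_exponent hs0.le hv₀.zero_mode))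
    obtain ⟨v, φ, V, hφ, hV, hVb, hv, hvb, hlim⟩ := h v₀ hv₀ le_rfl
    have hS : K * hnorm s v₀ ≠ ⊤ := ENNReal.mul_ne_top hK hv₀.hnorm_ne_top
    have hvb' : ∀ t ∈ Set.Icc 0 T, MemHdot s (v t) ∧ hnorm s (v t) ≤ K * hnorm s v₀ :=
      fun t ht => ⟨(hvb t ht).1, (hvb t ht).2.1⟩
    have hVm (j : ℕ) (k : ℤ) : AEMeasurable (fun t => V j t k) (volume.restrict (Set.Icc 0 T)) :=
      ((hV j).continuousOn k).aemeasurable measurableSet_Icc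
    refine ⟨v, fun σ _ hσs => ⟨memLinfty_of_forall hS hv.memLinfty.aemeasurable hvb', φ, V, hφ,
      fun j => ⟨hV j, memLinfty_of_forall hS (hVm j) (hVb j)⟩, fun p hp => ?_, ?_⟩, hv,
      fun w hw => hv.unique hT hw, hv.memC hs0 hT hv₀, fun t ht => ?_⟩
    · exact tendstoLp_of_tendsto hσs (by linarith) hS hVm hv.memLinfty.aemeasurable hVb hvb' hlim
    · exact tendstoWeakStar_of_tendsto hT.le hS hVm hVb hvb' hlim
    · rw [normHdot_eq_toReal, normHdot_eq_toReal, (hvb t ht).2.2]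
  · choose K hK hlip using fun R : ℝ =>
      exists_lipschitz_of_isSolution hs0 hT (ENNReal.ofReal_ne_top (r := R))
    -- the estimate holds on the whole interval at once, with a constant bounded by the power
    refine ⟨fun R => (K R).toReal, fun _ => 1, fun R => ENNReal.toReal_nonneg, fun _ => one_pos,
      fun v₀ w₀ hv₀ hw₀ v w hv hw t ht => ?_⟩
    have hnn (a : ℤ → ℂ) : 0 ≤ normHdot s a := Real.sqrt_nonneg _
    set R := normHdot s v₀ + normHdot s w₀ with hR
    have hfin : hnorm s (w₀ - v₀) ≠ ⊤ := ne_top_of_le_ne_top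
      (ENNReal.add_ne_top.2 ⟨hw₀.hnorm_ne_top, hv₀.hnorm_ne_top⟩) (hnorm_sub_le s w₀ v₀)
    have h1 := hlip R v₀ w₀ v w hv₀ hw₀
      (by
        rw [← ofReal_normHdot hv₀.hnorm_ne_top]
        exact ENNReal.ofReal_le_ofReal (le_add_of_nonneg_right (hnn w₀)))
      (by
        rw [← ofReal_normHdot hw₀.hnorm_ne_top]
        exact ENNReal.ofReal_le_ofReal (le_add_of_nonneg_left (hnn v₀))) hv hw t ht
    have h2 : normHdot s (w t - v t) ≤ (K R).toReal * normHdot s (w₀ - v₀) := by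
      rw [normHdot_eq_toReal, normHdot_eq_toReal, ← ENNReal.toReal_mul]
      exact ENNReal.toReal_mono (ENNReal.mul_ne_top (hK R) hfin) h1
    refine h2.trans ?_
    have hnonneg : 0 ≤ (K R).toReal := ENNReal.toReal_nonneg
    gcongr
    · exact hnn _
    · exact (le_add_of_nonneg_right zero_le_one).trans
        (le_self_pow₀ (by linarith) (Nat.succ_ne_zero _))
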